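/- Conventions. Let $n$ be a positive integer and $[n]=\{1,\dots,n\}$. Realize $S_n$ as the permutations of $\mathbb{Z}_{>0}$ fixing all $i>n$, so $S_n\subset S_{n+1}$; let $s_i=(i,i+1)$, $t_{ij}=(i,j)$, and let $\ell$ be the Coxeter length. Let $\mathcal I_n=\{w\in S_n: w=w^{-1}\}$ and let $\mathcal I^{\mathsf{fpf}}_n$ be the set of $w\in\mathcal I_n$ with $w(i)\ne i$ for all $i\in[n]$. Pipe dreams. For a set $D$ of cells $(i,j)\in[n]\times[n]$ with $i+j\le n$ (row $i$, column $j$, matrix coordinates), form the wiring diagram with a crossing tile at each cell of $D$ and, at every other cell, a tile in which the two paths bend away from each other (joining left edge to top edge and bottom edge to right edge). $D$ is a reduced pipe dream for $w\in S_n$, written $D\in\mathcal{PD}(w)$, if no two pipes cross more than once and the pipe with left endpoint $p$ has top endpoint $w(p)$ for every $p\in[n]$. $D$ is symmetric if $(i,j)\in D$ implies $(j,i)\in D$. It is almost-symmetric if, for all $i<j$, (1) $(i,j)\in D$ implies $(j,i)\in D$, and (2) if $(j,i)\in D$ but $(i,j)\notin D$, then the two pipes crossing at $(j,i)$ are also the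 two pipes avoiding each other at $(i,j)$. Set $$\mathcal{ID}(y)=\{D\cap\{(j,i)\in[n]^2: i\le j\} : D\in\mathcal{PD}(y)\text{ almost-symmetric}\}\quad (y\in\mathcal I_n),$$ $$\mathcal{FD}(z)=\{D\cap\{(j,i)\in[n]^2: i<j\} : D\in\mathcal{PD}(z)\text{ symmetric}\}\quad (z\in\mathcal I_n^{\mathsf{fpf}}).$$ Outer corners. The dominant component $\mathrm{dom}(w)$ of $w\in S_n$ is the union of all lower sets of $(\mathbb{Z}_{>0}\times\mathbb{Z}_{>0},\text{componentwise order})$ contained in the Rothe diagram $\{(i,j)\in[n]^2: w(i)>j,\ w^{-1}(j)>i\}$. An outer corner of $w$ is a cell $c\in\mathbb{Z}_{>0}\times\mathbb{Z}_{>0}$, $c\notin\mathrm{dom}(w)$, such that $\mathrm{dom}(w)\sqcup\{c\}$ is the Ferrers diagram of a partition. The sets $\Psi$. Let $\circ$ be the Demazure product on $S_n$. For $y\in\mathcal I_n$ let $\mathcal A(y)$ be the set of minimal-length $w\in S_n$ with $w^{-1}\circ w=y$, let $\hat\ell(y)$ be the common length of its elements, and for $i<j$ let $\mathcal A_{ij}(y)=\{wt_{ij}: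 w\in\mathcal A(y),\ \ell(wt_{ij})=\ell(w)+1\}$. Let $\tau_{ij}(y)$ be the (unique) $z\in\mathcal I_n$ with $\mathcal A_{ij}(y)\cap\mathcal A(z)\neq\varnothing$ if there is one, and $\tau_{ij}(y)=y$ otherwise. For $y\in\mathcal I_n$ and $j\in[n]$ let $$\Psi(y,j)=\{z\in\mathcal I_{n+1}: z=\tau_{js}(y)\text{ and }\hat\ell(z)=\hat\ell(y)+1\text{ for some } j<s\le n+1\}.$$ For $y\in\mathcal I^{\mathsf{fpf}}_n$ and $j\in[n]$ let $$\Psi^{\mathsf{fpf}}(y,j)=\{z\in\mathcal I^{\mathsf{fpf}}_{n+2}: \ell(z)=\ell(ys_{n+1})+2\text{ and } z=t_{js}\cdot ys_{n+1}\cdot t_{js}\text{ for some } j<s\le n+2\}.$$ Theorem. (I) Let $(j,i)$ with $i\le j$ be an outer corner of $y\in\mathcal I_n$. (a) The map $D\mapsto D\sqcup\{(j,i)\}$ is a well-defined bijection $\mathcal{ID}(y)\to\bigsqcup_{z\in\Psi(y,j)}\mathcal{ID}(z)$; that is, $(j,i)\notin D$ for all $D\in\mathcal{ID}(y)$, the sets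 $\mathcal{ID}(z)$ for $z\in\Psi(y,j)$ are pairwise disjoint, and the map is a bijection onto their union. (b) If $i+j\le n$ then $\Psi(y,j)\subset\mathcal I_n$. (II) Let $(j,i)$ with $i<j$ be an outer corner of $y\in\mathcal I^{\mathsf{fpf}}_n$. (a) The map $D\mapsto D\sqcup\{(j,i)\}$ is a well-defined bijection $\mathcal{FD}(y)\to\bigsqcup_{z\in\Psi^{\mathsf{fpf}}(y,j)}\mathcal{FD}(z)$, in the same sense. (b) If $i+j\le n$ then $\Psi^{\mathsf{fpf}}(y,j)\subset\{zs_{n+1}: z\in\mathcal I^{\mathsf{fpf}}_n\}$. -/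

import Mathlib

namespace InvPipe

/-! Everything is indexed from `1`, as in the usual matrix conventions: permutations act on `ℕ` and
fix `0`, and cells are pairs `(row, column)` with both coordinates at least `1`. -/

/-- `S_n`, realised as the permutations that fix everything outside `{1, …, n}`;
thus `S_n ⊆ S_{n+1}`. -/
def symmGroup (n : ℕ) : Set (Equiv.Perm ℕ) :=
  {w | ∀ k, k ∉ Finset.Icc 1 n → w k = k}

/-- `I_n`: the elements of `S_n` with `w = w⁻¹`. -/
def involutions (n : ℕ) : Set (Equiv.Perm ℕ) :=
  {w | w ∈ symmGroup n ∧ w = w⁻¹}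

/-- `I_n^fpf`: the involutions in `S_n` without fixed points in `{1, …, n}`
(there are none if `n` is odd). -/
def fpfInvolutions (n : ℕ) : Set (Equiv.Perm ℕ) :=
  {w | w ∈ involutions n ∧ ∀ k ∈ Finset.Icc 1 n, w k ≠ k}

/-- The simple transposition `s_i = (i, i+1)`. -/
def simpleT (i : ℕ) : Equiv.Perm ℕ := Equiv.swap i (i + 1)

/-- `a` is a word in the letters `1, 2, 3, …` with `w = s_{a_1} s_{a_2} ⋯ s_{a_l}`. -/
def IsWordFor (a : List ℕ) (w : Equiv.Perm ℕ) : Prop :=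
  (∀ x ∈ a, 1 ≤ x) ∧ (a.map simpleT).prod = w

/-- The Coxeter length `ℓ(w)`: the minimal length of a word for `w`. -/
noncomputable def len (w : Equiv.Perm ℕ) : ℕ :=
  sInf {k | ∃ a : List ℕ, IsWordFor a w ∧ a.length = k}

/-- Reduced words: words for `w` of minimal length. -/
def IsReducedWord (a : List ℕ) (w : Equiv.Perm ℕ) : Prop :=
  IsWordFor a w ∧ a.length = len w

open Classical in
/-- The Demazure product `v ∘ s_i`, which is `v s_i` if this is longer than `v`, and `v` otherwise. -/
noncomputable def demazureStep (v : Equiv.Perm ℕ) (i : ℕ) : Equiv.Perm ℕ :=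
  if len v < len (v * simpleT i) then v * simpleT i else v

/-- `u = v ∘ w` for the Demazure product: `u = (⋯((v ∘ s_{a_1}) ∘ s_{a_2}) ∘ ⋯) ∘ s_{a_l}` for a
reduced word `a_1 a_2 ⋯ a_l` of `w` (the value does not depend on the reduced word). -/
def IsDemazureProduct (v w u : Equiv.Perm ℕ) : Prop :=
  ∃ a : List ℕ, IsReducedWord a w ∧ a.foldl demazureStep v = u

/-- The atoms `A(y)` of `y ∈ I_n`: the `w ∈ S_n` of minimal length with `w⁻¹ ∘ w = y`. -/
def atoms (n : ℕ) (y : Equiv.Perm ℕ) : Set (Equiv.Perm ℕ) :=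
  {w | w ∈ symmGroup n ∧ IsDemazureProduct w⁻¹ w y ∧
    ∀ v ∈ symmGroup n, IsDemazureProduct v⁻¹ v y → len w ≤ len v}

/-- The involution length of `y`: the common length of its atoms. -/
noncomputable def invLen (n : ℕ) (y : Equiv.Perm ℕ) : ℕ :=
  sInf (len '' atoms n y)

/-- `A_{ij}(y)`: the permutations `w t_{ij}` with `w ∈ A(y)` and `ℓ(w t_{ij}) = ℓ(w) + 1`. -/
def atomCovers (n i j : ℕ) (y : Equiv.Perm ℕ) : Set (Equiv.Perm ℕ) :=
  {u | ∃ w ∈ atoms n y, u = w * Equiv.swap i j ∧ len u = len w + 1}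

/-- `τ_{ij}(y) = z`, for the operators `τ_{ij} : I_n → I_n` determined by:
if `A_{ij}(y)` meets `A(z)` for some `z ∈ I_n` then `τ_{ij}(y) = z` (there is at most one such `z`),
and if there is no such `z` then `τ_{ij}(y) = y`. -/
def IsTau (n i j : ℕ) (y z : Equiv.Perm ℕ) : Prop :=
  (z ∈ involutions n ∧ (atomCovers n i j y ∩ atoms n z).Nonempty) ∨
  ((∀ z' ∈ involutions n, atomCovers n i j y ∩ atoms n z' = ∅) ∧ z = y)

/-- `Ψ(y, j)` for `y ∈ I_n`: all `z ∈ I_{n+1}` whose involution length is one more than that of `y`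
and which have the form `τ_{js}(y)` for some `s > j`. -/
def Psi (n : ℕ) (y : Equiv.Perm ℕ) (j : ℕ) : Set (Equiv.Perm ℕ) :=
  {z | z ∈ involutions (n + 1) ∧ ∃ s, j < s ∧ s ≤ n + 1 ∧ IsTau (n + 1) j s y z ∧
    invLen (n + 1) z = invLen (n + 1) y + 1}

/-- `Ψ^fpf(y, j)` for `y ∈ I_n^fpf`: all `z ∈ I_{n+2}^fpf` of the form
`z = t_{js} · (y s_{n+1}) · t_{js}` with `j < s ≤ n+2` and `ℓ(z) = ℓ(y s_{n+1}) + 2`. -/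
def PsiFpf (n : ℕ) (y : Equiv.Perm ℕ) (j : ℕ) : Set (Equiv.Perm ℕ) :=
  {z | z ∈ fpfInvolutions (n + 2) ∧ len z = len (y * simpleT (n + 1)) + 2 ∧
    ∃ s, j < s ∧ s ≤ n + 2 ∧
      z = Equiv.swap j s * (y * simpleT (n + 1)) * Equiv.swap j s}

/-! ### Pipe dreams -/

/-- The cells `(i, j)` with `i, j ≥ 1` and `i + j ≤ n`. -/
def upperTriangle (n : ℕ) : Finset (ℕ × ℕ) :=
  (Finset.Icc 1 n ×ˢ Finset.Icc 1 n).filter (fun c => c.1 + c.2 ≤ n)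

/-- The cells `(j, i)` with `1 ≤ i ≤ j ≤ n`. -/
def lowerTriangle (n : ℕ) : Finset (ℕ × ℕ) :=
  (Finset.Icc 1 n ×ˢ Finset.Icc 1 n).filter (fun c => c.2 ≤ c.1)

/-- The cells `(j, i)` with `1 ≤ i < j ≤ n`. -/
def strictLowerTriangle (n : ℕ) : Finset (ℕ × ℕ) :=
  (Finset.Icc 1 n ×ˢ Finset.Icc 1 n).filter (fun c => c.2 < c.1)

/-- The side through which a pipe, followed from its left endpoint, enters a tile. -/
inductive Side
  | left
  | below

/-- `Enters D p σ i j`: in the wiring diagram of `D`, the pipe with left endpoint `p`, followed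
from there, enters the tile in row `i` and column `j` through the side `σ`. Cells of `D` carry
crossing tiles (the path from the left edge goes straight on to the right edge, the one from the
bottom edge to the top edge); all other cells carry bending tiles (left edge to top edge, bottom
edge to right edge). Rows are numbered downwards, so `Enters D p .below 0 j` says that the pipe
leaves the diagram at the top of column `j`. -/
inductive Enters (D : Finset (ℕ × ℕ)) (p : ℕ) : Side → ℕ → ℕ → Prop
  | start : Enters D p .left p 1
  | cross_left {i j : ℕ} : Enters D p .left (i + 1) j → (i + 1, j) ∈ D →
      Enters D p .left (i + 1) (j + 1)
  | bend_left {i j : ℕ} : Enters D p .left (i + 1) j → (i + 1, j) ∉ D →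
      Enters D p .below i j
  | cross_below {i j : ℕ} : Enters D p .below (i + 1) j → (i + 1, j) ∈ D →
      Enters D p .below i j
  | bend_below {i j : ℕ} : Enters D p .below (i + 1) j → (i + 1, j) ∉ D →
      Enters D p .left (i + 1) (j + 1)

/-- The pipes `p` and `q` are the two pipes that pass through the tile at `c`. -/
def Meet (D : Finset (ℕ × ℕ)) (p q : ℕ) (c : ℕ × ℕ) : Prop :=
  (Enters D p .left c.1 c.2 ∧ Enters D q .below c.1 c.2) ∨
  (Enters D q .left c.1 c.2 ∧ Enters D p .below c.1 c.2)

/-- The pipes `p` and `q` cross at `c`. -/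
def CrossAt (D : Finset (ℕ × ℕ)) (p q : ℕ) (c : ℕ × ℕ) : Prop :=
  c ∈ D ∧ Meet D p q c

/-- The pipes `p` and `q` avoid each other at `c`. -/
def AvoidAt (D : Finset (ℕ × ℕ)) (p q : ℕ) (c : ℕ × ℕ) : Prop :=
  c ∉ D ∧ Meet D p q c

/-- Reduced pipe dreams: sets of cells `(i, j)` with `i + j ≤ n` in whose wiring diagram no two of
the `n` pipes cross more than once. -/
def IsReducedPipeDream (n : ℕ) (D : Finset (ℕ × ℕ)) : Prop :=
  D ⊆ upperTriangle n ∧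
  ∀ p ∈ Finset.Icc 1 n, ∀ q ∈ Finset.Icc 1 n, p ≠ q →
    ∀ c c', CrossAt D p q c → CrossAt D p q c' → c = c'

/-- `PD(w)` for `w ∈ S_n`: the reduced pipe dreams in which the pipe with left endpoint `p` has top
endpoint `w(p)`, for every `p`. -/
def PD (n : ℕ) (w : Equiv.Perm ℕ) : Set (Finset (ℕ × ℕ)) :=
  {D | IsReducedPipeDream n D ∧ ∀ p ∈ Finset.Icc 1 n, Enters D p .below 0 (w p)}

/-- Symmetric sets of cells. -/
def IsSymmetric (D : Finset (ℕ × ℕ)) : Prop :=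
  ∀ i j, (i, j) ∈ D → (j, i) ∈ D

/-- Almost-symmetric pipe dreams. -/
def IsAlmostSymmetric (n : ℕ) (D : Finset (ℕ × ℕ)) : Prop :=
  (∀ i j, i < j → (i, j) ∈ D → (j, i) ∈ D) ∧
  (∀ i j, i < j → (j, i) ∈ D → (i, j) ∉ D →
    ∃ p ∈ Finset.Icc 1 n, ∃ q ∈ Finset.Icc 1 n, CrossAt D p q (j, i) ∧ AvoidAt D p q (i, j))

/-- The involution pipe dreams `ID(y)` of `y ∈ I_n`. -/
def ID (n : ℕ) (y : Equiv.Perm ℕ) : Set (Finset (ℕ × ℕ)) :=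
  {E | ∃ D ∈ PD n y, IsAlmostSymmetric n D ∧ E = D ∩ lowerTriangle n}

/-- The fpf-involution pipe dreams `FD(z)` of `z ∈ I_n^fpf`. -/
def FD (n : ℕ) (z : Equiv.Perm ℕ) : Set (Finset (ℕ × ℕ)) :=
  {E | ∃ D ∈ PD n z, IsSymmetric D ∧ E = D ∩ strictLowerTriangle n}

/-! ### Dominant components and outer corners -/

/-- The positive cells. -/
def cells : Set (ℕ × ℕ) := {c | 1 ≤ c.1 ∧ 1 ≤ c.2}

/-- Lower sets of the positive cells under the northwest order, which is the componentwise order. -/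
def IsNWLower (L : Set (ℕ × ℕ)) : Prop :=
  L ⊆ cells ∧ ∀ c ∈ L, ∀ c' ∈ cells, c' ≤ c → c' ∈ L

/-- The dominant component of a set of cells: the union of all lower sets contained in it. -/
def dom (D : Set (ℕ × ℕ)) : Set (ℕ × ℕ) :=
  ⋃₀ {L | IsNWLower L ∧ L ⊆ D}

/-- `F` is the Ferrers diagram `{(i, j) : i, j ≥ 1, j ≤ lam i}` of a partition
`lam 1 ≥ lam 2 ≥ ⋯` (with finitely many nonzero parts; the value `lam 0` plays no role). -/
def IsFerrers (F : Set (ℕ × ℕ)) : Prop :=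
  ∃ lam : ℕ → ℕ, Antitone lam ∧ (∃ N, ∀ i, N < i → lam i = 0) ∧
    F = {c | 1 ≤ c.1 ∧ 1 ≤ c.2 ∧ c.2 ≤ lam c.1}

/-- `c` is an outer corner of the set `D`: a positive cell outside `D` whose addition to the
dominant component of `D` gives a Ferrers diagram again. -/
def IsOuterCorner (D : Set (ℕ × ℕ)) (c : ℕ × ℕ) : Prop :=
  c ∈ cells ∧ c ∉ D ∧ IsFerrers (insert c (dom D))

/-- The Rothe diagram of `w ∈ S_n`. -/
def rothe (n : ℕ) (w : Equiv.Perm ℕ) : Set (ℕ × ℕ) :=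
  {c | c.1 ∈ Finset.Icc 1 n ∧ c.2 ∈ Finset.Icc 1 n ∧ c.2 < w c.1 ∧ c.1 < w⁻¹ c.2}

/-- The dominant component of a permutation `w ∈ S_n`: that of its Rothe diagram. -/
def domPerm (n : ℕ) (w : Equiv.Perm ℕ) : Set (ℕ × ℕ) := dom (rothe n w)

/-- Outer corners of a permutation are the outer corners of its dominant component. -/
def IsOuterCornerOf (n : ℕ) (w : Equiv.Perm ℕ) (c : ℕ × ℕ) : Prop :=
  IsOuterCorner (domPerm n w) c

end InvPipe

namespace InvPipe

open Equiv

/-! ### Rank functions and the Bruhat order -/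

/-! The proof translates pipe dreams into words and then compares Demazure products in the Bruhat
order.

The engine is the operator `dU m`, x ↦ s_m ∘ x ∘ s_m. It acts on rank functions by max formulas, so
it is Bruhat-monotone. On involutions it has the lower adjoint `dE m`, which undoes it at descents.
The statistic `invStat`, which is 2ℓ plus the number of moved points, grows by 4 at each letter that
genuinely raises an involution, and by `invStat_strictMono` it is strictly increasing for the Bruhat
order on involutions. Hence a Bruhat inequality together with a count of letters yields equality,
and equality in the count says that every letter raises.

First half (`mem_ID_iff`): ID(y) consists of the sets of lower cells whose reading word is an
involution word of y, that is, every letter raises and the product is y. A pipe dream is built up by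
adding (a,b) together with its reflection (b,a), in reading order of the lower cells. The cell (a,b)
multiplies the wiring on the right by s_{a+b-1} and (b,a) multiplies it on the left by the same
letter. The avoidance condition for a missing reflection says that the involution built so far
preserves {a+b-1, a+b} (`avoid_iff`). At an ascent it then fixes both points, which is the case
where s ∘ x ∘ s = xs.

Second half: let (j,i) be an outer corner of y. Every member of ID(y) contains the lower half of the
rectangle [j] × [i] except the corner. Adding the corner gives an involution z ≥ y with z(j) > i, so
z ≠ y, and the count leaves room for exactly one step. The pipe entering the corner from the left is
pipe j, so on atoms the new letter is right multiplication by some t_{js} with s > j, and z lies in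
Ψ(y,j). Conversely, each z in Ψ(y,j) satisfies y t_{js} ≤ z (`mul_swap_le_of_atoms`), so every
member of ID(z) contains the whole half-rectangle. Erasing the corner leaves a word whose product is
still ≥ y (`IsCorner.le_dUs_erase`): when letters are peeled off y from the end, the corner's letter
meets an ascent and removes nothing. The count then forces the product to be y.

For part (b), s beyond n would force y(t) < i for all j < t ≤ n, which is too many small values when
i + j ≤ n.

The fixed-point-free case reduces to the above. Counting cells shows that symmetric pipe dreams of
fixed-point-free involutions are the almost-symmetric ones containing every diagonal cell
(`mem_FD_iff`), and passing from y to y s_{n+1} adds one diagonal cell. What remains is to recognise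
z as a conjugate of y s_{n+1}, which follows from z being an involution. -/

/-- The number of positions below `p` with values below `q`. -/
def rk (x : Perm ℕ) (p q : ℕ) : ℕ := ((Finset.range p).filter (fun i => x i < q)).card

/-- The Bruhat order, through the tableau criterion. -/
def BruhatLE (x y : Perm ℕ) : Prop := ∀ p q, rk y p q ≤ rk x p q

@[simp] lemma rk_zero_left (x : Perm ℕ) (q : ℕ) : rk x 0 q = 0 := by simp [rk]

lemma rk_succ_left (x : Perm ℕ) (p q : ℕ) :
    rk x (p + 1) q = rk x p q + if x p < q then 1 else 0 := by
  unfold rk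
  rw [Finset.range_add_one, Finset.filter_insert]
  split_ifs with h
  · rw [Finset.card_insert_of_notMem (by simp)]
  · rfl

lemma rk_add_two (x : Perm ℕ) (p q : ℕ) :
    rk x (p + 2) q = rk x p q + (if x p < q then 1 else 0) + if x (p + 1) < q then 1 else 0 := by
  rw [show p + 2 = p + 1 + 1 from rfl, rk_succ_left, rk_succ_left]

lemma rk_inv (x : Perm ℕ) (p q : ℕ) : rk x⁻¹ p q = rk x q p := by
  unfold rk
  apply Finset.card_bij' (fun i _ => x⁻¹ i) (fun i _ => x i) <;> simp <;> tauto

lemma rk_le_left (x : Perm ℕ) (p q : ℕ) : rk x p q ≤ p := by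
  unfold rk
  exact (Finset.card_filter_le _ _).trans (by simp)

lemma rk_le_right (x : Perm ℕ) (p q : ℕ) : rk x p q ≤ q := by
  rw [← rk_inv]; exact rk_le_left _ _ _

lemma rk_mono_left (x : Perm ℕ) {p p' : ℕ} (h : p ≤ p') (q : ℕ) : rk x p q ≤ rk x p' q := by
  unfold rk
  exact Finset.card_le_card (Finset.filter_subset_filter _ (Finset.range_mono h))

lemma rk_add_le (x : Perm ℕ) (p q c : ℕ) : rk x (p + c) q ≤ rk x p q + c := by
  induction c with
  | zero => simp
  | succ c ih => rw [← add_assoc, rk_succ_left]; split_ifs <;> omega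

lemma rk_ext {x y : Perm ℕ} (h : ∀ p q, rk x p q = rk y p q) : x = y := by
  ext p
  have key : ∀ q, x p < q ↔ y p < q := by
    intro q
    have h1 := h (p + 1) q
    rw [rk_succ_left, rk_succ_left, h p q] at h1
    split_ifs at h1 with hx hy hy <;> omega
  have h1 := (key (x p + 1)).1 (by omega)
  have h2 := (key (y p + 1)).2 (by omega)
  omega

lemma rk_one (p q : ℕ) : rk 1 p q = min p q := by
  unfold rk
  have : (Finset.range p).filter (fun i => (1 : Perm ℕ) i < q) = Finset.range (min p q) := by
    ext i
    rw [Finset.mem_filter, Finset.mem_range, Finset.mem_range, lt_min_iff, Perm.one_apply]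
  rw [this, Finset.card_range]

lemma BruhatLE.refl (x : Perm ℕ) : BruhatLE x x := fun _ _ => le_rfl

lemma BruhatLE.trans {x y z : Perm ℕ} (h : BruhatLE x y) (h' : BruhatLE y z) : BruhatLE x z :=
  fun p q => (h' p q).trans (h p q)

lemma BruhatLE.antisymm {x y : Perm ℕ} (h : BruhatLE x y) (h' : BruhatLE y x) : x = y :=
  rk_ext fun p q => le_antisymm (h' p q) (h p q)

lemma BruhatLE.inv {x y : Perm ℕ} (h : BruhatLE x y) : BruhatLE x⁻¹ y⁻¹ :=
  fun p q => by rw [rk_inv, rk_inv]; exact h q p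

lemma BruhatLE.one_le (x : Perm ℕ) : BruhatLE 1 x := fun p q => by
  rw [rk_one]; exact le_min (rk_le_left _ _ _) (rk_le_right _ _ _)

/-! ### Simple transpositions -/

lemma simpleT_apply (m k : ℕ) :
    simpleT m k = if k = m then m + 1 else if k = m + 1 then m else k := by
  unfold simpleT; rw [swap_apply_def]

@[simp] lemma simpleT_left (m : ℕ) : simpleT m m = m + 1 := by simp [simpleT]

@[simp] lemma simpleT_right (m : ℕ) : simpleT m (m + 1) = m := by simp [simpleT]

lemma simpleT_of_ne {m k : ℕ} (h : k ≠ m) (h' : k ≠ m + 1) : simpleT m k = k := by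
  unfold simpleT; exact swap_apply_of_ne_of_ne h h'

@[simp] lemma simpleT_mul_self (m : ℕ) : simpleT m * simpleT m = 1 := by simp [simpleT]

@[simp] lemma simpleT_inv (m : ℕ) : (simpleT m)⁻¹ = simpleT m := by simp [simpleT]

@[simp] lemma simpleT_simpleT (m k : ℕ) : simpleT m (simpleT m k) = k := by simp [simpleT]

@[simp] lemma mul_simpleT_cancel (x : Perm ℕ) (m : ℕ) : x * simpleT m * simpleT m = x := by
  rw [mul_assoc]; simp

@[simp] lemma simpleT_mul_cancel (x : Perm ℕ) (m : ℕ) : simpleT m * (simpleT m * x) = x := by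
  rw [← mul_assoc]; simp

lemma simpleT_lt {m p q : ℕ} (h : p < q) (hne : ¬ (p = m ∧ q = m + 1)) :
    simpleT m p < simpleT m q := by
  rw [simpleT_apply, simpleT_apply]; split_ifs <;> omega

lemma asc_ne (x : Perm ℕ) (m : ℕ) : x m ≠ x (m + 1) := fun h => by
  have := x.injective h; omega

lemma rk_mul_simpleT_ne (x : Perm ℕ) {m p : ℕ} (h : p ≠ m + 1) (q : ℕ) :
    rk (x * simpleT m) p q = rk x p q := by
  induction p using Nat.strong_induction_on with
  | _ p ih =>
    rcases p with _ | p
    · simp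
    · by_cases hp : p = m + 1
      · subst hp
        rw [rk_succ_left, rk_succ_left, rk_succ_left, rk_succ_left, ih m (by omega) (by omega)]
        simp; omega
      · rw [rk_succ_left, rk_succ_left, ih p (by omega) hp, Perm.mul_apply,
          simpleT_of_ne (by omega) hp]

lemma rk_mul_simpleT_eq (x : Perm ℕ) (m q : ℕ) :
    rk (x * simpleT m) (m + 1) q = rk x m q + if x (m + 1) < q then 1 else 0 := by
  rw [rk_succ_left, rk_mul_simpleT_ne _ (by omega)]; simp

/-! ### Demazure operators -/

/-- The Demazure product `x ∘ s_m`. -/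
def dR (m : ℕ) (x : Perm ℕ) : Perm ℕ := if x m < x (m + 1) then x * simpleT m else x

/-- The Demazure product `s_m ∘ x`. -/
def dL (m : ℕ) (x : Perm ℕ) : Perm ℕ := (dR m x⁻¹)⁻¹

/-- The twofold Demazure product `s_m ∘ x ∘ s_m`. -/
def dU (m : ℕ) (x : Perm ℕ) : Perm ℕ := dL m (dR m x)

/-- The smaller of `x` and `x s_m`. -/
def downR (m : ℕ) (x : Perm ℕ) : Perm ℕ := if x m < x (m + 1) then x else x * simpleT m

/-- The smaller of `x` and `s_m x`. -/
def downL (m : ℕ) (x : Perm ℕ) : Perm ℕ := (downR m x⁻¹)⁻¹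

/-- The two-sided lowering operator, inverse to `dU m` on its ascents. -/
def dE (m : ℕ) (x : Perm ℕ) : Perm ℕ := downL m (downR m x)

/-- Sorting the values at m, m+1 decreasingly makes the single affected rank as small as its
neighbours allow. The formula involves only rows m and m+2 of the rank function of x, and
monotonicity and the commutation relations are read off from it. Truncated subtraction does no harm,
since the other argument of the max is nonnegative. -/
lemma rk_dR_eq (m : ℕ) (x : Perm ℕ) (q : ℕ) :
    rk (dR m x) (m + 1) q = max (rk x m q) (rk x (m + 2) q - 1) := by
  have h1 := rk_succ_left x m q
  have h2 := rk_add_two x m q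
  unfold dR
  split_ifs with h
  · rw [rk_mul_simpleT_eq]; split_ifs at * <;> omega
  · have := asc_ne x m
    split_ifs at * <;> omega

lemma rk_dR_ne {m p : ℕ} (h : p ≠ m + 1) (x : Perm ℕ) (q : ℕ) : rk (dR m x) p q = rk x p q := by
  unfold dR; split_ifs
  · exact rk_mul_simpleT_ne x h q
  · rfl

lemma rk_dL_eq (m : ℕ) (x : Perm ℕ) (p : ℕ) :
    rk (dL m x) p (m + 1) = max (rk x p m) (rk x p (m + 2) - 1) := by
  unfold dL; rw [rk_inv, rk_dR_eq, rk_inv, rk_inv]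

lemma rk_dL_ne {m q : ℕ} (h : q ≠ m + 1) (x : Perm ℕ) (p : ℕ) : rk (dL m x) p q = rk x p q := by
  unfold dL; rw [rk_inv, rk_dR_ne h, rk_inv]

lemma rk_downR_eq (m : ℕ) (x : Perm ℕ) (q : ℕ) :
    rk (downR m x) (m + 1) q = min (rk x m q + 1) (rk x (m + 2) q) := by
  have h1 := rk_succ_left x m q
  have h2 := rk_add_two x m q
  unfold downR
  split_ifs with h
  · split_ifs at * <;> omega
  · have := asc_ne x m
    rw [rk_mul_simpleT_eq]; split_ifs at * <;> omega

lemma rk_downR_ne {m p : ℕ} (h : p ≠ m + 1) (x : Perm ℕ) (q : ℕ) :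
    rk (downR m x) p q = rk x p q := by
  unfold downR; split_ifs
  · rfl
  · exact rk_mul_simpleT_ne x h q

lemma dR_mono (m : ℕ) {x y : Perm ℕ} (h : BruhatLE x y) : BruhatLE (dR m x) (dR m y) := by
  intro p q
  by_cases hp : p = m + 1
  · subst hp; rw [rk_dR_eq, rk_dR_eq]
    have := h m q; have := h (m + 2) q; omega
  · rw [rk_dR_ne hp, rk_dR_ne hp]; exact h p q

lemma dL_mono (m : ℕ) {x y : Perm ℕ} (h : BruhatLE x y) : BruhatLE (dL m x) (dL m y) :=
  (dR_mono m h.inv).inv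

lemma dU_mono (m : ℕ) {x y : Perm ℕ} (h : BruhatLE x y) : BruhatLE (dU m x) (dU m y) :=
  dL_mono m (dR_mono m h)

lemma downR_mono (m : ℕ) {x y : Perm ℕ} (h : BruhatLE x y) :
    BruhatLE (downR m x) (downR m y) := by
  intro p q
  by_cases hp : p = m + 1
  · subst hp; rw [rk_downR_eq, rk_downR_eq]
    have := h m q; have := h (m + 2) q; omega
  · rw [rk_downR_ne hp, rk_downR_ne hp]; exact h p q

lemma dE_mono (m : ℕ) {x y : Perm ℕ} (h : BruhatLE x y) : BruhatLE (dE m x) (dE m y) :=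
  (downR_mono m (downR_mono m h).inv).inv

lemma le_dR (m : ℕ) (x : Perm ℕ) : BruhatLE x (dR m x) := by
  intro p q
  by_cases hp : p = m + 1
  · subst hp; rw [rk_dR_eq]
    have h1 := rk_succ_left x m q
    have h2 := rk_add_two x m q
    split_ifs at * <;> omega
  · rw [rk_dR_ne hp]

lemma le_dL (m : ℕ) (x : Perm ℕ) : BruhatLE x (dL m x) := by
  have := (le_dR m x⁻¹).inv
  rwa [inv_inv] at this

lemma le_dU (m : ℕ) (x : Perm ℕ) : BruhatLE x (dU m x) := (le_dR m x).trans (le_dL m _)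

/-- One operator is a max formula in the rows of the rank function, the other in the columns. At the
common entry both orders give the same iterated maximum. -/
lemma dR_dL_comm (m k : ℕ) (x : Perm ℕ) : dR m (dL k x) = dL k (dR m x) := by
  apply rk_ext
  intro p q
  by_cases hp : p = m + 1 <;> by_cases hq : q = k + 1
  · subst hp; subst hq
    simp only [rk_dR_eq, rk_dL_eq]; omega
  · subst hp
    simp only [rk_dR_eq, rk_dL_ne hq]
  · subst hq
    simp only [rk_dR_ne hp, rk_dL_eq]
  · simp only [rk_dR_ne hp, rk_dL_ne hq]

lemma dL_inv (m : ℕ) (x : Perm ℕ) : dL m x⁻¹ = (dR m x)⁻¹ := by unfold dL; rw [inv_inv]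

lemma dR_inv (m : ℕ) (x : Perm ℕ) : dR m x⁻¹ = (dL m x)⁻¹ := by unfold dL; rw [inv_inv]

lemma dU_inv (m : ℕ) (x : Perm ℕ) : dU m x⁻¹ = (dU m x)⁻¹ := by
  unfold dU; rw [dR_inv, dL_inv, dR_dL_comm]

lemma dR_of_asc {m : ℕ} {x : Perm ℕ} (h : x m < x (m + 1)) : dR m x = x * simpleT m := if_pos h

lemma dR_of_desc {m : ℕ} {x : Perm ℕ} (h : x (m + 1) < x m) : dR m x = x := if_neg (by omega)

lemma dL_of_asc {m : ℕ} {x : Perm ℕ} (h : x⁻¹ m < x⁻¹ (m + 1)) : dL m x = simpleT m * x := by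
  unfold dL; rw [dR_of_asc h]; simp

lemma dL_of_desc {m : ℕ} {x : Perm ℕ} (h : x⁻¹ (m + 1) < x⁻¹ m) : dL m x = x := by
  unfold dL; rw [dR_of_desc h]; simp

lemma dR_dR_comm {m k : ℕ} (h : m + 2 ≤ k) (x : Perm ℕ) : dR m (dR k x) = dR k (dR m x) := by
  apply rk_ext
  intro p q
  by_cases hp : p = m + 1 <;> by_cases hq : p = k + 1
  · omega
  · subst hp
    simp only [rk_dR_eq, rk_dR_ne hq]
    rw [rk_dR_ne (by omega), rk_dR_ne (by omega)]
  · subst hq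
    simp only [rk_dR_eq, rk_dR_ne hp]
    rw [rk_dR_ne (by omega), rk_dR_ne (by omega)]
  · simp only [rk_dR_ne hp, rk_dR_ne hq]

lemma dU_dU_comm {m k : ℕ} (h : m + 2 ≤ k) (x : Perm ℕ) : dU m (dU k x) = dU k (dU m x) := by
  have hL : ∀ y, dL m (dL k y) = dL k (dL m y) := by
    intro y; unfold dL; simp only [inv_inv]; rw [dR_dR_comm h]
  unfold dU
  rw [dR_dL_comm, dR_dR_comm h, hL, dR_dL_comm]

/-! ### Involutions -/

lemma dU_of_desc {m : ℕ} {x : Perm ℕ} (hx : x⁻¹ = x) (h : x (m + 1) < x m) : dU m x = x := by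
  unfold dU; rw [dR_of_desc h, dL_of_desc (by rw [hx]; exact h)]

lemma dU_of_comm {m : ℕ} {x : Perm ℕ} (h1 : x m = m) (h2 : x (m + 1) = m + 1) :
    dU m x = x * simpleT m := by
  unfold dU
  rw [dR_of_asc (by omega), dL_of_desc]
  have e1 : x⁻¹ m = m := by rw [Perm.inv_eq_iff_eq]; exact h1.symm
  have e2 : x⁻¹ (m + 1) = m + 1 := by rw [Perm.inv_eq_iff_eq]; exact h2.symm
  rw [mul_inv_rev, Perm.mul_apply, Perm.mul_apply, e1, e2]; simp

lemma inv_apply_of_inv {x : Perm ℕ} (hx : x⁻¹ = x) (p : ℕ) : x (x p) = p := by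
  nth_rewrite 1 [← hx]; simp

/-- After right multiplication, left multiplication is still an ascent: s_m preserves the order of
the two values unless they are m and m+1 themselves, which for an ascent means that both points are
fixed. Together with `dU_of_comm` this covers all ascents. -/
lemma dU_of_conj {m : ℕ} {x : Perm ℕ} (hx : x⁻¹ = x) (h : x m < x (m + 1))
    (hne : ¬ (x m = m ∧ x (m + 1) = m + 1)) : dU m x = simpleT m * x * simpleT m := by
  unfold dU
  rw [dR_of_asc h, dL_of_asc, mul_assoc]
  rw [mul_inv_rev, hx, simpleT_inv]
  exact simpleT_lt h hne

lemma inv_dU {m : ℕ} {x : Perm ℕ} (hx : x⁻¹ = x) : (dU m x)⁻¹ = dU m x := by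
  rw [← dU_inv, hx]

lemma simpleT_comm_of_fix {m : ℕ} {x : Perm ℕ} (h1 : x m = m) (h2 : x (m + 1) = m + 1) :
    simpleT m * x = x * simpleT m := by
  unfold simpleT; rw [Equiv.mul_swap_eq_swap_mul, h1, h2]

lemma dE_of_asc {m : ℕ} {x : Perm ℕ} (hx : x⁻¹ = x) (h : x m < x (m + 1)) : dE m x = x := by
  unfold dE downL downR
  simp [h, hx]

lemma dE_of_desc {m : ℕ} {x : Perm ℕ} (hx : x⁻¹ = x) (h : x (m + 1) < x m) :
    dE m x = if x m = m + 1 then x * simpleT m else simpleT m * x * simpleT m := by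
  unfold dE downL
  have h1 : downR m x = x * simpleT m := if_neg (by omega)
  rw [h1, mul_inv_rev, hx, simpleT_inv]
  split_ifs with hm
  · have hm' : x (m + 1) = m := by rw [← hm]; exact inv_apply_of_inv hx m
    unfold downR
    rw [if_pos]
    · simp [mul_inv_rev, hx]
    · simp [hm, hm']
  · have := simpleT_lt (m := m) h (by
      rintro ⟨h1, h2⟩; exact hm h2)
    unfold downR
    rw [if_neg]
    · simp [mul_inv_rev, hx, mul_assoc]
    · simp only [Perm.mul_apply]; omega

lemma inv_dE {m : ℕ} {x : Perm ℕ} (hx : x⁻¹ = x) : (dE m x)⁻¹ = dE m x := by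
  rcases lt_or_gt_of_ne (asc_ne x m) with h | h
  · rw [dE_of_asc hx h, hx]
  · rw [dE_of_desc hx h]
    split_ifs with hm
    · have hm' : x (m + 1) = m := by rw [← hm]; exact inv_apply_of_inv hx m
      rw [mul_inv_rev, hx, simpleT_inv]
      unfold simpleT; rw [Equiv.mul_swap_eq_swap_mul, hm, hm', Equiv.swap_comm]
    · simp [mul_inv_rev, hx, mul_assoc]

lemma dE_asc {m : ℕ} {x : Perm ℕ} (hx : x⁻¹ = x) : dE m x m < dE m x (m + 1) := by
  rcases lt_or_gt_of_ne (asc_ne x m) with h | h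
  · rwa [dE_of_asc hx h]
  · rw [dE_of_desc hx h]
    split_ifs with hm
    · simpa using h
    · have := simpleT_lt (m := m) h (by
        rintro ⟨h1, h2⟩; exact hm h2)
      simpa using this

lemma dU_dE {m : ℕ} {x : Perm ℕ} (hx : x⁻¹ = x) (h : x (m + 1) < x m) : dU m (dE m x) = x := by
  have ha := dE_asc (m := m) hx
  have hi := inv_dE (m := m) hx
  have he := dE_of_desc hx h
  by_cases hm : x m = m + 1
  · rw [if_pos hm] at he
    have hm' : x (m + 1) = m := by rw [← hm]; exact inv_apply_of_inv hx m
    rw [dU_of_comm]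
    · rw [he]; simp
    · rw [he]; simp [hm']
    · rw [he]; simp [hm]
  · rw [if_neg hm] at he
    rw [dU_of_conj hi ha]
    · rw [he]; simp [mul_assoc]
    · rintro ⟨h1, h2⟩
      rw [he] at h1 h2
      simp only [Perm.mul_apply, simpleT_left, simpleT_right] at h1 h2
      have e1 : x (m + 1) = m + 1 := by
        have := congrArg (simpleT m) h1; simpa using this
      have e2 : x m = m := by
        have := congrArg (simpleT m) h2; simpa using this
      omega

lemma dU_desc {m : ℕ} {x : Perm ℕ} (hx : x⁻¹ = x) : dU m x (m + 1) < dU m x m := by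
  rcases lt_or_gt_of_ne (asc_ne x m) with h | h
  · by_cases hc : x m = m ∧ x (m + 1) = m + 1
    · rw [dU_of_comm hc.1 hc.2]; simp [hc.1, hc.2]
    · rw [dU_of_conj hx h hc]
      simpa using simpleT_lt h hc
  · rwa [dU_of_desc hx h]

lemma dE_dU {m : ℕ} {x : Perm ℕ} (hx : x⁻¹ = x) (h : x m < x (m + 1)) : dE m (dU m x) = x := by
  have hd := dU_desc (m := m) hx
  rw [dE_of_desc (inv_dU hx) hd]
  by_cases hc : x m = m ∧ x (m + 1) = m + 1
  · rw [dU_of_comm hc.1 hc.2]; simp [hc.2]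
  · rw [dU_of_conj hx h hc, if_neg]
    · simp [mul_assoc]
    · simp only [Perm.mul_apply, simpleT_left]
      intro h1
      have h2 : x (m + 1) = m := by
        have := congrArg (simpleT m) h1; simpa using this
      have := inv_apply_of_inv hx (m + 1)
      rw [h2] at this; omega

lemma dE_le (m : ℕ) (x : Perm ℕ) : BruhatLE (dE m x) x := by
  have key : ∀ y : Perm ℕ, BruhatLE (downR m y) y := by
    intro y p q
    by_cases hp : p = m + 1
    · subst hp
      have h1 := rk_succ_left y m q
      have h2 := rk_add_two y m q
      rw [rk_downR_eq]
      split_ifs at * <;> omega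
    · rw [rk_downR_ne hp]
  have h2 := (key (downR m x)⁻¹).inv
  rw [inv_inv] at h2
  exact h2.trans (key x)

/-- Counit of the adjunction on involutions. With `le_dU_dE` and monotonicity it says that `dE m x ≤
z` exactly when `x ≤ dU m z`. -/
lemma dE_dU_le {m : ℕ} {x : Perm ℕ} (hx : x⁻¹ = x) : BruhatLE (dE m (dU m x)) x := by
  rcases lt_or_gt_of_ne (asc_ne x m) with h | h
  · rw [dE_dU hx h]; exact BruhatLE.refl x
  · rw [dU_of_desc hx h]; exact dE_le m x

lemma le_dU_dE {m : ℕ} {x : Perm ℕ} (hx : x⁻¹ = x) : BruhatLE x (dU m (dE m x)) := by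
  rcases lt_or_gt_of_ne (asc_ne x m) with h | h
  · rw [dE_of_asc hx h]; exact le_dU m x
  · rw [dU_dE hx h]; exact BruhatLE.refl x

/-! ### The groups `S_n` -/

lemma one_mem_symmGroup (n : ℕ) : (1 : Perm ℕ) ∈ symmGroup n := fun _ _ => rfl

lemma symmGroup_mono {n N : ℕ} (h : n ≤ N) : symmGroup n ⊆ symmGroup N := fun _ hw k hk =>
  hw k (fun hk' => hk (Finset.mem_Icc.2 ⟨(Finset.mem_Icc.1 hk').1, (Finset.mem_Icc.1 hk').2.trans h⟩))

lemma mul_mem_symmGroup {n : ℕ} {x y : Perm ℕ} (hx : x ∈ symmGroup n) (hy : y ∈ symmGroup n) :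
    x * y ∈ symmGroup n := fun k hk => by rw [Perm.mul_apply, hy k hk, hx k hk]

lemma inv_mem_symmGroup {n : ℕ} {x : Perm ℕ} (hx : x ∈ symmGroup n) : x⁻¹ ∈ symmGroup n :=
  fun k hk => by rw [Perm.inv_eq_iff_eq, hx k hk]

lemma swap_mem_symmGroup {n p q : ℕ} (hp : 1 ≤ p) (hp' : p ≤ n) (hq : 1 ≤ q) (hq' : q ≤ n) :
    swap p q ∈ symmGroup n := fun k hk => by
  rw [Finset.mem_Icc] at hk
  exact swap_apply_of_ne_of_ne (by rintro rfl; exact hk ⟨hp, hp'⟩) (by rintro rfl; exact hk ⟨hq, hq'⟩)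

lemma simpleT_mem_symmGroup {n m : ℕ} (h : 1 ≤ m) (h' : m < n) : simpleT m ∈ symmGroup n :=
  swap_mem_symmGroup h (by omega) (by omega) (by omega)

lemma symmGroup_zero {n : ℕ} {x : Perm ℕ} (hx : x ∈ symmGroup n) : x 0 = 0 := hx 0 (by simp)

lemma symmGroup_gt {n : ℕ} {x : Perm ℕ} (hx : x ∈ symmGroup n) {k : ℕ} (h : n < k) : x k = k :=
  hx k (by rw [Finset.mem_Icc]; omega)

lemma symmGroup_pos {n : ℕ} {x : Perm ℕ} (hx : x ∈ symmGroup n) {k : ℕ} (h : 1 ≤ k) : 1 ≤ x k := by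
  rcases Nat.eq_zero_or_pos (x k) with h0 | h0
  · have := x.injective (h0.trans (symmGroup_zero hx).symm); omega
  · exact h0

lemma symmGroup_le {n : ℕ} {x : Perm ℕ} (hx : x ∈ symmGroup n) {k : ℕ} (h : k ≤ n) : x k ≤ n := by
  by_contra h0
  have := x.injective (symmGroup_gt hx (k := x k) (by omega)); omega

/-! ### Inversions -/

/-- The inversions of a permutation, as pairs of positions. -/
def invSet (x : Perm ℕ) : Set (ℕ × ℕ) := {c | c.1 < c.2 ∧ x c.2 < x c.1}

/-- The number of inversions. -/
noncomputable def invCount (x : Perm ℕ) : ℕ := (invSet x).ncard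

lemma mem_invSet {x : Perm ℕ} {p q : ℕ} : (p, q) ∈ invSet x ↔ p < q ∧ x q < x p := Iff.rfl

lemma invSet_mul_simpleT {x : Perm ℕ} {m : ℕ} (h : x m < x (m + 1)) :
    invSet (x * simpleT m) =
      insert (m, m + 1) (Prod.map (simpleT m) (simpleT m) '' invSet x) := by
  ext ⟨p, q⟩
  simp only [mem_invSet, Set.mem_insert_iff, Set.mem_image, Prod.exists, Prod.map_apply,
    Prod.mk.injEq, Perm.mul_apply]
  constructor
  · rintro ⟨h1, h2⟩
    by_cases hpq : p = m ∧ q = m + 1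
    · exact Or.inl hpq
    · exact Or.inr ⟨simpleT m p, simpleT m q, ⟨simpleT_lt h1 hpq, h2⟩, by simp, by simp⟩
  · rintro (⟨rfl, rfl⟩ | ⟨a, b, ⟨h1, h2⟩, rfl, rfl⟩)
    · simpa using h
    · refine ⟨simpleT_lt h1 ?_, by simpa using h2⟩
      rintro ⟨rfl, rfl⟩; omega

lemma invCount_mul_simpleT {x : Perm ℕ} {m : ℕ} (hf : (invSet x).Finite) (h : x m < x (m + 1)) :
    (invSet (x * simpleT m)).Finite ∧ invCount (x * simpleT m) = invCount x + 1 := by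
  have hinj : Function.Injective (Prod.map (simpleT m) (simpleT m)) :=
    (simpleT m).injective.prodMap (simpleT m).injective
  rw [invCount, invSet_mul_simpleT h]
  refine ⟨(hf.image _).insert _, ?_⟩
  rw [Set.ncard_insert_of_notMem _ (hf.image _), Set.ncard_image_of_injective _ hinj, invCount]
  rintro ⟨⟨a, b⟩, ⟨h1, h2⟩, h3⟩
  simp only [Prod.map_apply, Prod.mk.injEq] at h3
  have e1 : a = m + 1 := by have := congrArg (simpleT m) h3.1; simpa using this
  have e2 : b = m := by have := congrArg (simpleT m) h3.2; simpa using this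
  simp only at h1; omega

lemma finite_invSet_mul_simpleT {x : Perm ℕ} (m : ℕ) (hf : (invSet x).Finite) :
    (invSet (x * simpleT m)).Finite := by
  have : invSet (x * simpleT m) ⊆
      insert (m, m + 1) (Prod.map (simpleT m) (simpleT m) '' invSet x) := by
    rintro ⟨p, q⟩ ⟨h1, h2⟩
    by_cases hpq : p = m ∧ q = m + 1
    · left; simp [hpq]
    · exact Or.inr ⟨(simpleT m p, simpleT m q), ⟨simpleT_lt h1 hpq, h2⟩, by simp⟩
  exact ((hf.image _).insert _).subset this

lemma invCount_mul_simpleT_desc {x : Perm ℕ} {m : ℕ} (hf : (invSet x).Finite)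
    (h : x (m + 1) < x m) : invCount x = invCount (x * simpleT m) + 1 := by
  have := (invCount_mul_simpleT (x := x * simpleT m) (m := m) (finite_invSet_mul_simpleT m hf)
    (by simpa using h)).2
  simpa using this

lemma invSet_inv (x : Perm ℕ) : invSet x⁻¹ = (fun c : ℕ × ℕ => (x c.2, x c.1)) '' invSet x := by
  ext ⟨p, q⟩
  simp only [mem_invSet, Set.mem_image, Prod.exists, Prod.mk.injEq]
  constructor
  · rintro ⟨h1, h2⟩
    exact ⟨x⁻¹ q, x⁻¹ p, ⟨h2, by simpa using h1⟩, by simp, by simp⟩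
  · rintro ⟨a, b, ⟨h1, h2⟩, rfl, rfl⟩
    exact ⟨h2, by simpa using h1⟩

lemma invCount_inv (x : Perm ℕ) : invCount x⁻¹ = invCount x := by
  rw [invCount, invSet_inv, Set.ncard_image_of_injective, invCount]
  rintro ⟨a, b⟩ ⟨c, d⟩ h
  simpa [and_comm] using h

lemma finite_invSet_inv {x : Perm ℕ} (hf : (invSet x).Finite) : (invSet x⁻¹).Finite := by
  rw [invSet_inv]; exact hf.image _

@[simp] lemma invSet_one : invSet 1 = ∅ := by
  ext ⟨p, q⟩
  simp only [mem_invSet, Perm.one_apply, Set.mem_empty_iff_false, iff_false]; omega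

lemma finite_invSet {n : ℕ} {x : Perm ℕ} (hx : x ∈ symmGroup n) : (invSet x).Finite := by
  apply ((Set.finite_Iic n).prod (Set.finite_Iic n)).subset
  rintro ⟨p, q⟩ ⟨h1, h2⟩
  simp only at h1 h2
  simp only [Set.mem_prod, Set.mem_Iic]
  by_cases hq : q ≤ n
  · omega
  · rw [symmGroup_gt hx (by omega)] at h2
    by_cases hp : p ≤ n
    · have := symmGroup_le hx hp; omega
    · rw [symmGroup_gt hx (by omega)] at h2; omega

lemma eq_one_of_asc {x : Perm ℕ} (h : ∀ m, x m < x (m + 1)) : x = 1 := by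
  have hm : StrictMono x := strictMono_nat_of_lt_succ h
  have hm' : StrictMono x.symm := by
    intro a b hab
    by_contra hc
    have := hm.monotone (not_lt.1 hc)
    simp at this; omega
  ext p
  have h1 := hm.le_apply (x := p)
  have h2 := hm'.le_apply (x := x p)
  simp at h2
  simp; omega

lemma exists_desc {n : ℕ} {x : Perm ℕ} (hx : x ∈ symmGroup n) (h : x ≠ 1) :
    ∃ m, 1 ≤ m ∧ m < n ∧ x (m + 1) < x m := by
  by_contra hc
  push Not at hc
  refine h (eq_one_of_asc fun m => ?_)
  have hne := asc_ne x m
  rcases Nat.eq_zero_or_pos m with rfl | hm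
  · rw [symmGroup_zero hx] at *; omega
  · by_cases hmn : m < n
    · have := hc m hm hmn; omega
    · rw [symmGroup_gt hx (k := m + 1) (by omega)]
      by_cases hmn' : m = n
      · have := symmGroup_le hx (le_of_eq hmn'); omega
      · rw [symmGroup_gt hx (k := m) (by omega)]; omega

/-! ### Words -/

/-- The product of a word in the simple transpositions. -/
def wprod (c : List ℕ) : Perm ℕ := (c.map simpleT).prod

@[simp] lemma wprod_nil : wprod [] = 1 := rfl

@[simp] lemma wprod_cons (m : ℕ) (c : List ℕ) : wprod (m :: c) = simpleT m * wprod c := by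
  simp [wprod]

@[simp] lemma wprod_append (c d : List ℕ) : wprod (c ++ d) = wprod c * wprod d := by
  simp [wprod]

lemma wprod_snoc (c : List ℕ) (m : ℕ) : wprod (c ++ [m]) = wprod c * simpleT m := by
  simp

lemma wprod_mem_symmGroup {n : ℕ} {c : List ℕ} (h : ∀ m ∈ c, 1 ≤ m ∧ m < n) :
    wprod c ∈ symmGroup n := by
  induction c with
  | nil => exact one_mem_symmGroup n
  | cons m c ih =>
    rw [wprod_cons]
    exact mul_mem_symmGroup (simpleT_mem_symmGroup (h m (by simp)).1 (h m (by simp)).2)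
      (ih fun k hk => h k (by simp [hk]))

lemma finite_invSet_wprod (c : List ℕ) : (invSet (wprod c)).Finite := by
  induction c using List.reverseRecOn with
  | nil => simp
  | append_singleton c m ih => rw [wprod_snoc]; exact finite_invSet_mul_simpleT m ih

lemma invCount_mul_simpleT_le {x : Perm ℕ} (m : ℕ) (hf : (invSet x).Finite) :
    invCount (x * simpleT m) ≤ invCount x + 1 := by
  rcases lt_or_gt_of_ne (asc_ne x m) with h | h
  · exact (invCount_mul_simpleT hf h).2.le
  · have := invCount_mul_simpleT_desc hf h; omega

lemma invCount_simpleT_mul_le {x : Perm ℕ} (m : ℕ) (hf : (invSet x).Finite) :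
    invCount (simpleT m * x) ≤ invCount x + 1 := by
  rw [← invCount_inv (simpleT m * x), ← invCount_inv x, mul_inv_rev, simpleT_inv]
  exact invCount_mul_simpleT_le m (finite_invSet_inv hf)

lemma asc_of_invCount {x : Perm ℕ} {m : ℕ} (hf : (invSet x).Finite)
    (h : invCount x < invCount (x * simpleT m)) : x m < x (m + 1) := by
  by_contra hc
  have := invCount_mul_simpleT_desc (m := m) hf (by have := asc_ne x m; omega)
  omega

lemma invCount_wprod_le (c : List ℕ) : invCount (wprod c) ≤ c.length := by
  induction c using List.reverseRecOn with
  | nil => simp [invCount]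
  | append_singleton c m ih =>
    rw [wprod_snoc, List.length_append]
    exact (invCount_mul_simpleT_le m (finite_invSet_wprod c)).trans (by simpa using ih)

lemma exists_reduced_word {n : ℕ} {x : Perm ℕ} (hx : x ∈ symmGroup n) :
    ∃ c : List ℕ, (∀ m ∈ c, 1 ≤ m ∧ m < n) ∧ wprod c = x ∧ c.length = invCount x := by
  induction hk : invCount x generalizing x with
  | zero =>
    refine ⟨[], by simp, ?_, rfl⟩
    by_contra hne
    obtain ⟨m, -, -, hd⟩ := exists_desc hx (Ne.symm hne)
    have := invCount_mul_simpleT_desc (finite_invSet hx) hd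
    omega
  | succ k ih =>
    have hne : x ≠ 1 := by rintro rfl; simp [invCount] at hk
    obtain ⟨m, h1, h2, hd⟩ := exists_desc hx hne
    have := invCount_mul_simpleT_desc (finite_invSet hx) hd
    obtain ⟨c, hc, hp, hl⟩ := ih (mul_mem_symmGroup hx (simpleT_mem_symmGroup h1 h2)) (by omega)
    refine ⟨c ++ [m], ?_, ?_, by simp [hl]⟩
    · intro a ha
      rcases List.mem_append.1 ha with ha | ha
      · exact hc a ha
      · rw [List.mem_singleton.1 ha]; exact ⟨h1, h2⟩
    · rw [wprod_snoc, hp]; simp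

lemma len_eq_invCount {n : ℕ} {x : Perm ℕ} (hx : x ∈ symmGroup n) : len x = invCount x := by
  obtain ⟨c, hc, hp, hl⟩ := exists_reduced_word hx
  apply le_antisymm
  · exact Nat.sInf_le ⟨c, ⟨fun a ha => (hc a ha).1, hp⟩, hl⟩
  · obtain ⟨d, ⟨-, hd⟩, hd'⟩ := Nat.sInf_mem (s := {k | ∃ a : List ℕ, IsWordFor a x ∧ a.length = k})
      ⟨_, c, ⟨fun a ha => (hc a ha).1, hp⟩, rfl⟩
    rw [len, ← hd', ← hd]
    exact invCount_wprod_le d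

/-- A word is reduced if its length is the number of inversions of its product. -/
def Red (c : List ℕ) : Prop := c.length = invCount (wprod c)

lemma red_nil : Red [] := by simp [Red, invCount]

lemma red_snoc {c : List ℕ} {m : ℕ} :
    Red (c ++ [m]) ↔ Red c ∧ wprod c m < wprod c (m + 1) := by
  unfold Red
  rw [wprod_snoc, List.length_append, List.length_singleton]
  have h1 := invCount_wprod_le c
  constructor
  · intro h
    have h2 := invCount_mul_simpleT_le m (finite_invSet_wprod c)
    have h3 : c.length = invCount (wprod c) := by omega
    exact ⟨h3, asc_of_invCount (finite_invSet_wprod c) (by omega)⟩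
  · rintro ⟨h, h'⟩
    rw [(invCount_mul_simpleT (finite_invSet_wprod c) h').2, h]

/-- The strong exchange property. -/
lemma exchange {c : List ℕ} {p q : ℕ} (hpq : p < q) (h : wprod c q < wprod c p) :
    ∃ u k v, c = u ++ k :: v ∧ wprod (u ++ v) = wprod c * swap p q ∧
      wprod v p = k ∧ wprod v q = k + 1 := by
  induction c using List.reverseRecOn generalizing p q with
  | nil => simp at h; omega
  | append_singleton c m ih =>
    rw [wprod_snoc] at h ⊢
    by_cases hm : p = m ∧ q = m + 1
    · obtain ⟨rfl, rfl⟩ := hm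
      refine ⟨c, p, [], rfl, ?_, by simp, by simp⟩
      rw [List.append_nil]
      exact (mul_simpleT_cancel (wprod c) p).symm
    -- The last letter does not interchange p and q, so it keeps their order and the exchange takes
    -- place in the prefix, for the images of p and q.
    · obtain ⟨u, k, v, rfl, h1, h2, h3⟩ := ih (simpleT_lt hpq hm) h
      refine ⟨u, k, v ++ [m], by simp, ?_, by simpa using h2, by simpa using h3⟩
      rw [← List.append_assoc, wprod_snoc, h1, mul_assoc, mul_assoc,
        Equiv.mul_swap_eq_swap_mul (simpleT m)]

/-- Strong exchange deletes a letter from a reduced word of the product and leaves a word for x. -/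
lemma invCount_lt_mul_swap {n : ℕ} {x : Perm ℕ} (hx : x ∈ symmGroup n) {p q : ℕ} (hpq : p < q)
    (hp : 1 ≤ p) (hq : q ≤ n) (h : x p < x q) : invCount x < invCount (x * swap p q) := by
  obtain ⟨c, -, hc, hl⟩ := exists_reduced_word
    (mul_mem_symmGroup hx (swap_mem_symmGroup hp (by omega) (by omega) hq))
  obtain ⟨u, k, v, rfl, h1, -, -⟩ := exchange (c := c) hpq (by rw [hc]; simpa using h)
  rw [hc, mul_assoc, swap_mul_self, mul_one] at h1
  have := invCount_wprod_le (u ++ v)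
  rw [h1] at this
  simp at this hl; omega

/-- A transposition that covers in length admits no intermediate value. -/
lemma no_between {n : ℕ} {x : Perm ℕ} (hx : x ∈ symmGroup n) {p q : ℕ}
    (hp : 1 ≤ p) (hq : q ≤ n) (hcov : invCount (x * swap p q) = invCount x + 1)
    {t : ℕ} (h1 : p < t) (h2 : t < q) (h3 : x p < x t) (h4 : x t < x q) : False := by
  -- With an intermediate value, x t_{pq} = x t_{pt} t_{pq} t_{tq} where each of the three factors
  -- raises the length, so the length grows by at least 3.
  have m1 := mul_mem_symmGroup hx (swap_mem_symmGroup (n := n) (p := p) (q := t) (by omega)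
    (by omega) (by omega) (by omega))
  have m2 := mul_mem_symmGroup m1 (swap_mem_symmGroup (n := n) (p := p) (q := q) (by omega)
    (by omega) (by omega) (by omega))
  have a1 := invCount_lt_mul_swap hx h1 hp (by omega) h3
  have a2 := invCount_lt_mul_swap m1 (p := p) (q := q) (by omega) hp hq (by
    simp [swap_apply_of_ne_of_ne (show q ≠ p by omega) (show q ≠ t by omega)]; omega)
  have a3 := invCount_lt_mul_swap m2 (p := t) (q := q) h2 (by omega) hq (by
    simp [swap_apply_of_ne_of_ne (show t ≠ p by omega) (show t ≠ q by omega)]; omega)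
  have e : x * swap p t * swap p q * swap t q = x * swap p q := by
    rw [mul_assoc, mul_assoc]
    congr 1
    ext k
    simp only [Perm.mul_apply, swap_apply_def]
    split_ifs <;> omega
  rw [e] at a3
  omega

lemma le_mul_swap {x : Perm ℕ} {p q : ℕ} (hpq : p ≤ q) (h : x p ≤ x q) :
    BruhatLE x (x * swap p q) := by
  rcases Nat.eq_or_lt_of_le hpq with rfl | hpq
  · rw [swap_self]; exact BruhatLE.refl x
  intro a b
  unfold rk
  by_cases ha : q < a
  · apply le_of_eq
    have hr : ∀ i, i < a ↔ swap p q i < a := by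
      intro i; rw [swap_apply_def]; split_ifs <;> omega
    apply Finset.card_bij' (fun i _ => swap p q i) (fun i _ => swap p q i)
    · intro i hi
      rw [Finset.mem_filter, Finset.mem_range] at hi ⊢
      rw [Perm.mul_apply] at hi
      exact ⟨(hr i).1 hi.1, hi.2⟩
    · intro i hi
      rw [Finset.mem_filter, Finset.mem_range] at hi ⊢
      rw [Perm.mul_apply, swap_apply_self]
      exact ⟨(hr i).1 hi.1, hi.2⟩
    · simp
    · simp
  · apply Finset.card_le_card
    intro i hi
    rw [Finset.mem_filter, Finset.mem_range] at hi ⊢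
    rw [Perm.mul_apply, swap_apply_def] at hi
    refine ⟨hi.1, ?_⟩
    split_ifs at hi <;> subst_vars <;> omega

/-! ### Involutions and the involution length -/

lemma mem_involutions_iff {n : ℕ} {x : Perm ℕ} :
    x ∈ involutions n ↔ x ∈ symmGroup n ∧ x⁻¹ = x :=
  and_congr_right fun _ => eq_comm

lemma involutions_inv {n : ℕ} {x : Perm ℕ} (hx : x ∈ involutions n) : x⁻¹ = x := hx.2.symm

lemma involutions_mono {n N : ℕ} (h : n ≤ N) : involutions n ⊆ involutions N :=
  fun _ hx => ⟨symmGroup_mono h hx.1, hx.2⟩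

lemma one_mem_involutions (n : ℕ) : (1 : Perm ℕ) ∈ involutions n := ⟨one_mem_symmGroup n, by simp⟩

lemma dR_mem_symmGroup {n m : ℕ} {x : Perm ℕ} (hx : x ∈ symmGroup n) (h1 : 1 ≤ m) (h2 : m < n) :
    dR m x ∈ symmGroup n := by
  unfold dR; split_ifs
  · exact mul_mem_symmGroup hx (simpleT_mem_symmGroup h1 h2)
  · exact hx

lemma dL_mem_symmGroup {n m : ℕ} {x : Perm ℕ} (hx : x ∈ symmGroup n) (h1 : 1 ≤ m) (h2 : m < n) :
    dL m x ∈ symmGroup n :=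
  inv_mem_symmGroup (dR_mem_symmGroup (inv_mem_symmGroup hx) h1 h2)

lemma downR_mem_symmGroup {n m : ℕ} {x : Perm ℕ} (hx : x ∈ symmGroup n) (h1 : 1 ≤ m) (h2 : m < n) :
    downR m x ∈ symmGroup n := by
  unfold downR; split_ifs
  · exact hx
  · exact mul_mem_symmGroup hx (simpleT_mem_symmGroup h1 h2)

lemma dU_mem_involutions {n m : ℕ} {x : Perm ℕ} (hx : x ∈ involutions n) (h1 : 1 ≤ m)
    (h2 : m < n) : dU m x ∈ involutions n :=
  mem_involutions_iff.2 ⟨dL_mem_symmGroup (dR_mem_symmGroup hx.1 h1 h2) h1 h2,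
    inv_dU (involutions_inv hx)⟩

lemma dE_mem_involutions {n m : ℕ} {x : Perm ℕ} (hx : x ∈ involutions n) (h1 : 1 ≤ m)
    (h2 : m < n) : dE m x ∈ involutions n :=
  mem_involutions_iff.2 ⟨inv_mem_symmGroup (downR_mem_symmGroup (inv_mem_symmGroup
    (downR_mem_symmGroup hx.1 h1 h2)) h1 h2), inv_dE (involutions_inv hx)⟩

/-- The number of points that are not fixed. -/
noncomputable def moved (x : Perm ℕ) : ℕ := {p | x p ≠ p}.ncard

lemma finite_moved {n : ℕ} {x : Perm ℕ} (hx : x ∈ symmGroup n) : {p | x p ≠ p}.Finite :=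
  (Set.finite_Iic n).subset fun p hp => by
    by_contra h
    exact hp (symmGroup_gt hx (by simpa using h))

/-- Four times the involution length, as `2 ℓ(x)` plus the number of non-fixed points. -/
noncomputable def invStat (x : Perm ℕ) : ℕ := 2 * invCount x + moved x

lemma moved_conj (m : ℕ) (x : Perm ℕ) : moved (simpleT m * x * simpleT m) = moved x := by
  unfold moved
  rw [← Set.ncard_image_of_injective {p | x p ≠ p} (simpleT m).injective]
  congr 1
  ext p
  simp only [Set.mem_ofPred_eq, Set.mem_image, Perm.mul_apply]
  constructor
  · intro h
    refine ⟨simpleT m p, fun h' => h ?_, by simp⟩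
    rw [h']; simp
  · rintro ⟨q, h, rfl⟩ h'
    apply h
    simpa using h'

lemma moved_comm {n m : ℕ} {x : Perm ℕ} (hx : x ∈ symmGroup n) (h1 : x m = m)
    (h2 : x (m + 1) = m + 1) : moved (x * simpleT m) = moved x + 2 := by
  unfold moved
  have : {p | (x * simpleT m) p ≠ p} = insert m (insert (m + 1) {p | x p ≠ p}) := by
    ext p
    simp only [Set.mem_ofPred_eq, Set.mem_insert_iff, Perm.mul_apply]
    by_cases hp : p = m
    · subst hp; simp [h2]
    · by_cases hp' : p = m + 1
      · subst hp'; simp [h1]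
      · rw [simpleT_of_ne hp hp']; simp [hp, hp']
  rw [this, Set.ncard_insert_of_notMem _ ((finite_moved hx).insert _),
    Set.ncard_insert_of_notMem _ (finite_moved hx)]
  · simp [h2]
  · simp [h1]

lemma invCount_conj {n m : ℕ} {x : Perm ℕ} (hx : x ∈ involutions n) (h : x m < x (m + 1))
    (hc : ¬ (x m = m ∧ x (m + 1) = m + 1)) :
    invCount (simpleT m * x * simpleT m) = invCount x + 2 := by
  have hi := involutions_inv hx
  obtain ⟨f1, e1⟩ := invCount_mul_simpleT (finite_invSet hx.1) h
  have e2 : simpleT m * x = (x * simpleT m)⁻¹ := by rw [mul_inv_rev, hi, simpleT_inv]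
  rw [(invCount_mul_simpleT (x := simpleT m * x) (m := m) (by rw [e2]; exact finite_invSet_inv f1)
    (simpleT_lt h hc)).2, e2, invCount_inv, e1]

/-- The two kinds of ascent balance: the commuting one adds 1 to the length and 2 moved points, the
conjugating one adds 2 to the length and no moved point. -/
lemma invStat_dU {n m : ℕ} {x : Perm ℕ} (hx : x ∈ involutions n) (h : x m < x (m + 1)) :
    invStat (dU m x) = invStat x + 4 := by
  unfold invStat
  by_cases hc : x m = m ∧ x (m + 1) = m + 1
  · rw [dU_of_comm hc.1 hc.2, moved_comm hx.1 hc.1 hc.2,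
      (invCount_mul_simpleT (finite_invSet hx.1) h).2]
    ring
  · rw [dU_of_conj (involutions_inv hx) h hc, moved_conj, invCount_conj hx h hc]
    ring

lemma invStat_dU_le {n m : ℕ} {x : Perm ℕ} (hx : x ∈ involutions n) :
    invStat (dU m x) ≤ invStat x + 4 := by
  rcases lt_or_gt_of_ne (asc_ne x m) with h | h
  · exact (invStat_dU hx h).le
  · rw [dU_of_desc (involutions_inv hx) h]; omega

lemma invStat_one : invStat 1 = 0 := by simp [invStat, invCount, moved]

lemma invStat_dE {n m : ℕ} {x : Perm ℕ} (hx : x ∈ involutions n) (h1 : 1 ≤ m) (h2 : m < n)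
    (h : x (m + 1) < x m) : invStat x = invStat (dE m x) + 4 := by
  have := invStat_dU (dE_mem_involutions hx h1 h2) (dE_asc (m := m) (involutions_inv hx))
  rwa [dU_dE (involutions_inv hx) h] at this

/-- On involutions, the involution length is strictly monotone in the Bruhat order. -/
lemma invStat_strictMono {n : ℕ} {x y : Perm ℕ} (hx : x ∈ involutions n) (hy : y ∈ involutions n)
    (hxy : BruhatLE x y) : invStat x ≤ invStat y ∧ (invStat x = invStat y → x = y) := by
  induction hk : invStat y using Nat.strong_induction_on generalizing x y with
  | _ k ih =>
    by_cases h1 : y = 1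
    · subst h1
      have := hxy.antisymm (BruhatLE.one_le x)
      subst this
      exact ⟨hk.le, fun _ => rfl⟩
    · obtain ⟨m, hm1, hm2, hd⟩ := exists_desc hy.1 h1
      have hE := invStat_dE hy hm1 hm2 hd
      have hle := dE_mono m hxy
      rcases lt_or_gt_of_ne (asc_ne x m) with h | h
      -- An ascent of x at a descent of y: x already lies below the lowered y, so the inequality is
      -- strict and the equality clause is vacuous.
      · rw [dE_of_asc (involutions_inv hx) h] at hle
        have := ih _ (by omega) hx (dE_mem_involutions hy hm1 hm2) hle rfl
        exact ⟨by omega, fun _ => by omega⟩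
      · have hE' := invStat_dE hx hm1 hm2 h
        have := ih _ (by omega) (dE_mem_involutions hx hm1 hm2)
          (dE_mem_involutions hy hm1 hm2) hle rfl
        refine ⟨by omega, fun _ => ?_⟩
        rw [← dU_dE (involutions_inv hx) h, ← dU_dE (involutions_inv hy) hd, this.2 (by omega)]

/-! ### Involution words -/

/-- Iterated twofold Demazure products. -/
def dUs (x : Perm ℕ) (c : List ℕ) : Perm ℕ := c.foldl (fun x m => dU m x) x

/-- Iterated right Demazure products. -/
def dRs (x : Perm ℕ) (c : List ℕ) : Perm ℕ := c.foldl (fun x m => dR m x) x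

/-- Iterated left Demazure products. -/
def dLs (x : Perm ℕ) (c : List ℕ) : Perm ℕ := c.foldl (fun x m => dL m x) x

@[simp] lemma dUs_nil (x : Perm ℕ) : dUs x [] = x := rfl
@[simp] lemma dUs_cons (x : Perm ℕ) (m : ℕ) (c : List ℕ) :
    dUs x (m :: c) = dUs (dU m x) c := rfl
lemma dUs_append (x : Perm ℕ) (c d : List ℕ) : dUs x (c ++ d) = dUs (dUs x c) d :=
  List.foldl_append
lemma dUs_snoc (x : Perm ℕ) (c : List ℕ) (m : ℕ) : dUs x (c ++ [m]) = dU m (dUs x c) := by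
  rw [dUs_append]; rfl
@[simp] lemma dRs_nil (x : Perm ℕ) : dRs x [] = x := rfl
@[simp] lemma dRs_cons (x : Perm ℕ) (m : ℕ) (c : List ℕ) :
    dRs x (m :: c) = dRs (dR m x) c := rfl
lemma dRs_snoc (x : Perm ℕ) (c : List ℕ) (m : ℕ) : dRs x (c ++ [m]) = dR m (dRs x c) := by
  simp [dRs]
@[simp] lemma dLs_nil (x : Perm ℕ) : dLs x [] = x := rfl
lemma dLs_snoc (x : Perm ℕ) (c : List ℕ) (m : ℕ) : dLs x (c ++ [m]) = dL m (dLs x c) := by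
  simp [dLs]

/-- Every letter of the word raises the twofold Demazure product, starting from `x`. -/
def RaisesFrom : Perm ℕ → List ℕ → Prop
  | _, [] => True
  | x, m :: c => x m < x (m + 1) ∧ RaisesFrom (dU m x) c

lemma raisesFrom_append {x : Perm ℕ} {c d : List ℕ} :
    RaisesFrom x (c ++ d) ↔ RaisesFrom x c ∧ RaisesFrom (dUs x c) d := by
  induction c generalizing x with
  | nil => simp [RaisesFrom]
  | cons m c ih => simp [RaisesFrom, ih, and_assoc]

lemma raisesFrom_snoc {x : Perm ℕ} {c : List ℕ} {m : ℕ} :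
    RaisesFrom x (c ++ [m]) ↔ RaisesFrom x c ∧ dUs x c m < dUs x c (m + 1) := by
  simp [raisesFrom_append, RaisesFrom]

lemma dUs_mem_involutions {n : ℕ} {x : Perm ℕ} (hx : x ∈ involutions n) {c : List ℕ}
    (hc : ∀ m ∈ c, 1 ≤ m ∧ m < n) : dUs x c ∈ involutions n := by
  induction c generalizing x with
  | nil => exact hx
  | cons m c ih =>
    exact ih (dU_mem_involutions hx (hc m (by simp)).1 (hc m (by simp)).2)
      fun k hk => hc k (by simp [hk])

/-- Each letter contributes 4 or 0, so being an involution word becomes a numerical equality. This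
is how raising is deduced later from Bruhat comparisons. -/
lemma invStat_dUs {n : ℕ} {x : Perm ℕ} (hx : x ∈ involutions n) {c : List ℕ}
    (hc : ∀ m ∈ c, 1 ≤ m ∧ m < n) :
    invStat (dUs x c) ≤ invStat x + 4 * c.length ∧
      (invStat (dUs x c) = invStat x + 4 * c.length ↔ RaisesFrom x c) := by
  induction c generalizing x with
  | nil => simp [RaisesFrom]
  | cons m c ih =>
    have := ih (dU_mem_involutions hx (hc m (by simp)).1 (hc m (by simp)).2)
      fun k hk => hc k (by simp [hk])
    have hle := invStat_dU_le (m := m) hx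
    simp only [dUs_cons, RaisesFrom, List.length_cons]
    refine ⟨by omega, ?_⟩
    rw [← this.2]
    constructor
    · intro h
      refine ⟨?_, by omega⟩
      by_contra h'
      rw [dU_of_desc (involutions_inv hx) (by have := asc_ne x m; omega)] at *
      omega
    · rintro ⟨h1, h2⟩
      have := invStat_dU hx h1
      omega

lemma dUs_mono {x y : Perm ℕ} (h : BruhatLE x y) (c : List ℕ) :
    BruhatLE (dUs x c) (dUs y c) := by
  induction c generalizing x y with
  | nil => exact h
  | cons m c ih => exact ih (dU_mono m h)

/-- The inversions of the ordinary product stay among those of the involution, so a letter that is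
an ascent of the involution is an ascent of the product too. Involution words are therefore reduced
words. -/
lemma RaisesFrom.red {n : ℕ} {c : List ℕ} (hc : ∀ m ∈ c, 1 ≤ m ∧ m < n) (h : RaisesFrom 1 c) :
    Red c ∧ invSet (wprod c) ⊆ invSet (dUs 1 c) := by
  induction c using List.reverseRecOn with
  | nil => exact ⟨red_nil, by simp⟩
  | append_singleton c m ih =>
    rw [raisesFrom_snoc] at h
    have hc' : ∀ m ∈ c, 1 ≤ m ∧ m < n := fun k hk => hc k (by simp [hk])
    obtain ⟨h1, h2⟩ := ih hc' h.1
    have hx := dUs_mem_involutions (one_mem_involutions n) hc'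
    set x := dUs 1 c with hxdef
    have hw : wprod c m < wprod c (m + 1) := by
      by_contra hd
      have : (m, m + 1) ∈ invSet x := 
        h2 (mem_invSet.2 ⟨by omega, by have := asc_ne (wprod c) m; omega⟩)
      have := this.2
      simp only at this; omega
    refine ⟨red_snoc.2 ⟨h1, hw⟩, ?_⟩
    rw [dUs_snoc, ← hxdef, wprod_snoc, invSet_mul_simpleT hw]
    have hsub : invSet (x * simpleT m) ⊆ invSet (dU m x) := by
      by_cases hc : x m = m ∧ x (m + 1) = m + 1
      · rw [dU_of_comm hc.1 hc.2]
      · rw [dU_of_conj (involutions_inv hx) h.2 hc]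
        rintro ⟨p, q⟩ hpq
        rw [mem_invSet] at hpq ⊢
        obtain ⟨h3, h4⟩ := hpq
        refine ⟨h3, ?_⟩
        simp only [Perm.mul_apply] at h4 ⊢
        apply simpleT_lt h4
        rintro ⟨h5, h6⟩
        have e1 := inv_apply_of_inv (involutions_inv hx) (simpleT m q)
        have e2 := inv_apply_of_inv (involutions_inv hx) (simpleT m p)
        rw [h5] at e1; rw [h6] at e2
        have h7 : x m < x (m + 1) := h.2
        have h8 : ¬ (simpleT m q < simpleT m p) ∨ (q = m + 1 ∧ p = m) ∨ (p = m ∧ q = m+1) := by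
          by_cases hpq : p = m ∧ q = m + 1
          · tauto
          · left; have := simpleT_lt h3 hpq; omega
        rcases h8 with h8 | ⟨rfl, rfl⟩ | ⟨rfl, rfl⟩
        · omega
        · simp at e1 e2; omega
        · simp at e1 e2; omega
    refine subset_trans ?_ hsub
    rw [invSet_mul_simpleT h.2]
    exact Set.insert_subset_insert (Set.image_mono h2)

lemma exists_raising_subword {n : ℕ} {c : List ℕ} (hc : ∀ m ∈ c, 1 ≤ m ∧ m < n) :
    ∃ c' : List ℕ, (∀ m ∈ c', 1 ≤ m ∧ m < n) ∧ RaisesFrom 1 c' ∧ dUs 1 c' = dUs 1 c := by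
  induction c using List.reverseRecOn with
  | nil => exact ⟨[], by simp, trivial, rfl⟩
  | append_singleton c m ih =>
    obtain ⟨d, hd, hr, he⟩ := ih fun k hk => hc k (by simp [hk])
    have hx := dUs_mem_involutions (one_mem_involutions n) hd
    rcases lt_or_gt_of_ne (asc_ne (dUs 1 d) m) with h | h
    · refine ⟨d ++ [m], ?_, raisesFrom_snoc.2 ⟨hr, h⟩, by rw [dUs_snoc, dUs_snoc, he]⟩
      intro k hk
      rcases List.mem_append.1 hk with hk | hk
      · exact hd k hk
      · exact hc k (by simp at hk; simp [hk])
    · exact ⟨d, hd, hr, by rw [dUs_snoc, ← he, dU_of_desc (involutions_inv hx) h]⟩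

/-! ### Demazure products and atoms -/

lemma dL_dRs_comm (m : ℕ) (x : Perm ℕ) (c : List ℕ) : dL m (dRs x c) = dRs (dL m x) c := by
  induction c generalizing x with
  | nil => rfl
  | cons k c ih => rw [dRs_cons, dRs_cons, ih, dR_dL_comm]

/-- Left and right steps commute, so all left steps can be done first. Starting from 1, a reduced
word of w then gives w⁻¹ ∘ w. -/
lemma dUs_eq (x : Perm ℕ) (c : List ℕ) : dUs x c = dRs (dLs x c) c := by
  induction c using List.reverseRecOn with
  | nil => rfl
  | append_singleton c m ih =>
    rw [dUs_snoc, dLs_snoc, dRs_snoc, ih, ← dL_dRs_comm, dR_dL_comm]; rfl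

lemma dLs_one {c : List ℕ} (h : Red c) : dLs 1 c = (wprod c)⁻¹ := by
  induction c using List.reverseRecOn with
  | nil => simp
  | append_singleton c m ih =>
    rw [red_snoc] at h
    rw [dLs_snoc, ih h.1, dL_inv, dR_of_asc h.2, wprod_snoc]

/-- The rank function of a Demazure product as a max-plus product. -/
lemma rk_dRs (x : Perm ℕ) {c : List ℕ} (h : Red c) (p q : ℕ) :
    (∀ t, rk x t q + rk (wprod c) p t ≤ rk (dRs x c) p q + t) ∧
      ∃ t, rk (dRs x c) p q + t = rk x t q + rk (wprod c) p t := by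
  induction c using List.reverseRecOn generalizing p with
  | nil =>
    simp only [dRs_nil, wprod_nil, rk_one]
    refine ⟨fun t => ?_, p, by simp⟩
    rcases le_total t p with ht | ht
    · have := rk_mono_left x ht q; omega
    · obtain ⟨d, rfl⟩ := Nat.exists_eq_add_of_le ht
      have := rk_add_le x p q d; omega
  | append_singleton c m ih =>
    rw [red_snoc] at h
    rw [dRs_snoc, wprod_snoc]
    by_cases hp : p = m + 1
    · subst hp
      obtain ⟨a1, t1, b1⟩ := ih h.1 m
      obtain ⟨a2, t2, b2⟩ := ih h.1 (m + 2)
      simp only [rk_dR_eq, rk_mul_simpleT_eq]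
      have key : ∀ t, rk (wprod c) (m + 2) t = rk (wprod c) m t +
        (if wprod c m < t then 1 else 0) + if wprod c (m + 1) < t then 1 else 0 :=
        fun t => rk_add_two _ _ _
      refine ⟨fun t => ?_, ?_⟩
      · have := a1 t; have := a2 t; have := key t
        split_ifs at * <;> omega
      · rcases le_total (rk (dRs x c) (m + 2) q - 1) (rk (dRs x c) m q) with hle | hle
        · refine ⟨t1, ?_⟩
          have := a1 t1; have := a2 t1; have := key t1
          split_ifs at * <;> omega
        -- If the rank in row m+2 is 0, the truncated subtraction hides it and the maximum is
        -- attained at the witness for row m.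
        · by_cases h0 : rk (dRs x c) (m + 2) q = 0
          · refine ⟨t1, ?_⟩
            have := a1 t1; have := a2 t1; have := key t1
            split_ifs at * <;> omega
          · refine ⟨t2, ?_⟩
            have := a1 t2; have := a2 t2; have := key t2
            split_ifs at * <;> omega
    · simp only [rk_dR_ne hp, rk_mul_simpleT_ne _ hp]
      exact ih h.1 p

/-- The max-plus formula mentions only the product of the word, so the Demazure product does not
depend on the reduced word chosen. -/
lemma dRs_congr (x : Perm ℕ) {c d : List ℕ} (hc : Red c) (hd : Red d)
    (h : wprod c = wprod d) : dRs x c = dRs x d := by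
  apply rk_ext
  intro p q
  obtain ⟨a1, t1, b1⟩ := rk_dRs x hc p q
  obtain ⟨a2, t2, b2⟩ := rk_dRs x hd p q
  rw [h] at a1 b1
  have := a1 t2; have := a2 t1
  omega

lemma dUs_one_congr {c d : List ℕ} (hc : Red c) (hd : Red d) (h : wprod c = wprod d) :
    dUs 1 c = dUs 1 d := by
  rw [dUs_eq, dUs_eq, dLs_one hc, dLs_one hd, h, dRs_congr _ hc hd h]

lemma demazureStep_eq {n : ℕ} {v : Perm ℕ} (hv : v ∈ symmGroup n) {i : ℕ} (hi : 1 ≤ i) :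
    demazureStep v i = dR i v := by
  have h1 : v * simpleT i ∈ symmGroup (n + i + 1) :=
    mul_mem_symmGroup (symmGroup_mono (by omega) hv) (simpleT_mem_symmGroup hi (by omega))
  unfold demazureStep dR
  rw [len_eq_invCount hv, len_eq_invCount h1]
  congr 1
  apply propext
  constructor
  · exact asc_of_invCount (finite_invSet hv)
  · intro h
    rw [(invCount_mul_simpleT (finite_invSet hv) h).2]; omega

lemma foldl_demazureStep {n : ℕ} {v : Perm ℕ} (hv : v ∈ symmGroup n) {a : List ℕ}
    (ha : ∀ i ∈ a, 1 ≤ i) : a.foldl demazureStep v = dRs v a := by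
  induction a generalizing n v with
  | nil => rfl
  | cons i a ih =>
    have hi := ha i (by simp)
    rw [List.foldl_cons, demazureStep_eq hv hi, dRs_cons]
    exact ih (dR_mem_symmGroup (n := n + i + 1) (symmGroup_mono (by omega) hv) hi (by omega))
      fun k hk => ha k (by simp [hk])

lemma isReducedWord_iff {n : ℕ} {w : Perm ℕ} (hw : w ∈ symmGroup n) {a : List ℕ} :
    IsReducedWord a w ↔ (∀ i ∈ a, 1 ≤ i) ∧ wprod a = w ∧ Red a := by
  unfold IsReducedWord IsWordFor Red
  rw [len_eq_invCount hw]
  constructor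
  · rintro ⟨⟨h1, h2⟩, h3⟩
    have h2' : wprod a = w := h2
    exact ⟨h1, h2', by rw [h2', h3]⟩
  · rintro ⟨h1, h2, h3⟩
    exact ⟨⟨h1, h2⟩, by rw [h3, h2]⟩

lemma isDemazureProduct_iff {n : ℕ} {w y : Perm ℕ} (hw : w ∈ symmGroup n) {c : List ℕ}
    (hc1 : ∀ i ∈ c, 1 ≤ i) (hc : wprod c = w) (hr : Red c) :
    IsDemazureProduct w⁻¹ w y ↔ dUs 1 c = y := by
  unfold IsDemazureProduct
  constructor
  · rintro ⟨a, ha, rfl⟩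
    rw [isReducedWord_iff hw] at ha
    rw [foldl_demazureStep (inv_mem_symmGroup hw) ha.1, dUs_one_congr hr ha.2.2 (hc.trans ha.2.1.symm),
      dUs_eq, dLs_one ha.2.2, ha.2.1]
  · rintro rfl
    refine ⟨c, (isReducedWord_iff hw).2 ⟨hc1, hc, hr⟩, ?_⟩
    rw [foldl_demazureStep (inv_mem_symmGroup hw) hc1, dUs_eq, dLs_one hr, hc]

/-- A letter gains at most 4 in `invStat`, and here every letter gains exactly 4, so no word with
the same Demazure product is shorter. -/
lemma wprod_mem_atoms {n : ℕ} {c : List ℕ} (hc : ∀ m ∈ c, 1 ≤ m ∧ m < n) (h : RaisesFrom 1 c) :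
    wprod c ∈ atoms n (dUs 1 c) := by
  have hw := wprod_mem_symmGroup hc
  have hr := (h.red hc).1
  refine ⟨hw, (isDemazureProduct_iff hw (fun i hi => (hc i hi).1) rfl hr).2 rfl, fun v hv hdem => ?_⟩
  obtain ⟨a, ha, hav, hal⟩ := exists_reduced_word hv
  have har : Red a := by unfold Red; rw [hav, hal]
  rw [isDemazureProduct_iff hv (fun i hi => (ha i hi).1) hav har] at hdem
  rw [len_eq_invCount hw, len_eq_invCount hv, ← hr, ← hal]
  have h1 := (invStat_dUs (one_mem_involutions n) ha).1
  have h2 := (invStat_dUs (one_mem_involutions n) hc).2.2 h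
  rw [hdem] at h1
  omega

/-- Dropping the letters that do not raise leaves an involution word for y. Minimality of the atom
bounds the length of c by that of this word, so nothing was dropped. -/
lemma raises_of_mem_atoms {n : ℕ} {w y : Perm ℕ} (hw : w ∈ atoms n y) {c : List ℕ}
    (hc : ∀ m ∈ c, 1 ≤ m ∧ m < n) (hcw : wprod c = w) (hr : Red c) :
    RaisesFrom 1 c ∧ dUs 1 c = y := by
  obtain ⟨hws, hdem, hmin⟩ := hw
  rw [isDemazureProduct_iff hws (fun i hi => (hc i hi).1) hcw hr] at hdem
  refine ⟨?_, hdem⟩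
  obtain ⟨d, hd, hdr, hde⟩ := exists_raising_subword hc
  have h1 := (hdr.red hd).1
  have h2 := hmin (wprod d) (wprod_mem_symmGroup hd)
    ((isDemazureProduct_iff (wprod_mem_symmGroup hd) (fun i hi => (hd i hi).1) rfl h1).2
      (hde.trans hdem))
  rw [len_eq_invCount hws, len_eq_invCount (wprod_mem_symmGroup hd), ← h1, ← hcw, ← hr] at h2
  have h3 := invStat_dUs (one_mem_involutions n) hc
  have h4 := (invStat_dUs (one_mem_involutions n) hd).2.2 hdr
  rw [hde] at h4
  rw [← h3.2]
  omega

lemma invLen_eq {n : ℕ} {c : List ℕ} (hc : ∀ m ∈ c, 1 ≤ m ∧ m < n) (h : RaisesFrom 1 c) :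
    invLen n (dUs 1 c) = c.length := by
  have hw := wprod_mem_atoms hc h
  have hl : len (wprod c) = c.length := by
    rw [len_eq_invCount hw.1]; exact ((h.red hc).1).symm
  unfold invLen
  apply le_antisymm
  · exact (Nat.sInf_le (Set.mem_image_of_mem len hw)).trans hl.le
  · obtain ⟨v, hv, hv'⟩ := Nat.sInf_mem (s := len '' atoms n (dUs 1 c)) (Set.Nonempty.image len ⟨_, hw⟩)
    rw [← hv', ← hl]
    exact hw.2.2 v hv.1 hv.2.1

/-! ### Reading words -/

/-- The cells of row `i` in columns `k, k - 1, …, 1`. -/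
def rowCells (i : ℕ) : ℕ → List (ℕ × ℕ)
  | 0 => []
  | k + 1 => (i, k + 1) :: rowCells i k

/-- The cells in rows `i, …, i + k - 1` and columns `1, …, N`, in reading order: rows from top to
bottom, each row from right to left. -/
def boxCells (N : ℕ) : ℕ → ℕ → List (ℕ × ℕ)
  | _, 0 => []
  | i, k + 1 => rowCells i N ++ boxCells N (i + 1) k

/-- The cells after `(i, j)` in reading order. -/
def cellsAfter (N i j : ℕ) : List (ℕ × ℕ) := rowCells i (j - 1) ++ boxCells N (i + 1) (N - i)

/-- The subword of the reading word of `D` given by the cells in a list. -/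
def wordOn (D : Finset (ℕ × ℕ)) (l : List (ℕ × ℕ)) : List ℕ :=
  (l.filter (· ∈ D)).map (fun c => c.1 + c.2 - 1)

/-- The reading word of `D`. -/
def word (N : ℕ) (D : Finset (ℕ × ℕ)) : List ℕ := wordOn D (boxCells N 1 N)

/-- The order in which cells are read. -/
def ReadBefore (c d : ℕ × ℕ) : Prop := c.1 < d.1 ∨ (c.1 = d.1 ∧ d.2 < c.2)

lemma mem_rowCells {i k : ℕ} {c : ℕ × ℕ} :
    c ∈ rowCells i k ↔ c.1 = i ∧ 1 ≤ c.2 ∧ c.2 ≤ k := by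
  induction k with
  | zero => simp [rowCells]; omega
  | succ k ih =>
    rw [rowCells, List.mem_cons, ih, Prod.ext_iff]
    simp only; omega

lemma mem_boxCells {N i k : ℕ} {c : ℕ × ℕ} :
    c ∈ boxCells N i k ↔ i ≤ c.1 ∧ c.1 < i + k ∧ 1 ≤ c.2 ∧ c.2 ≤ N := by
  induction k generalizing i with
  | zero => simp [boxCells]; omega
  | succ k ih => rw [boxCells, List.mem_append, ih, mem_rowCells]; omega

lemma mem_cellsAfter {N i j : ℕ} {c : ℕ × ℕ} :
    c ∈ cellsAfter N i j ↔ (c.1 = i ∧ 1 ≤ c.2 ∧ c.2 < j) ∨ (i < c.1 ∧ c.1 ≤ N ∧ 1 ≤ c.2 ∧ c.2 ≤ N) := by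
  rw [cellsAfter, List.mem_append, mem_rowCells, mem_boxCells]; omega

lemma pairwise_rowCells (i k : ℕ) : (rowCells i k).Pairwise ReadBefore := by
  induction k with
  | zero => simp [rowCells]
  | succ k ih =>
    rw [rowCells, List.pairwise_cons]
    refine ⟨fun c hc => ?_, ih⟩
    rw [mem_rowCells] at hc
    right; simp only; omega

lemma pairwise_boxCells (N i k : ℕ) : (boxCells N i k).Pairwise ReadBefore := by
  induction k generalizing i with
  | zero => simp [boxCells]
  | succ k ih =>
    rw [boxCells, List.pairwise_append]
    refine ⟨pairwise_rowCells _ _, ih _, fun c hc d hd => ?_⟩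
    rw [mem_rowCells] at hc; rw [mem_boxCells] at hd
    left; omega

lemma nodup_boxCells (N i k : ℕ) : (boxCells N i k).Nodup :=
  (pairwise_boxCells N i k).imp fun {a b} h => by rintro rfl; unfold ReadBefore at h; omega

lemma rowCells_split {i j k : ℕ} (h : j ≤ k) :
    ∃ X, rowCells i k = X ++ rowCells i j ∧ ∀ c ∈ X, c.1 = i ∧ j < c.2 ∧ c.2 ≤ k := by
  induction k with
  | zero => exact ⟨[], by rw [Nat.le_zero.1 h]; rfl, by simp⟩
  | succ k ih =>
    rcases Nat.lt_or_eq_of_le h with hlt | rfl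
    · obtain ⟨X, hX, hX'⟩ := ih (Nat.lt_succ_iff.1 hlt)
      refine ⟨(i, k + 1) :: X, by rw [rowCells, hX]; rfl, ?_⟩
      intro c hc
      rcases List.mem_cons.1 hc with rfl | hc
      · exact ⟨rfl, hlt, le_rfl⟩
      · have := hX' c hc; exact ⟨this.1, this.2.1, by omega⟩
    · exact ⟨[], rfl, by simp⟩

lemma boxCells_split (N i k l : ℕ) :
    boxCells N i (k + l) = boxCells N i k ++ boxCells N (i + k) l := by
  induction k generalizing i with
  | zero => simp [boxCells]
  | succ k ih =>
    rw [show k + 1 + l = (k + l) + 1 by omega, boxCells, boxCells, ih, List.append_assoc,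
      show i + 1 + k = i + (k + 1) by omega]

lemma cellsAfter_succ (N i : ℕ) {j : ℕ} (hj : 1 ≤ j) :
    cellsAfter N i (j + 1) = (i, j) :: cellsAfter N i j := by
  obtain ⟨j, rfl⟩ := Nat.exists_eq_add_of_le' hj
  rfl

lemma cellsAfter_eq (N i : ℕ) {j : ℕ} (hj : j ≤ N) (hi : i < N) :
    ∃ X, cellsAfter N i j = rowCells i (j - 1) ++ (X ++ cellsAfter N (i + 1) (j + 1)) ∧
      ∀ c ∈ X, c.1 = i + 1 ∧ j < c.2 ∧ c.2 ≤ N := by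
  obtain ⟨X, hX, hX'⟩ := rowCells_split (i := i + 1) hj
  refine ⟨X, ?_, hX'⟩
  rw [cellsAfter, cellsAfter, show N - i = (N - (i + 1)) + 1 by omega, boxCells, hX]
  simp

lemma boxCells_eq {N i j : ℕ} (hi : 1 ≤ i) (hi' : i ≤ N) (hj : 1 ≤ j) (hj' : j ≤ N) :
    ∃ B, boxCells N 1 N = B ++ (i, j) :: cellsAfter N i j := by
  obtain ⟨X, hX, -⟩ := rowCells_split (i := i) hj'
  refine ⟨boxCells N 1 (i - 1) ++ X, ?_⟩
  have h := boxCells_split N 1 (i - 1) (N - i + 1)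
  rw [show i - 1 + (N - i + 1) = N by omega, show 1 + (i - 1) = i by omega, boxCells, hX] at h
  rw [h, ← cellsAfter_succ N i hj, cellsAfter]
  simp

lemma cellsAfter_unique {N : ℕ} {B A : List (ℕ × ℕ)} {c : ℕ × ℕ}
    (h : boxCells N 1 N = B ++ c :: A) : A = cellsAfter N c.1 c.2 := by
  have hc : c ∈ boxCells N 1 N := by rw [h]; simp
  rw [mem_boxCells] at hc
  obtain ⟨B', hB'⟩ := boxCells_eq (N := N) (i := c.1) (j := c.2) (by omega) (by omega) (by omega)
    (by omega)
  have hn := nodup_boxCells N 1 N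
  have h1 : c ∉ B := by
    rw [h, List.nodup_append] at hn
    exact fun hb => hn.2.2 c hb c (by simp) rfl
  have hn := nodup_boxCells N 1 N
  have h2 : c ∉ B' := by
    rw [hB', List.nodup_append] at hn
    exact fun hb => hn.2.2 c hb c (by simp) rfl
  rw [h] at hB'
  clear hn h
  induction B generalizing B' with
  | nil =>
    cases B' with
    | nil => simpa using hB'
    | cons d B' => simp at hB'; simp [← hB'.1] at h2
  | cons b B ih =>
    cases B' with
    | nil => simp at hB'; simp [hB'.1] at h1
    | cons d B' =>
      simp only [List.cons_append, List.cons.injEq] at hB'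
      exact ih B' hB'.2 (fun h => h1 (by simp [h])) (fun h => h2 (by simp [h]))

@[simp] lemma wordOn_nil (D : Finset (ℕ × ℕ)) : wordOn D [] = [] := rfl

lemma wordOn_append (D : Finset (ℕ × ℕ)) (l l' : List (ℕ × ℕ)) :
    wordOn D (l ++ l') = wordOn D l ++ wordOn D l' := by simp [wordOn]

lemma wordOn_cons_mem {D : Finset (ℕ × ℕ)} {c : ℕ × ℕ} (h : c ∈ D) (l : List (ℕ × ℕ)) :
    wordOn D (c :: l) = (c.1 + c.2 - 1) :: wordOn D l := by simp [wordOn, h]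

lemma wordOn_cons_not_mem {D : Finset (ℕ × ℕ)} {c : ℕ × ℕ} (h : c ∉ D) (l : List (ℕ × ℕ)) :
    wordOn D (c :: l) = wordOn D l := by simp [wordOn, h]

lemma wordOn_congr {D D' : Finset (ℕ × ℕ)} {l : List (ℕ × ℕ)} (h : ∀ c ∈ l, c ∈ D ↔ c ∈ D') :
    wordOn D l = wordOn D' l := by
  unfold wordOn
  congr 1
  apply List.filter_congr
  intro c hc; simp [h c hc]

lemma wordOn_eq_nil {D : Finset (ℕ × ℕ)} {l : List (ℕ × ℕ)} (h : ∀ c ∈ l, c ∉ D) :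
    wordOn D l = [] := by
  unfold wordOn
  rw [List.filter_eq_nil_iff.2 (by simpa using h)]; rfl

lemma mem_wordOn {D : Finset (ℕ × ℕ)} {l : List (ℕ × ℕ)} {m : ℕ} :
    m ∈ wordOn D l ↔ ∃ c ∈ l, c ∈ D ∧ c.1 + c.2 - 1 = m := by
  simp [wordOn, and_assoc]

lemma mem_upperTriangle {n : ℕ} {c : ℕ × ℕ} :
    c ∈ upperTriangle n ↔ 1 ≤ c.1 ∧ 1 ≤ c.2 ∧ c.1 + c.2 ≤ n := by
  simp [upperTriangle]; omega

lemma upperTriangle_mono {n N : ℕ} (h : n ≤ N) : upperTriangle n ⊆ upperTriangle N := by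
  intro c hc
  rw [mem_upperTriangle] at *; omega

lemma wordOn_letters {n : ℕ} {D : Finset (ℕ × ℕ)} (hD : D ⊆ upperTriangle n)
    (l : List (ℕ × ℕ)) : ∀ m ∈ wordOn D l, 1 ≤ m ∧ m < n := by
  intro m hm
  obtain ⟨c, -, hc, rfl⟩ := mem_wordOn.1 hm
  have := mem_upperTriangle.1 (hD hc)
  omega

lemma length_word {n N : ℕ} (h : n ≤ N) {D : Finset (ℕ × ℕ)} (hD : D ⊆ upperTriangle n) :
    (word N D).length = D.card := by
  rw [word, wordOn, List.length_map,
    ← List.toFinset_card_of_nodup ((nodup_boxCells N 1 N).filter _)]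
  congr 1
  ext c
  simp only [List.mem_toFinset, List.mem_filter, mem_boxCells, decide_eq_true_eq,
    and_iff_right_iff_imp]
  intro hc
  have := mem_upperTriangle.1 (hD hc)
  omega

/-- The permutation of positions effected by the cells in a list. -/
def permOn (D : Finset (ℕ × ℕ)) (l : List (ℕ × ℕ)) : Perm ℕ := wprod (wordOn D l)

/-- The permutation of the wiring diagram of `D`. -/
def wiring (N : ℕ) (D : Finset (ℕ × ℕ)) : Perm ℕ := wprod (word N D)

lemma permOn_append (D : Finset (ℕ × ℕ)) (l l' : List (ℕ × ℕ)) :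
    permOn D (l ++ l') = permOn D l * permOn D l' := by
  rw [permOn, wordOn_append, wprod_append]; rfl

lemma permOn_cons_mem {D : Finset (ℕ × ℕ)} {c : ℕ × ℕ} (h : c ∈ D) (l : List (ℕ × ℕ)) :
    permOn D (c :: l) = simpleT (c.1 + c.2 - 1) * permOn D l := by
  rw [permOn, wordOn_cons_mem h, wprod_cons]; rfl

lemma permOn_cons_not_mem {D : Finset (ℕ × ℕ)} {c : ℕ × ℕ} (h : c ∉ D) (l : List (ℕ × ℕ)) :
    permOn D (c :: l) = permOn D l := by
  rw [permOn, wordOn_cons_not_mem h]; rfl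

lemma permOn_mem_symmGroup {n : ℕ} {D : Finset (ℕ × ℕ)} (hD : D ⊆ upperTriangle n)
    (l : List (ℕ × ℕ)) : permOn D l ∈ symmGroup n := wprod_mem_symmGroup (wordOn_letters hD l)

lemma wprod_apply_of_ne {c : List ℕ} {p : ℕ} (h : ∀ m ∈ c, p ≠ m ∧ p ≠ m + 1) :
    wprod c p = p := by
  induction c with
  | nil => rfl
  | cons m c ih =>
    rw [wprod_cons, Perm.mul_apply, ih fun k hk => h k (by simp [hk])]
    exact simpleT_of_ne (h m (by simp)).1 (h m (by simp)).2

lemma permOn_apply_of_ne {D : Finset (ℕ × ℕ)} {l : List (ℕ × ℕ)} {p : ℕ}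
    (h : ∀ c ∈ l, c ∈ D → p ≠ c.1 + c.2 - 1 ∧ p ≠ c.1 + c.2 - 1 + 1) : permOn D l p = p := by
  apply wprod_apply_of_ne
  intro m hm
  obtain ⟨c, hc, hcD, rfl⟩ := mem_wordOn.1 hm
  exact h c hc hcD

/-! ### Pipes and positions -/

lemma simpleT_pred {a : ℕ} (h : 1 ≤ a) : simpleT (a - 1) a = a - 1 := by
  obtain ⟨a, rfl⟩ := Nat.exists_eq_add_of_le' h
  exact simpleT_right a

/-- The position of a pipe on the cut of the diagram at a tile. -/
def Side.pos : Side → ℕ → ℕ → ℕ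
  | .left, i, j => i + j - 1
  | .below, i, j => i + j

/-- Between the cuts at (i+1, j+1) and (i, j) only letters ≥ i+j+1 (row i+1) and ≤ i+j-2 (row i) are
read, and neither kind touches position i+j. This bridges the jump in reading order when a pipe
moves up one row. -/
lemma permOn_cellsAfter_diag {N i j p : ℕ} (D : Finset (ℕ × ℕ)) (hj : 1 ≤ j)
    (hij : i + j ≤ N) :
    permOn D (cellsAfter N i j) p = i + j ↔
      permOn D (cellsAfter N (i + 1) (j + 1)) p = i + j := by
  obtain ⟨X, hX, hX'⟩ := cellsAfter_eq N i (j := j) (by omega) (by omega)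
  rw [hX, permOn_append, permOn_append, Perm.mul_apply, Perm.mul_apply]
  have h1 : permOn D (rowCells i (j - 1)) (i + j) = i + j := by
    apply permOn_apply_of_ne
    intro c hc _
    rw [mem_rowCells] at hc; omega
  have h2 : permOn D X (i + j) = i + j := by
    apply permOn_apply_of_ne
    intro c hc _
    have := hX' c hc; omega
  constructor
  · intro h
    have h := (permOn D (rowCells i (j - 1))).injective (h.trans h1.symm)
    have h3 : permOn D X (permOn D (cellsAfter N (i + 1) (j + 1)) p) = permOn D X (i + j) := by
      rw [h2]; exact h
    exact (permOn D X).injective h3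
  · intro h; rw [h, h2, h1]

/-- Along a pipe, the position on the cut records the tile and the side of entry. Moves to the right
advance the cut by one letter, and moves upward use `permOn_cellsAfter_diag`. -/
lemma enters_pos {N p : ℕ} {D : Finset (ℕ × ℕ)} (hD : D ⊆ upperTriangle N)
    (hp : 1 ≤ p) (hp' : p ≤ N) {σ : Side} {i j : ℕ} (h : Enters D p σ i j) :
    1 ≤ j ∧ permOn D (cellsAfter N i j) p = σ.pos i j := by
  induction h with
  | start =>
    refine ⟨le_rfl, ?_⟩
    simp only [Side.pos]
    rw [permOn_apply_of_ne]
    · rfl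
    · intro c hc _
      rw [mem_cellsAfter] at hc; omega
  | @cross_left i j _ hc ih =>
    obtain ⟨hj, ih⟩ := ih
    refine ⟨by omega, ?_⟩
    rw [cellsAfter_succ _ _ hj, permOn_cons_mem hc, Perm.mul_apply, ih]
    simp only [Side.pos]
    rw [simpleT_left]; omega
  | @bend_left i j _ hc ih =>
    obtain ⟨hj, ih⟩ := ih
    refine ⟨hj, ?_⟩
    have hle := symmGroup_le (permOn_mem_symmGroup hD (cellsAfter N (i + 1) j)) hp'
    rw [ih] at hle
    simp only [Side.pos] at ih hle ⊢
    rw [permOn_cellsAfter_diag D hj (by omega), cellsAfter_succ _ _ hj, permOn_cons_not_mem hc, ih]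
    omega
  | @cross_below i j _ hc ih =>
    obtain ⟨hj, ih⟩ := ih
    refine ⟨hj, ?_⟩
    have hle := symmGroup_le (permOn_mem_symmGroup hD (cellsAfter N (i + 1) j)) hp'
    rw [ih] at hle
    simp only [Side.pos] at ih hle ⊢
    rw [permOn_cellsAfter_diag D hj (by omega), cellsAfter_succ _ _ hj, permOn_cons_mem hc,
      Perm.mul_apply, ih]
    simp only
    rw [simpleT_pred (by omega)]
    omega
  | @bend_below i j _ hc ih =>
    obtain ⟨hj, ih⟩ := ih
    refine ⟨by omega, ?_⟩
    rw [cellsAfter_succ _ _ hj, permOn_cons_not_mem hc, ih]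
    simp only [Side.pos]; omega

/-- The pipe is traced backwards: induction on the column, and within a column from the bottom row
upward, since a pipe entering from below comes from the row underneath or turns there from the left.
-/
lemma enters_of_pos {N p : ℕ} {D : Finset (ℕ × ℕ)} (hD : D ⊆ upperTriangle N)
    (hp' : p ≤ N) {j : ℕ} (hj : 1 ≤ j) :
    (∀ i, 1 ≤ i → permOn D (cellsAfter N i j) p = i + j - 1 → Enters D p .left i j) ∧
    (∀ i, permOn D (cellsAfter N i j) p = i + j → Enters D p .below i j) := by
  induction j, hj using Nat.le_induction with
  | base =>
    have hleft : ∀ i, 1 ≤ i → permOn D (cellsAfter N i 1) p = i + 1 - 1 →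
        Enters D p .left i 1 := by
      intro i hi h
      have h1 : permOn D (cellsAfter N i 1) i = i := by
        apply permOn_apply_of_ne
        intro c hc _
        rw [mem_cellsAfter] at hc; omega
      have : p = i := (permOn D (cellsAfter N i 1)).injective (by rw [h, h1]; omega)
      subst this
      exact .start
    refine ⟨hleft, fun i => ?_⟩
    induction hk : N - i using Nat.strong_induction_on generalizing i with
    | _ k ih =>
      intro h
      have hle := symmGroup_le (permOn_mem_symmGroup hD (cellsAfter N i 1)) hp'
      rw [h] at hle
      rw [permOn_cellsAfter_diag D le_rfl (by omega), cellsAfter_succ _ _ le_rfl] at h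
      by_cases hc : (i + 1, 1) ∈ D
      · refine .cross_below (ih (N - (i + 1)) (by omega) (i + 1) rfl ?_) hc
        rw [permOn_cons_mem hc, Perm.mul_apply] at h
        have := congrArg (simpleT (i + 1 + 1 - 1)) h
        rw [simpleT_simpleT] at this
        rw [this]; exact simpleT_left _
      · rw [permOn_cons_not_mem hc] at h
        exact .bend_left (hleft (i + 1) (by omega) (by omega)) hc
  | succ j hj ihj =>
    obtain ⟨ihl, ihb⟩ := ihj
    have hleft : ∀ i, 1 ≤ i → permOn D (cellsAfter N i (j + 1)) p = i + (j + 1) - 1 →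
        Enters D p .left i (j + 1) := by
      intro i hi h
      obtain ⟨i, rfl⟩ := Nat.exists_eq_add_of_le' hi
      rw [cellsAfter_succ _ _ hj] at h
      by_cases hc : (i + 1, j) ∈ D
      · refine .cross_left (ihl (i + 1) hi ?_) hc
        rw [permOn_cons_mem hc, Perm.mul_apply] at h
        have := congrArg (simpleT (i + 1 + j - 1)) h
        rw [simpleT_simpleT] at this
        rw [this, show i + 1 + (j + 1) - 1 = i + 1 + j - 1 + 1 by omega]
        exact simpleT_right _
      · rw [permOn_cons_not_mem hc] at h
        exact .bend_below (ihb (i + 1) (by omega)) hc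
    refine ⟨hleft, fun i => ?_⟩
    induction hk : N - i using Nat.strong_induction_on generalizing i with
    | _ k ih =>
      intro h
      have hle := symmGroup_le (permOn_mem_symmGroup hD (cellsAfter N i (j + 1))) hp'
      rw [h] at hle
      rw [permOn_cellsAfter_diag D (by omega) (by omega), cellsAfter_succ _ _ (by omega)] at h
      by_cases hc : (i + 1, j + 1) ∈ D
      · refine .cross_below (ih (N - (i + 1)) (by omega) (i + 1) rfl ?_) hc
        rw [permOn_cons_mem hc, Perm.mul_apply] at h
        have := congrArg (simpleT (i + 1 + (j + 1) - 1)) h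
        rw [simpleT_simpleT] at this
        rw [this, show i + (j + 1) = i + 1 + (j + 1) - 1 by omega, simpleT_left]; omega
      · rw [permOn_cons_not_mem hc] at h
        exact .bend_left (hleft (i + 1) (by omega) (by omega)) hc

lemma enters_left_iff {N p i j : ℕ} {D : Finset (ℕ × ℕ)} (hD : D ⊆ upperTriangle N)
    (hp : 1 ≤ p) (hp' : p ≤ N) (hi : 1 ≤ i) (hj : 1 ≤ j) :
    Enters D p .left i j ↔ permOn D (cellsAfter N i j) p = i + j - 1 :=
  ⟨fun h => (enters_pos hD hp hp' h).2, (enters_of_pos hD hp' hj).1 i hi⟩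

lemma enters_below_iff {N p i j : ℕ} {D : Finset (ℕ × ℕ)} (hD : D ⊆ upperTriangle N)
    (hp : 1 ≤ p) (hp' : p ≤ N) (hj : 1 ≤ j) :
    Enters D p .below i j ↔ permOn D (cellsAfter N i j) p = i + j :=
  ⟨fun h => (enters_pos hD hp hp' h).2, (enters_of_pos hD hp' hj).2 i⟩

lemma enters_top_iff {N p q : ℕ} {D : Finset (ℕ × ℕ)} (hD : D ⊆ upperTriangle N)
    (hp : 1 ≤ p) (hp' : p ≤ N) (hq : 1 ≤ q) :
    Enters D p .below 0 q ↔ wiring N D p = q := by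
  rw [enters_below_iff hD hp hp' hq, cellsAfter, permOn_append, Perm.mul_apply]
  have h0 : permOn D (rowCells 0 (q - 1)) = 1 := by
    rw [permOn, wordOn_eq_nil]; rfl
    intro c hc hcD
    have := mem_upperTriangle.1 (hD hcD)
    rw [mem_rowCells] at hc; omega
  rw [h0]; simp [wiring, word, permOn]

/-! ### Reducedness -/

lemma red_cons {c : List ℕ} {m : ℕ} :
    Red (m :: c) ↔ Red c ∧ (wprod c)⁻¹ m < (wprod c)⁻¹ (m + 1) := by
  unfold Red
  rw [wprod_cons, List.length_cons, ← invCount_inv (simpleT m * wprod c), mul_inv_rev, simpleT_inv,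
    ← invCount_inv (wprod c)]
  have hf := finite_invSet_inv (finite_invSet_wprod c)
  have h1 := invCount_wprod_le c
  rw [← invCount_inv] at h1
  constructor
  · intro h
    have h2 := invCount_mul_simpleT_le m hf
    have h3 : c.length = invCount (wprod c)⁻¹ := by omega
    exact ⟨h3, asc_of_invCount hf (by omega)⟩
  · rintro ⟨h, h'⟩
    rw [(invCount_mul_simpleT hf h').2, h]

lemma Red.of_append_right {c d : List ℕ} (h : Red (c ++ d)) : Red d := by
  induction c with
  | nil => exact h
  | cons m c ih => exact ih (red_cons.1 h).1

lemma Red.invSet_subset {c d : List ℕ} (h : Red (c ++ d)) :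
    invSet (wprod d) ⊆ invSet (wprod (c ++ d)) := by
  induction c with
  | nil => exact subset_rfl
  | cons m c ih =>
    rw [List.cons_append, red_cons] at h
    refine (ih h.1).trans ?_
    rintro ⟨p, q⟩ hpq
    rw [mem_invSet] at hpq ⊢
    refine ⟨hpq.1, ?_⟩
    rw [List.cons_append, wprod_cons, Perm.mul_apply, Perm.mul_apply]
    apply simpleT_lt hpq.2
    rintro ⟨h1, h2⟩
    have h3 := h.2
    have e1 : (wprod (c ++ d))⁻¹ m = q := by rw [Perm.inv_eq_iff_eq]; exact h1.symm
    have e2 : (wprod (c ++ d))⁻¹ (m + 1) = p := by rw [Perm.inv_eq_iff_eq]; exact h2.symm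
    rw [e1, e2] at h3
    exact absurd hpq.1 (by omega)

lemma meet_iff {N : ℕ} {D : Finset (ℕ × ℕ)} (hD : D ⊆ upperTriangle N) {p q i j : ℕ}
    (hp : 1 ≤ p) (hp' : p ≤ N) (hq : 1 ≤ q) (hq' : q ≤ N) (hi : 1 ≤ i) (hj : 1 ≤ j) :
    Meet D p q (i, j) ↔
      (permOn D (cellsAfter N i j) p = i + j - 1 ∧ permOn D (cellsAfter N i j) q = i + j) ∨
      (permOn D (cellsAfter N i j) q = i + j - 1 ∧ permOn D (cellsAfter N i j) p = i + j) := by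
  unfold Meet
  rw [enters_left_iff hD hp hp' hi hj, enters_left_iff hD hq hq' hi hj,
    enters_below_iff hD hp hp' hj, enters_below_iff hD hq hq' hj]

lemma exists_crossing_of_inv {D : Finset (ℕ × ℕ)} {A : List (ℕ × ℕ)} {p q : ℕ}
    (hpq : p < q) (h : permOn D A q < permOn D A p) :
    ∃ B c A', A = B ++ c :: A' ∧ c ∈ D ∧ permOn D A' p = c.1 + c.2 - 1 ∧
      permOn D A' q = c.1 + c.2 - 1 + 1 := by
  induction A with
  | nil => simp [permOn] at h; omega
  | cons c A ih =>
    by_cases hc : c ∈ D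
    · by_cases hA : permOn D A q < permOn D A p
      · obtain ⟨B, d, A', h1, h2⟩ := ih hA
        exact ⟨c :: B, d, A', by rw [h1]; rfl, h2⟩
      · refine ⟨[], c, A, rfl, hc, ?_⟩
        rw [permOn_cons_mem hc, Perm.mul_apply, Perm.mul_apply] at h
        by_contra hne
        have hlt : permOn D A p < permOn D A q := by
          have : permOn D A p ≠ permOn D A q := fun h => by
            have := (permOn D A).injective h; omega
          omega
        have := simpleT_lt hlt hne
        omega
    · rw [permOn_cons_not_mem hc] at h
      obtain ⟨B, d, A', h1, h2⟩ := ih h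
      exact ⟨c :: B, d, A', by rw [h1]; rfl, h2⟩

/-- If a letter failed to raise the length, the two pipes at its positions would already be
inverted. They would then have crossed at a cell of the part of the word that acts first, and would
cross again here. -/
lemma red_word_of_reduced {n N : ℕ} (hN : n ≤ N) {D : Finset (ℕ × ℕ)}
    (h : IsReducedPipeDream n D) : Red (word N D) := by
  obtain ⟨hD, hcross⟩ := h
  have hDN := hD.trans (upperTriangle_mono hN)
  have key : ∀ A B, boxCells N 1 N = B ++ A → Red (wordOn D A) := by
    intro A
    induction A with
    | nil => intro _ _; exact red_nil
    | cons c A ih =>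
      intro B hB
      have hA := ih (B ++ [c]) (by simpa using hB)
      by_cases hc : c ∈ D
      · rw [wordOn_cons_mem hc, red_cons]
        refine ⟨hA, ?_⟩
        have hcu := mem_upperTriangle.1 (hD hc)
        set k := c.1 + c.2 - 1 with hk
        have hmem := permOn_mem_symmGroup hD A
        set P := permOn D A with hP
        change P⁻¹ k < P⁻¹ (k + 1)
        by_contra hlt
        have hne := asc_ne P⁻¹ k
        have hPk : P (P⁻¹ k) = k := by simp
        have hPk' : P (P⁻¹ (k + 1)) = k + 1 := by simp
        have hmem' := inv_mem_symmGroup hmem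
        have b1 := symmGroup_pos hmem' (k := k) (by omega)
        have b2 := symmGroup_pos hmem' (k := k + 1) (by omega)
        have b3 := symmGroup_le hmem' (k := k) (by omega)
        have b4 := symmGroup_le hmem' (k := k + 1) (by omega)
        obtain ⟨B', d, A', hA', hd, h1, h2⟩ := exists_crossing_of_inv (D := D) (A := A)
          (p := P⁻¹ (k + 1)) (q := P⁻¹ k) (by omega) (by rw [← hP, hPk, hPk']; omega)
        have hdu := mem_upperTriangle.1 (hD hd)
        have e1 := cellsAfter_unique hB
        have e2 := cellsAfter_unique (B := B ++ c :: B') (c := d) (A := A') (by rw [hB, hA']; simp)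
        have := hcross (P⁻¹ (k + 1)) (Finset.mem_Icc.2 ⟨b2, b4⟩) (P⁻¹ k)
          (Finset.mem_Icc.2 ⟨b1, b3⟩) hne.symm d c
          ⟨hd, (meet_iff hDN b2 (by omega) b1 (by omega) hdu.1 hdu.2.1).2
            (Or.inl (by rw [← e2]; exact ⟨h1, by omega⟩))⟩
          ⟨hc, (meet_iff hDN b2 (by omega) b1 (by omega) hcu.1 hcu.2.1).2
            (Or.inr (by rw [← e1]; exact ⟨hPk, hPk'.trans (by omega)⟩))⟩
        subst this
        have hn := nodup_boxCells N 1 N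
        rw [hB, hA'] at hn
        simp [List.nodup_append, List.nodup_cons] at hn
      · rwa [wordOn_cons_not_mem hc]
  exact key _ [] rfl

/-- In a reduced word the inversion created by the first crossing of two pipes persists in every
longer suffix, so a second crossing of the same pipes would be a descent. -/
lemma reduced_of_red_word {n N : ℕ} (hN : n ≤ N) {D : Finset (ℕ × ℕ)}
    (hD : D ⊆ upperTriangle n) (h : Red (word N D)) : IsReducedPipeDream n D := by
  have hDN := hD.trans (upperTriangle_mono hN)
  refine ⟨hD, ?_⟩
  have key : ∀ p q, 1 ≤ p → p < q → q ≤ n → ∀ c c', ReadBefore c' c → CrossAt D p q c →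
      CrossAt D p q c' → False := by
    intro p q hp hpq hq c c' hcc hc hc'
    obtain ⟨hcD, hc⟩ := hc
    obtain ⟨hcD', hc'⟩ := hc'
    have hcu := mem_upperTriangle.1 (hD hcD)
    have hcu' := mem_upperTriangle.1 (hD hcD')
    rw [meet_iff hDN hp (by omega) (by omega) (by omega) hcu.1 hcu.2.1] at hc
    rw [meet_iff hDN hp (by omega) (by omega) (by omega) hcu'.1 hcu'.2.1] at hc'
    obtain ⟨B, hB⟩ := boxCells_eq (N := N) (i := c'.1) (j := c'.2) (by omega) (by omega) (by omega)
      (by omega)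
    have hmem : c ∈ cellsAfter N c'.1 c'.2 := by
      rw [mem_cellsAfter]; unfold ReadBefore at hcc; omega
    obtain ⟨B', A', hBA⟩ := List.append_of_mem hmem
    have e := cellsAfter_unique (B := B ++ c' :: B') (c := c) (A := A') (by rw [hB, hBA]; simp)
    have h2 := h
    rw [word, hB, wordOn_append] at h2
    have h2 := h2.of_append_right
    rw [wordOn_cons_mem hcD'] at h2
    have h3 := red_cons.1 h2
    have h4 := h3.1
    have hBA2 : cellsAfter N c'.1 c'.2 = (B' ++ [c]) ++ A' := by rw [hBA]; simp
    rw [hBA2, wordOn_append] at h4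
    have h5 : Red (wordOn D (c :: A')) := by
      have := h3.1
      rw [hBA, wordOn_append] at this
      exact this.of_append_right
    have h6 : Red (wordOn D B' ++ wordOn D (c :: A')) := by
      rw [← wordOn_append, ← hBA]; exact h3.1
    rw [wordOn_cons_mem hcD] at h5
    have h7 := (red_cons.1 h5).2
    have hfirst : permOn D A' p = c.1 + c.2 - 1 ∧ permOn D A' q = c.1 + c.2 := by
      rcases hc with hc | hc
      · rwa [e]
      · exfalso
        rw [← e] at hc
        have e1 : (wprod (wordOn D A'))⁻¹ (c.1 + c.2 - 1) = q := by
          rw [Perm.inv_eq_iff_eq]; exact hc.1.symm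
        have e2 : (wprod (wordOn D A'))⁻¹ (c.1 + c.2 - 1 + 1) = p := by
          rw [Perm.inv_eq_iff_eq]
          exact (show c.1 + c.2 - 1 + 1 = c.1 + c.2 by omega).trans hc.2.symm
        rw [e1, e2] at h7; omega
    have hinv : (p, q) ∈ invSet (wprod (wordOn D (c :: A'))) := by
      rw [mem_invSet]
      refine ⟨hpq, ?_⟩
      change permOn D (c :: A') q < permOn D (c :: A') p
      rw [permOn_cons_mem hcD, Perm.mul_apply, Perm.mul_apply, hfirst.1, hfirst.2, simpleT_left,
        simpleT_pred (by omega)]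
      omega
    have hinv' := h6.invSet_subset hinv
    rw [← wordOn_append, ← hBA, mem_invSet] at hinv'
    have hinv' : permOn D (cellsAfter N c'.1 c'.2) q < permOn D (cellsAfter N c'.1 c'.2) p :=
      hinv'.2
    rcases hc' with hc' | hc'
    · omega
    · have e1 : (wprod (wordOn D (cellsAfter N c'.1 c'.2)))⁻¹ (c'.1 + c'.2 - 1) = q := by
        rw [Perm.inv_eq_iff_eq]; exact hc'.1.symm
      have e2 : (wprod (wordOn D (cellsAfter N c'.1 c'.2)))⁻¹ (c'.1 + c'.2 - 1 + 1) = p := by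
        rw [Perm.inv_eq_iff_eq]
        exact (show c'.1 + c'.2 - 1 + 1 = c'.1 + c'.2 by omega).trans hc'.2.symm
      rw [e1, e2] at h3; omega
  have key2 : ∀ p q, 1 ≤ p → p < q → q ≤ n → ∀ c c', CrossAt D p q c → CrossAt D p q c' →
      c = c' := by
    intro p q hp hpq hq c c' hc hc'
    by_contra hne
    have : ReadBefore c c' ∨ ReadBefore c' c := by
      unfold ReadBefore
      by_contra h
      apply hne
      ext <;> omega
    rcases this with h | h
    · exact key p q hp hpq hq c' c h hc' hc
    · exact key p q hp hpq hq c c' h hc hc'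
  have hsymm : ∀ p q c, CrossAt D p q c → CrossAt D q p c :=
    fun p q c h => ⟨h.1, h.2.symm⟩
  intro p hp q hq hpq c c' hc hc'
  rw [Finset.mem_Icc] at hp hq
  rcases lt_or_gt_of_ne hpq with h | h
  · exact key2 p q hp.1 h hq.2 c c' hc hc'
  · exact key2 q p hq.1 h hp.2 c c' (hsymm _ _ _ hc) (hsymm _ _ _ hc')

/-- The reading box may be any N ≥ n. This freedom lets one compare members of PD for different n,
and fit auxiliary shapes into the box. -/
lemma mem_PD_iff {n N : ℕ} (hN : n ≤ N) {D : Finset (ℕ × ℕ)} {w : Perm ℕ}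
    (hw : w ∈ symmGroup n) :
    D ∈ PD n w ↔ D ⊆ upperTriangle n ∧ Red (word N D) ∧ wiring N D = w := by
  constructor
  · rintro ⟨h1, h2⟩
    refine ⟨h1.1, red_word_of_reduced hN h1, ?_⟩
    ext p
    by_cases hp : p ∈ Finset.Icc 1 n
    · have hp' := Finset.mem_Icc.1 hp
      exact (enters_top_iff (h1.1.trans (upperTriangle_mono hN)) hp'.1 (by omega)
        (symmGroup_pos hw hp'.1)).1 (h2 p hp)
    · rw [hw p hp]
      exact permOn_mem_symmGroup h1.1 _ p hp
  · rintro ⟨h1, h2, rfl⟩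
    refine ⟨reduced_of_red_word hN h1 h2, fun p hp => ?_⟩
    have hp' := Finset.mem_Icc.1 hp
    exact (enters_top_iff (h1.trans (upperTriangle_mono hN)) hp'.1 (by omega)
        (symmGroup_pos hw hp'.1)).2 rfl

/-! ### Inserting crossings -/

lemma readBefore_of_split {N : ℕ} {B A : List (ℕ × ℕ)} {c : ℕ × ℕ}
    (h : boxCells N 1 N = B ++ c :: A) :
    (∀ d ∈ B, ReadBefore d c) ∧ (∀ d ∈ A, ReadBefore c d) := by
  have hp := pairwise_boxCells N 1 N
  rw [h, List.pairwise_append, List.pairwise_cons] at hp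
  exact ⟨fun d hd => hp.2.2 d hd c (by simp), hp.2.1.1⟩

lemma mem_prefix_iff {N : ℕ} {B A : List (ℕ × ℕ)} {c d : ℕ × ℕ}
    (h : boxCells N 1 N = B ++ c :: A) (hd : d ∈ boxCells N 1 N) :
    d ∈ B ↔ ReadBefore d c := by
  refine ⟨(readBefore_of_split h).1 d, fun hdc => ?_⟩
  rw [h, List.mem_append, List.mem_cons] at hd
  rcases hd with hd | rfl | hd
  · exact hd
  · unfold ReadBefore at hdc; omega
  · have := (readBefore_of_split h).2 d hd
    unfold ReadBefore at hdc this; omega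

lemma word_eq_of_split {N : ℕ} {B A : List (ℕ × ℕ)} {c : ℕ × ℕ} (F : Finset (ℕ × ℕ))
    (h : boxCells N 1 N = B ++ c :: A) (hc : c ∉ F) :
    word N F = wordOn F B ++ wordOn F A := by
  rw [word, h, wordOn_append, wordOn_cons_not_mem hc]

lemma word_insert {N : ℕ} {B A : List (ℕ × ℕ)} {c : ℕ × ℕ} (F : Finset (ℕ × ℕ))
    (h : boxCells N 1 N = B ++ c :: A) :
    word N (insert c F) = wordOn F B ++ (c.1 + c.2 - 1) :: wordOn F A := by
  have hn := nodup_boxCells N 1 N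
  rw [h, List.nodup_append, List.nodup_cons] at hn
  rw [word, h, wordOn_append, wordOn_cons_mem (Finset.mem_insert_self _ _)]
  congr 1
  · apply wordOn_congr
    intro d hd
    have : d ≠ c := hn.2.2 d hd c (by simp)
    simp [this]
  · congr 1
    apply wordOn_congr
    intro d hd
    have : d ≠ c := by rintro rfl; exact hn.2.1.1 hd
    simp [this]

lemma word_insert_last {N : ℕ} {c : ℕ × ℕ} {F : Finset (ℕ × ℕ)} (hc : c ∈ boxCells N 1 N)
    (h : ∀ d ∈ F, ReadBefore d c) : word N (insert c F) = word N F ++ [c.1 + c.2 - 1] := by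
  obtain ⟨B, A, hBA⟩ := List.append_of_mem hc
  have hcF : c ∉ F := fun hcF => by have := h c hcF; unfold ReadBefore at this; omega
  have hA : wordOn F A = [] := by
    apply wordOn_eq_nil
    intro d hd hdF
    have h1 := h d hdF
    have h2 := (readBefore_of_split hBA).2 d hd
    unfold ReadBefore at h1 h2; omega
  rw [word_insert F hBA, word_eq_of_split F hBA hcF, hA]; simp

lemma simpleT_comm {k m : ℕ} (h : k + 2 ≤ m) : simpleT m * simpleT k = simpleT k * simpleT m := by
  ext x
  simp only [Perm.mul_apply, simpleT_apply]
  split_ifs <;> omega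

lemma simpleT_comm_wprod {m : ℕ} {c : List ℕ} (h : ∀ k ∈ c, k + 2 ≤ m) :
    simpleT m * wprod c = wprod c * simpleT m := by
  induction c with
  | nil => simp
  | cons k c ih =>
    rw [wprod_cons, ← mul_assoc, simpleT_comm (h k (by simp)), mul_assoc,
      ih fun k hk => h k (by simp [hk]), mul_assoc]

lemma wiring_insert_last {N : ℕ} {c : ℕ × ℕ} {F : Finset (ℕ × ℕ)} (hc : c ∈ boxCells N 1 N)
    (h : ∀ d ∈ F, ReadBefore d c) :
    wiring N (insert c F) = wiring N F * simpleT (c.1 + c.2 - 1) := by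
  rw [wiring, word_insert_last hc h, wprod_snoc]; rfl

/-- Every letter read before the new cell is smaller by at least 2, so the new letter commutes to
the front of the word. -/
lemma wiring_insert_first {N : ℕ} {c : ℕ × ℕ} {F : Finset (ℕ × ℕ)} (hc : c ∈ boxCells N 1 N)
    (hcF : c ∉ F) (h : ∀ d ∈ F, ReadBefore d c → d.1 + d.2 - 1 + 2 ≤ c.1 + c.2 - 1) :
    wiring N (insert c F) = simpleT (c.1 + c.2 - 1) * wiring N F := by
  obtain ⟨B, A, hBA⟩ := List.append_of_mem hc
  rw [wiring, wiring, word_insert F hBA, word_eq_of_split F hBA hcF, wprod_append, wprod_append,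
    wprod_cons, ← mul_assoc, ← mul_assoc, simpleT_comm_wprod]
  intro k hk
  obtain ⟨d, hd, hdF, rfl⟩ := mem_wordOn.1 hk
  exact h d hdF ((readBefore_of_split hBA).1 d hd)

/-! ### Symmetric exhaustion of a pipe dream -/

/-- The cells of `D` whose reflection into the lower triangle is in a list. -/
def inner (D : Finset (ℕ × ℕ)) (l : List (ℕ × ℕ)) : Finset (ℕ × ℕ) :=
  D.filter (fun d => (max d.1 d.2, min d.1 d.2) ∈ l)

lemma mem_inner {D : Finset (ℕ × ℕ)} {l : List (ℕ × ℕ)} {d : ℕ × ℕ} :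
    d ∈ inner D l ↔ d ∈ D ∧ (max d.1 d.2, min d.1 d.2) ∈ l := by simp [inner]

lemma inner_nil (D : Finset (ℕ × ℕ)) : inner D [] = ∅ := by simp [inner]

lemma inner_boxCells {n N : ℕ} (hN : n ≤ N) {D : Finset (ℕ × ℕ)} (hD : D ⊆ upperTriangle n) :
    inner D (boxCells N 1 N) = D := by
  apply Finset.filter_true_of_mem
  intro d hd
  have := mem_upperTriangle.1 (hD hd)
  rw [mem_boxCells]; simp only; omega

lemma max_min_eq_iff {d : ℕ × ℕ} {a b : ℕ} (hab : b ≤ a) :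
    (max d.1 d.2, min d.1 d.2) = (a, b) ↔ d = (a, b) ∨ d = (b, a) := by
  simp only [Prod.ext_iff]; omega

lemma inner_snoc_of_lt {D : Finset (ℕ × ℕ)} {l : List (ℕ × ℕ)} {a b : ℕ} (h : a < b) :
    inner D (l ++ [(a, b)]) = inner D l := by
  ext d
  rw [mem_inner, mem_inner, List.mem_append, List.mem_singleton, Prod.ext_iff]
  simp only
  constructor
  · rintro ⟨h1, h2 | h2⟩
    · exact ⟨h1, h2⟩
    · omega
  · exact fun h => ⟨h.1, Or.inl h.2⟩

lemma mem_inner_snoc {D : Finset (ℕ × ℕ)} {l : List (ℕ × ℕ)} {a b : ℕ} (h : b ≤ a) (d : ℕ × ℕ) :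
    d ∈ inner D (l ++ [(a, b)]) ↔ d ∈ inner D l ∨ (d ∈ D ∧ (d = (a, b) ∨ d = (b, a))) := by
  rw [mem_inner, mem_inner, List.mem_append, List.mem_singleton, max_min_eq_iff h]
  tauto

lemma mem_inner_split {n N : ℕ} (hN : n ≤ N) {D : Finset (ℕ × ℕ)} (hD : D ⊆ upperTriangle n)
    {B A : List (ℕ × ℕ)} {c d : ℕ × ℕ} (h : boxCells N 1 N = B ++ c :: A) :
    d ∈ inner D B ↔ d ∈ D ∧ (max d.1 d.2 < c.1 ∨ (max d.1 d.2 = c.1 ∧ c.2 < min d.1 d.2)) := by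
  rw [mem_inner]
  refine and_congr_right fun hd => ?_
  have := mem_upperTriangle.1 (hD hd)
  rw [mem_prefix_iff h]
  · rfl
  · rw [mem_boxCells]; simp only; omega

section Step

variable {n N : ℕ} {D : Finset (ℕ × ℕ)} {B A : List (ℕ × ℕ)} {a b : ℕ}

/-- The cells of `inner D B` lie in rows above a, or in row a to the right of b, so (a,b) is read
last. -/
lemma inner_step_right (hN : n ≤ N) (hD : D ⊆ upperTriangle n)
    (h : boxCells N 1 N = B ++ (a, b) :: A) (hab : b ≤ a) (hc : (a, b) ∈ D)
    (hc' : a = b ∨ (b, a) ∉ D) :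
    wiring N (inner D (B ++ [(a, b)])) = wiring N (inner D B) * simpleT (a + b - 1) ∧
    (inner D (B ++ [(a, b)])).card = (inner D B).card + 1 := by
  have e : inner D (B ++ [(a, b)]) = insert (a, b) (inner D B) := by
    ext d
    rw [mem_inner_snoc hab, Finset.mem_insert]
    constructor
    · rintro (hd | ⟨hd, rfl | rfl⟩)
      · exact Or.inr hd
      · exact Or.inl rfl
      · rcases hc' with rfl | hc'
        · exact Or.inl rfl
        · exact absurd hd hc'
    · rintro (rfl | hd)
      · exact Or.inr ⟨hc, Or.inl rfl⟩
      · exact Or.inl hd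
  have hbox : (a, b) ∈ boxCells N 1 N := by rw [h]; simp
  rw [e, wiring_insert_last hbox, Finset.card_insert_of_notMem]
  · exact ⟨rfl, rfl⟩
  · rw [mem_inner_split hN hD h]; simp only; omega
  · intro d hd
    rw [mem_inner_split hN hD h] at hd
    unfold ReadBefore
    simp only at hd ⊢; omega

/-- Cells of `inner D B` read before the reflection (b,a) have row < b and column < a, so their
letters are at most a+b-3 and commute with s_{a+b-1}. -/
lemma inner_step_both (hN : n ≤ N) (hD : D ⊆ upperTriangle n)
    (h : boxCells N 1 N = B ++ (a, b) :: A) (hab : b < a) (hc : (a, b) ∈ D) (hc' : (b, a) ∈ D) :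
    wiring N (inner D (B ++ [(a, b)])) =
      simpleT (a + b - 1) * (wiring N (inner D B) * simpleT (a + b - 1)) ∧
    (inner D (B ++ [(a, b)])).card = (inner D B).card + 2 := by
  have e : inner D (B ++ [(a, b)]) = insert (b, a) (insert (a, b) (inner D B)) := by
    ext d
    rw [mem_inner_snoc hab.le, Finset.mem_insert, Finset.mem_insert]
    constructor
    · rintro (hd | ⟨hd, rfl | rfl⟩) <;> tauto
    · rintro (rfl | rfl | hd) <;> tauto
  have hbox : (a, b) ∈ boxCells N 1 N := by rw [h]; simp
  have hbox' : (b, a) ∈ boxCells N 1 N := by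
    rw [mem_boxCells] at hbox ⊢; simp only at hbox ⊢; omega
  have h1 : (a, b) ∉ inner D B := by rw [mem_inner_split hN hD h]; simp only; omega
  have h2 : (b, a) ∉ insert (a, b) (inner D B) := by
    rw [Finset.mem_insert, mem_inner_split hN hD h, Prod.ext_iff]; simp only; omega
  rw [e, wiring_insert_first hbox' h2, wiring_insert_last hbox, Finset.card_insert_of_notMem h2,
    Finset.card_insert_of_notMem h1]
  · simp only [add_comm b a, and_true]
  · intro d hd
    rw [mem_inner_split hN hD h] at hd
    unfold ReadBefore
    simp only at hd ⊢; omega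
  · intro d hd
    rw [Finset.mem_insert, mem_inner_split hN hD h, Prod.ext_iff] at hd
    unfold ReadBefore
    simp only at hd ⊢
    have : d ∈ D → 1 ≤ d.1 ∧ 1 ≤ d.2 := fun hd => by
      have := mem_upperTriangle.1 (hD hd); omega
    rcases hd with hd | hd
    · omega
    · have := this hd.1
      omega

lemma inner_step_none (hD : ∀ i j, i < j → (i, j) ∈ D → (j, i) ∈ D) (hc : ¬ (b ≤ a ∧ (a, b) ∈ D)) :
    inner D (B ++ [(a, b)]) = inner D B := by
  rcases lt_or_ge a b with hab | hab
  · exact inner_snoc_of_lt hab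
  · ext d
    rw [mem_inner_snoc hab]
    refine ⟨?_, Or.inl⟩
    rintro (hd | ⟨hd, rfl | rfl⟩)
    · exact hd
    · exact absurd ⟨hab, hd⟩ hc
    · rcases hab.lt_or_eq with hab' | rfl
      · exact absurd ⟨hab, hD _ _ hab' hd⟩ hc
      · exact absurd ⟨hab, hd⟩ hc

end Step

/-! ### Locality of the wiring -/

lemma wprod_fix_of_lt {c : List ℕ} {K u : ℕ} (h : ∀ m ∈ c, K ≤ m) (hu : wprod c u < K) :
    wprod c u = u := by
  apply (wprod c).injective
  rw [wprod_apply_of_ne]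
  intro m hm
  have := h m hm; omega

lemma wprod_fix_of_gt {c : List ℕ} {K u : ℕ} (h : ∀ m ∈ c, m < K) (hu : K < u) :
    wprod c u = u := by
  rw [wprod_apply_of_ne]
  intro m hm
  have := h m hm; omega

lemma permOn_congr {D D' : Finset (ℕ × ℕ)} {l : List (ℕ × ℕ)} (h : ∀ c ∈ l, c ∈ D ↔ c ∈ D') :
    permOn D l = permOn D' l := by rw [permOn, permOn, wordOn_congr h]

/-- Pipes only move up and to the right, so one whose position is below i+a after row i has never
met a cell in a column beyond a. -/
lemma permOn_boxCells_locality {D D' : Finset (ℕ × ℕ)} {N a i₀ : ℕ} (ha : a ≤ N)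
    (h : ∀ d : ℕ × ℕ, i₀ ≤ d.1 → d.2 ≤ a → (d ∈ D ↔ d ∈ D')) (k i t : ℕ) (hi : i₀ ≤ i)
    (ht : permOn D (boxCells N i k) t < i + a) :
    permOn D' (boxCells N i k) t = permOn D (boxCells N i k) t := by
  induction k generalizing i with
  | zero => rfl
  | succ k ih =>
    obtain ⟨X, hX, hX'⟩ := rowCells_split (i := i) ha
    rw [boxCells, hX, permOn_append, permOn_append, Perm.mul_apply, Perm.mul_apply] at ht
    rw [boxCells, hX, permOn_append, permOn_append, Perm.mul_apply, Perm.mul_apply,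
      permOn_append, permOn_append, Perm.mul_apply, Perm.mul_apply]
    have hXl : ∀ F : Finset (ℕ × ℕ), ∀ m ∈ wordOn F X, i + a ≤ m := by
      intro F m hm
      obtain ⟨c, hc, -, rfl⟩ := mem_wordOn.1 hm
      have := hX' c hc; omega
    have h1 := wprod_fix_of_lt (hXl D) ht
    have hrow : ∀ m ∈ wordOn D (rowCells i a), m < i + a := by
      intro m hm
      obtain ⟨c, hc, -, rfl⟩ := mem_wordOn.1 hm
      rw [mem_rowCells] at hc; omega
    have h2 : permOn D (boxCells N (i + 1) k) t < i + 1 + a := by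
      by_contra hlt
      have h3 := wprod_fix_of_gt hrow (u := permOn D (boxCells N (i + 1) k) t) (by omega)
      have h4 : permOn D X _ = _ := h1
      have h5 : permOn D (rowCells i a) _ = _ := h3
      rw [h4, h5] at ht
      omega
    have h1' : permOn D X _ = _ := h1
    rw [h1'] at ht ⊢
    rw [ih (i + 1) (by omega) h2, permOn_congr (D := D') (D' := D) (l := rowCells i a)]
    · apply permOn_apply_of_ne
      intro c hc _
      have := hX' c hc; omega
    · intro c hc
      rw [mem_rowCells] at hc
      exact (h c (by omega) (by omega)).symm

section Transfer

variable {n N : ℕ} {D : Finset (ℕ × ℕ)} {B A : List (ℕ × ℕ)} {a b : ℕ}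

lemma permOn_cellsAfter_locality {F G : Finset (ℕ × ℕ)} (ha : a ≤ N)
    (h : ∀ d : ℕ × ℕ, b < d.1 → d.2 ≤ a → (d ∈ F ↔ d ∈ G))
    (h' : ∀ q, q < a → ((b, q) ∈ F ↔ (b, q) ∈ G)) {t : ℕ}
    (ht : permOn F (cellsAfter N b a) t ≤ a + b) :
    permOn G (cellsAfter N b a) t = permOn F (cellsAfter N b a) t := by
  rw [cellsAfter, permOn_append, Perm.mul_apply] at ht
  rw [cellsAfter, permOn_append, permOn_append, Perm.mul_apply, Perm.mul_apply]
  have h1 : permOn F (boxCells N (b + 1) (N - b)) t < b + 1 + a := by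
    by_contra hlt
    have : permOn F (rowCells b (a - 1)) (permOn F (boxCells N (b + 1) (N - b)) t) = _ :=
      permOn_apply_of_ne (by
        intro c hc _
        rw [mem_rowCells] at hc; omega)
    rw [this] at ht; omega
  rw [permOn_boxCells_locality ha (i₀ := b + 1) (fun d h1 h2 => h d h1 h2) _ _ _ le_rfl h1,
    permOn_congr (D := G) (D' := F)]
  rintro ⟨c, q⟩ hc
  rw [mem_rowCells] at hc
  obtain ⟨rfl, hc⟩ := hc
  exact (h' q (by simp only at hc; omega)).symm

/-- The pipes crossing at (a,b) leave it in positions a+b-1 and a+b. They meet again at (b,a)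
exactly when the cells read in between preserve this pair of positions. By locality those cells may
be replaced by the symmetric region `inner D B`, whose remaining cells do not touch these positions.
-/
lemma avoid_iff (hN : n ≤ N) (hD : D ⊆ upperTriangle n)
    (h : boxCells N 1 N = B ++ (a, b) :: A) (hab : b < a) (hc : (a, b) ∈ D) (hc' : (b, a) ∉ D) :
    (∃ p ∈ Finset.Icc 1 n, ∃ q ∈ Finset.Icc 1 n, CrossAt D p q (a, b) ∧ AvoidAt D p q (b, a)) ↔
    ((wiring N (inner D B) (a + b - 1) = a + b - 1 ∧ wiring N (inner D B) (a + b) = a + b) ∨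
     (wiring N (inner D B) (a + b - 1) = a + b ∧ wiring N (inner D B) (a + b) = a + b - 1)) := by
  have hcu := mem_upperTriangle.1 (hD hc)
  simp only at hcu
  have hDN := hD.trans (upperTriangle_mono hN)
  obtain ⟨B', hB'⟩ := boxCells_eq (N := N) (i := b) (j := a) (by omega) (by omega) (by omega)
    (by omega)
  have hmem : (a, b) ∈ cellsAfter N b a := by rw [mem_cellsAfter]; simp only; omega
  obtain ⟨mid, A', hmid⟩ := List.append_of_mem hmem
  have hA' : A' = cellsAfter N a b :=
    cellsAfter_unique (B := B' ++ (b, a) :: mid) (c := (a, b)) (by rw [hB', hmid]; simp)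
  rw [hA'] at hmid
  clear hA' A'
  -- F is the symmetric region and G is the part of D read before (a,b). They agree on all cells
  -- that a strand at position ≤ a+b on the cut at (b,a) can have visited.
  set F := inner D B with hF
  have memF : ∀ d : ℕ × ℕ, d ∈ F ↔ d ∈ D ∧ (max d.1 d.2 < a ∨ (max d.1 d.2 = a ∧ b < min d.1 d.2)) :=
    fun d => mem_inner_split hN hD h
  set G := D.filter (fun d => d.1 < a ∨ (d.1 = a ∧ b < d.2)) with hG
  have memG : ∀ d : ℕ × ℕ, d ∈ G ↔ d ∈ D ∧ (d.1 < a ∨ (d.1 = a ∧ b < d.2)) := fun d => by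
    rw [hG, Finset.mem_filter]
  have hmidb : ∀ d ∈ mid, ReadBefore d (a, b) :=  fun d hd =>
    (readBefore_of_split (B := B' ++ (b, a) :: mid) (c := (a, b)) (A := cellsAfter N a b)
      (by rw [hB', hmid]; simp)).1 d (by simp [hd])
  have hGD : permOn D (cellsAfter N b a) =
      permOn G (cellsAfter N b a) * simpleT (a + b - 1) * permOn D (cellsAfter N a b) := by
    rw [hmid, permOn_append, permOn_append, permOn_cons_mem hc, permOn_cons_not_mem,
      permOn_congr (D := D) (D' := G) (l := mid)]
    · have : permOn G (cellsAfter N a b) = 1 := by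
        rw [permOn, wordOn_eq_nil]
        · rfl
        · intro d hd hdG
          rw [memG] at hdG
          rw [mem_cellsAfter] at hd; omega
      rw [this, mul_one, mul_assoc]
    · intro d hd
      rw [memG]
      exact ⟨fun hdD => ⟨hdD, hmidb d hd⟩, fun h => h.1⟩
    · rw [memG]; simp only; omega
  have hFG1 : ∀ d : ℕ × ℕ, b < d.1 → d.2 ≤ a → (d ∈ F ↔ d ∈ G) := by
    intro d h1 h2
    rw [memF, memG]
    refine and_congr_right fun _ => ?_
    omega
  have hFG2 : ∀ q, q < a → ((b, q) ∈ F ↔ (b, q) ∈ G) := by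
    intro q hq
    rw [memF, memG]
    refine and_congr_right fun _ => ?_
    simp only; omega
  have hFtoG : ∀ t, permOn F (cellsAfter N b a) t ≤ a + b →
      permOn G (cellsAfter N b a) t = permOn F (cellsAfter N b a) t :=
    fun t ht => permOn_cellsAfter_locality (by omega) hFG1 hFG2 ht
  have hGtoF : ∀ t, permOn G (cellsAfter N b a) t ≤ a + b →
      permOn F (cellsAfter N b a) t = permOn G (cellsAfter N b a) t :=
    fun t ht => permOn_cellsAfter_locality (by omega) (fun d h1 h2 => (hFG1 d h1 h2).symm)
      (fun q hq => (hFG2 q hq).symm) ht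
  have hx : wiring N F = permOn F B' * permOn F (cellsAfter N b a) := by
    rw [wiring, word, hB', ← permOn, permOn_append, permOn_cons_not_mem]
    rw [memF]; exact fun h => hc' h.1
  -- Cells of F read before (b,a) carry letters at most a+b-3.
  have hfix : ∀ t, a + b - 1 ≤ t → permOn F B' t = t := by
    intro t ht
    apply permOn_apply_of_ne
    intro c hcB hcF
    have h1 := (readBefore_of_split hB').1 c hcB
    unfold ReadBefore at h1
    have h3 := mem_upperTriangle.1 (hD ((memF c).1 hcF).1)
    rw [memF] at hcF
    simp only at h1; omega
  have hxt : ∀ t r, a + b - 1 ≤ r → (wiring N F t = r ↔ permOn F (cellsAfter N b a) t = r) := by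
    intro t r hr
    rw [hx, Perm.mul_apply]
    constructor
    · intro h
      exact (permOn F B').injective (h.trans (hfix r hr).symm)
    · intro h; rw [h, hfix r hr]
  rw [hxt _ _ le_rfl, hxt _ _ (by omega), hxt _ _ (by omega), hxt _ _ le_rfl]
  set P := permOn D (cellsAfter N a b) with hP
  set Q := permOn G (cellsAfter N b a) with hQ
  have hs1 : simpleT (a + b - 1) (a + b - 1) = a + b := by rw [simpleT_left]; omega
  have hs2 : simpleT (a + b - 1) (a + b) = a + b - 1 := simpleT_pred (by omega)
  have hPmem : P ∈ symmGroup n := permOn_mem_symmGroup hD _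
  constructor
  · rintro ⟨p, hp, q, hq, ⟨-, h1⟩, -, h2⟩
    rw [Finset.mem_Icc] at hp hq
    rw [meet_iff hDN (by omega) (by omega) (by omega) (by omega) (by omega) (by omega)] at h1 h2
    rw [hGD, Perm.mul_apply, Perm.mul_apply, Perm.mul_apply, Perm.mul_apply, add_comm b a] at h2
    have key : (Q (a + b - 1) = a + b - 1 ∧ Q (a + b) = a + b) ∨
        (Q (a + b - 1) = a + b ∧ Q (a + b) = a + b - 1) := by
      rcases h1 with ⟨h1, h1'⟩ | ⟨h1, h1'⟩ <;> rw [h1, h1', hs1, hs2] at h2 <;> tauto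
    rcases key with ⟨k1, k2⟩ | ⟨k1, k2⟩
    · left
      exact ⟨(hGtoF _ (by omega)).trans k1, (hGtoF _ (by omega)).trans k2⟩
    · right
      exact ⟨(hGtoF _ (by omega)).trans k1, (hGtoF _ (by omega)).trans k2⟩
  · intro hcase
    have hPi := inv_mem_symmGroup hPmem
    have b1 := symmGroup_pos hPi (k := a + b - 1) (by omega)
    have b2 := symmGroup_pos hPi (k := a + b) (by omega)
    have b3 := symmGroup_le hPi (k := a + b - 1) (by omega)
    have b4 := symmGroup_le hPi (k := a + b) (by omega)
    have e1 : P (P⁻¹ (a + b - 1)) = a + b - 1 := by simp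
    have e2 : P (P⁻¹ (a + b)) = a + b := by simp
    refine ⟨P⁻¹ (a + b - 1), Finset.mem_Icc.2 ⟨b1, b3⟩, P⁻¹ (a + b), Finset.mem_Icc.2 ⟨b2, b4⟩,
      ⟨hc, ?_⟩, hc', ?_⟩
    · rw [meet_iff hDN (by omega) (by omega) (by omega) (by omega) (by omega) (by omega)]
      exact Or.inl ⟨e1, e2⟩
    · rw [meet_iff hDN (by omega) (by omega) (by omega) (by omega) (by omega) (by omega)]
      rw [hGD, Perm.mul_apply, Perm.mul_apply, Perm.mul_apply, Perm.mul_apply, e1, e2, hs1,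
        hs2, add_comm b a]
      rcases hcase with ⟨k1, k2⟩ | ⟨k1, k2⟩
      · rw [hFtoG _ (by omega), hFtoG _ (by omega)]
        exact Or.inr ⟨k1, k2⟩
      · rw [hFtoG _ (by omega), hFtoG _ (by omega)]
        exact Or.inl ⟨k2, k1⟩

end Transfer

/-! ### Involution pipe dreams through their reading words -/

lemma mem_lowerTriangle {n : ℕ} {c : ℕ × ℕ} :
    c ∈ lowerTriangle n ↔ 1 ≤ c.2 ∧ c.2 ≤ c.1 ∧ c.1 ≤ n := by
  simp [lowerTriangle]; omega

lemma mem_inter_lowerTriangle {n : ℕ} {D : Finset (ℕ × ℕ)} (hD : D ⊆ upperTriangle n)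
    {c : ℕ × ℕ} : c ∈ D ∩ lowerTriangle n ↔ c.2 ≤ c.1 ∧ c ∈ D := by
  rw [Finset.mem_inter, mem_lowerTriangle]
  refine ⟨fun h => ⟨h.2.2.1, h.1⟩, fun h => ⟨h.2, ?_⟩⟩
  have := mem_upperTriangle.1 (hD h.2)
  omega

lemma inner_subset (D : Finset (ℕ × ℕ)) (l : List (ℕ × ℕ)) : inner D l ⊆ D :=
  Finset.filter_subset _ _

lemma finite_invSet_wiring (N : ℕ) (D : Finset (ℕ × ℕ)) : (invSet (wiring N D)).Finite :=
  finite_invSet_wprod _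

lemma wiring_mem_symmGroup {n N : ℕ} {D : Finset (ℕ × ℕ)} (hD : D ⊆ upperTriangle n) :
    wiring N D ∈ symmGroup n := permOn_mem_symmGroup hD _

lemma invCount_wiring_le {n N : ℕ} (hN : n ≤ N) {D : Finset (ℕ × ℕ)} (hD : D ⊆ upperTriangle n) :
    invCount (wiring N D) ≤ D.card := by
  rw [← length_word hN hD]; exact invCount_wprod_le _

lemma red_word_iff {n N : ℕ} (hN : n ≤ N) {D : Finset (ℕ × ℕ)} (hD : D ⊆ upperTriangle n) :
    Red (word N D) ↔ invCount (wiring N D) = D.card := by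
  rw [← length_word hN hD]; exact eq_comm

section

variable {n N : ℕ} {D : Finset (ℕ × ℕ)}

lemma invCount_inner_step (hN : n ≤ N) (hD : D ⊆ upperTriangle n)
    (hs : ∀ i j, i < j → (i, j) ∈ D → (j, i) ∈ D) {B A : List (ℕ × ℕ)} {c : ℕ × ℕ}
    (h : boxCells N 1 N = B ++ c :: A) :
    invCount (wiring N (inner D (B ++ [c]))) + (inner D B).card ≤
      invCount (wiring N (inner D B)) + (inner D (B ++ [c])).card := by
  obtain ⟨a, b⟩ := c
  have hf := finite_invSet_wiring N (inner D B)
  by_cases hc : b ≤ a ∧ (a, b) ∈ D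
  · by_cases hc' : a = b ∨ (b, a) ∉ D
    · obtain ⟨e1, e2⟩ := inner_step_right hN hD h hc.1 hc.2 hc'
      rw [e1, e2]
      have := invCount_mul_simpleT_le (a + b - 1) hf
      omega
    · push Not at hc'
      obtain ⟨e1, e2⟩ := inner_step_both hN hD h (lt_of_le_of_ne hc.1 hc'.1.symm) hc.2 hc'.2
      rw [e1, e2]
      have h1 := invCount_mul_simpleT_le (a + b - 1) hf
      have h2 := invCount_simpleT_mul_le (a + b - 1) (finite_invSet_mul_simpleT (a + b - 1) hf)
      omega
  · rw [inner_step_none hs hc]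

/-- Each stage adds at most as much length as cells, and the full pipe dream attains equality, so
every intermediate region is reduced. The induction runs backwards from the full box. -/
lemma invCount_inner (hN : n ≤ N) (hD : D ⊆ upperTriangle n)
    (hs : ∀ i j, i < j → (i, j) ∈ D → (j, i) ∈ D) (hr : Red (word N D)) {B A : List (ℕ × ℕ)}
    (h : boxCells N 1 N = B ++ A) :
    invCount (wiring N (inner D B)) = (inner D B).card := by
  refine le_antisymm (invCount_wiring_le hN ((inner_subset D B).trans hD)) ?_
  induction A generalizing B with
  | nil =>
    rw [List.append_nil] at h
    rw [← h, inner_boxCells hN hD, (red_word_iff hN hD).1 hr]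
  | cons c A ih =>
    have h1 := ih (B := B ++ [c]) (by simpa using h)
    have h2 := invCount_inner_step hN hD hs h
    omega

lemma wiring_inner_diag (hN : n ≤ N) (hD : D ⊆ upperTriangle n) {B A : List (ℕ × ℕ)} {a : ℕ}
    (h : boxCells N 1 N = B ++ (a, a) :: A) {t : ℕ} (ht : a + a - 1 ≤ t) :
    wiring N (inner D B) t = t := by
  apply permOn_apply_of_ne
  intro d _ hd
  have hd' := mem_upperTriangle.1 (hD (inner_subset _ _ hd))
  rw [mem_inner_split hN hD h] at hd
  simp only at hd; omega

/-- Stage by stage, a cell without separate reflection acts as x ↦ xs and a reflected pair as x ↦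
sxs. Reducedness makes the letter an ascent, and the two cases match the two forms of `dU`. -/
lemma dUs_of_almostSymmetric (hN : n ≤ N) (hD : D ⊆ upperTriangle n)
    (hs : IsAlmostSymmetric n D) (hr : Red (word N D)) {B A : List (ℕ × ℕ)}
    (h : boxCells N 1 N = B ++ A) :
    RaisesFrom 1 (wordOn (D ∩ lowerTriangle n) B) ∧
      dUs 1 (wordOn (D ∩ lowerTriangle n) B) = wiring N (inner D B) := by
  set E := D ∩ lowerTriangle n with hE
  have hEu : E ⊆ upperTriangle n := Finset.inter_subset_left.trans hD
  induction B using List.reverseRecOn generalizing A with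
  | nil =>
    refine ⟨trivial, ?_⟩
    rw [inner_nil, wordOn_nil, wiring, word, wordOn_eq_nil (l := boxCells N 1 N) (by simp)]; rfl
  | append_singleton B c ih =>
    have h' : boxCells N 1 N = B ++ c :: A := by simpa using h
    obtain ⟨ih1, ih2⟩ := ih h'
    have hinv := dUs_mem_involutions (one_mem_involutions n) (wordOn_letters hEu B)
    obtain ⟨a, b⟩ := c
    have hcount := invCount_inner hN hD hs.1 hr h'
    have hcount' := invCount_inner hN hD hs.1 hr h
    have hf := finite_invSet_wiring N (inner D B)
    rw [wordOn_append]
    by_cases hc : b ≤ a ∧ (a, b) ∈ D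
    · rw [wordOn_cons_mem ((mem_inter_lowerTriangle hD).2 hc), wordOn_nil, raisesFrom_snoc,
        dUs_snoc, ih2]
      rw [ih2] at hinv
      have hu := mem_upperTriangle.1 (hD hc.2)
      simp only at hu ⊢
      set m := a + b - 1 with hm
      by_cases hc' : a = b ∨ (b, a) ∉ D
      · obtain ⟨e1, e2⟩ := inner_step_right hN hD h' hc.1 hc.2 hc'
        have hasc : wiring N (inner D B) m < wiring N (inner D B) (m + 1) := by
          apply asc_of_invCount hf
          rw [← e1, hcount', hcount, e2]; omega
        have hfix : wiring N (inner D B) m = m ∧ wiring N (inner D B) (m + 1) = m + 1 := by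
          by_cases hab : a = b
          · subst hab
            exact ⟨wiring_inner_diag hN hD h' (by omega), wiring_inner_diag hN hD h' (by omega)⟩
          · have hc' : (b, a) ∉ D := by tauto
            have hlt : b < a := lt_of_le_of_ne hc.1 (Ne.symm hab)
            have := (avoid_iff hN hD h' hlt hc.2 hc').1 (hs.2 b a hlt hc.2 hc')
            rw [← hm, show a + b = m + 1 by omega] at this
            -- The alternative in which the two points are interchanged contradicts the ascent.
            rcases this with this | this
            · exact this
            · omega
        exact ⟨⟨ih1, hasc⟩, by rw [dU_of_comm hfix.1 hfix.2, e1]⟩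
      · push Not at hc'
        obtain ⟨e1, e2⟩ := inner_step_both hN hD h' (lt_of_le_of_ne hc.1 hc'.1.symm) hc.2 hc'.2
        have h1 := invCount_mul_simpleT_le m hf
        have h2 := invCount_simpleT_mul_le m (finite_invSet_mul_simpleT m hf)
        rw [← e1, hcount'] at h2
        have hasc : wiring N (inner D B) m < wiring N (inner D B) (m + 1) := by
          apply asc_of_invCount hf
          omega
        refine ⟨⟨ih1, hasc⟩, ?_⟩
        rw [dU_of_conj (involutions_inv hinv) hasc, e1, mul_assoc]
        rintro ⟨f1, f2⟩
        -- If both points were fixed, sxs would equal x, although two cells have been added to a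
        -- reduced region.
        rw [← mul_assoc, simpleT_comm_of_fix f1 f2, mul_assoc, simpleT_mul_self, mul_one] at e1
        rw [e1] at hcount'
        omega
    · rw [wordOn_cons_not_mem (by rwa [mem_inter_lowerTriangle hD]), wordOn_nil, List.append_nil,
        inner_step_none hs.1 hc]
      exact ⟨ih1, ih2⟩

end

/-! ### Rebuilding an almost-symmetric pipe dream from its lower half -/

open Classical in
/-- The symmetrization of a set of lower cells: the reflection of a cell is added unless the
involution read before the cell fixes both endpoints of its letter. -/
noncomputable def unfoldCells (N : ℕ) (E : Finset (ℕ × ℕ)) : Finset (ℕ × ℕ) :=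
  E ∪ (E.filter (fun c => c.2 < c.1 ∧
    ¬ (dUs 1 (word N (E.filter (ReadBefore · c))) (c.1 + c.2 - 1) = c.1 + c.2 - 1 ∧
      dUs 1 (word N (E.filter (ReadBefore · c))) (c.1 + c.2) = c.1 + c.2))).image Prod.swap

open Classical in
lemma word_filter_readBefore {N : ℕ} {E : Finset (ℕ × ℕ)} {B A : List (ℕ × ℕ)} {c : ℕ × ℕ}
    (h : boxCells N 1 N = B ++ c :: A) :
    word N (E.filter (ReadBefore · c)) = wordOn E B := by
  have hb := readBefore_of_split h
  rw [word, h, wordOn_append, wordOn_eq_nil (l := c :: A), List.append_nil]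
  · apply wordOn_congr
    intro d hd
    rw [Finset.mem_filter]
    exact ⟨fun h => h.1, fun h => ⟨h, hb.1 d hd⟩⟩
  · intro d hd hdE
    have h1 := (Finset.mem_filter.1 hdE).2
    unfold ReadBefore at h1
    rcases List.mem_cons.1 hd with rfl | hd
    · omega
    · have h2 := hb.2 d hd
      unfold ReadBefore at h2; omega

section

variable {n N : ℕ} {E : Finset (ℕ × ℕ)}

lemma mem_unfoldCells_low {a b : ℕ} (hab : b ≤ a) :
    (a, b) ∈ unfoldCells N E ↔ (a, b) ∈ E := by
  unfold unfoldCells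
  rw [Finset.mem_union, Finset.mem_image]
  refine ⟨?_, Or.inl⟩
  rintro (h | ⟨c, hc, he⟩)
  · exact h
  · rw [Finset.mem_filter] at hc
    rw [Prod.ext_iff] at he
    simp only [Prod.fst_swap, Prod.snd_swap] at he
    omega

lemma mem_unfoldCells_high (hE : E ⊆ lowerTriangle n) {B A : List (ℕ × ℕ)} {a b : ℕ}
    (h : boxCells N 1 N = B ++ (a, b) :: A) (hab : b < a) :
    (b, a) ∈ unfoldCells N E ↔ (a, b) ∈ E ∧
      ¬ (dUs 1 (wordOn E B) (a + b - 1) = a + b - 1 ∧ dUs 1 (wordOn E B) (a + b) = a + b) := by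
  unfold unfoldCells
  rw [Finset.mem_union, Finset.mem_image, ← word_filter_readBefore h]
  constructor
  · rintro (h | ⟨c, hc, he⟩)
    · have := mem_lowerTriangle.1 (hE h)
      simp only at this; omega
    · rw [Prod.ext_iff] at he
      obtain rfl : c = (a, b) := Prod.ext he.2 he.1
      rw [Finset.mem_filter] at hc
      exact ⟨hc.1, hc.2.2⟩
  · rintro ⟨h1, h2⟩
    exact Or.inr ⟨(a, b), Finset.mem_filter.2 ⟨h1, hab, h2⟩, rfl⟩

lemma unfoldCells_symm (hE : E ⊆ lowerTriangle n) {i j : ℕ} (hij : i < j)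
    (h : (i, j) ∈ unfoldCells N E) : (j, i) ∈ unfoldCells N E := by
  rw [mem_unfoldCells_low hij.le]
  unfold unfoldCells at h
  rw [Finset.mem_union, Finset.mem_image] at h
  rcases h with h | ⟨c, hc, he⟩
  · have := mem_lowerTriangle.1 (hE h)
    simp only at this; omega
  · rw [Prod.ext_iff] at he
    obtain rfl : c = (j, i) := Prod.ext he.2 he.1
    exact (Finset.mem_filter.1 hc).1

lemma unfoldCells_subset (hE : E ⊆ lowerTriangle n) (hE' : E ⊆ upperTriangle n) :
    unfoldCells N E ⊆ upperTriangle n := by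
  rintro ⟨a, b⟩ h
  rcases le_or_gt b a with hab | hab
  · exact hE' ((mem_unfoldCells_low hab).1 h)
  · have := mem_upperTriangle.1
      (hE' ((mem_unfoldCells_low hab.le).1 (unfoldCells_symm hE hab h)))
    rw [mem_upperTriangle]; simp only at this ⊢; omega

lemma unfoldCells_inter (hE : E ⊆ lowerTriangle n) :
    unfoldCells N E ∩ lowerTriangle n = E := by
  ext ⟨a, b⟩
  rw [Finset.mem_inter]
  constructor
  · rintro ⟨h1, h2⟩
    exact (mem_unfoldCells_low (mem_lowerTriangle.1 h2).2.1).1 h1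
  · intro h
    have h2 := hE h
    exact ⟨(mem_unfoldCells_low (mem_lowerTriangle.1 h2).2.1).2 h, h2⟩

/-- The reflection of an off-diagonal cell is left out exactly when `dU` takes its commuting form,
so wiring and involution agree at every stage. The length grows by the number of cells added, which
gives reducedness. -/
lemma wiring_inner_unfoldCells (hN : n ≤ N) (hE : E ⊆ lowerTriangle n) (hE' : E ⊆ upperTriangle n)
    (hr : RaisesFrom 1 (word N E)) {B A : List (ℕ × ℕ)} (h : boxCells N 1 N = B ++ A) :
    wiring N (inner (unfoldCells N E) B) = dUs 1 (wordOn E B) ∧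
      invCount (dUs 1 (wordOn E B)) = (inner (unfoldCells N E) B).card := by
  have hD := unfoldCells_subset (N := N) hE hE'
  induction B using List.reverseRecOn generalizing A with
  | nil =>
    rw [inner_nil, wordOn_nil, wiring, word, wordOn_eq_nil (l := boxCells N 1 N) (by simp)]
    exact ⟨rfl, by simp [invCount]⟩
  | append_singleton B c ih =>
    have h' : boxCells N 1 N = B ++ c :: A := by simpa using h
    obtain ⟨ih1, ih2⟩ := ih h'
    have hinv := dUs_mem_involutions (one_mem_involutions n) (wordOn_letters hE' B)
    obtain ⟨a, b⟩ := c
    have hf := finite_invSet_wiring N (inner (unfoldCells N E) B)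
    by_cases hc : b ≤ a ∧ (a, b) ∈ E
    · have hu := mem_upperTriangle.1 (hE' hc.2)
      have hcD := (mem_unfoldCells_low (N := N) hc.1).2 hc.2
      have hasc : dUs 1 (wordOn E B) (a + b - 1) < dUs 1 (wordOn E B) (a + b - 1 + 1) := by
        rw [word, h', wordOn_append, wordOn_cons_mem hc.2, raisesFrom_append] at hr
        exact hr.2.1
      rw [wordOn_append, wordOn_cons_mem hc.2, wordOn_nil, dUs_snoc]
      simp only at hu ⊢
      by_cases hc' : a = b ∨ (b, a) ∉ unfoldCells N E
      · obtain ⟨e1, e2⟩ := inner_step_right hN hD h' hc.1 hcD hc'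
        have hfix : dUs 1 (wordOn E B) (a + b - 1) = a + b - 1 ∧
            dUs 1 (wordOn E B) (a + b - 1 + 1) = a + b - 1 + 1 := by
          by_cases hab : a = b
          · subst hab
            rw [← ih1]
            exact ⟨wiring_inner_diag hN hD h' (by omega), wiring_inner_diag hN hD h' (by omega)⟩
          · have hc' : (b, a) ∉ unfoldCells N E := by tauto
            have hlt : b < a := lt_of_le_of_ne hc.1 (Ne.symm hab)
            rw [mem_unfoldCells_high hE h' hlt] at hc'
            rw [show a + b - 1 + 1 = a + b by omega]
            by_contra hcon
            exact hc' ⟨hc.2, hcon⟩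
        rw [e1, e2, dU_of_comm hfix.1 hfix.2, ih1, ← ih2]
        rw [ih1] at hf
        exact ⟨rfl, (invCount_mul_simpleT hf hasc).2⟩
      · push Not at hc'
        have hlt : b < a := lt_of_le_of_ne hc.1 hc'.1.symm
        obtain ⟨e1, e2⟩ := inner_step_both hN hD h' hlt hcD hc'.2
        have hnf : ¬ (dUs 1 (wordOn E B) (a + b - 1) = a + b - 1 ∧
            dUs 1 (wordOn E B) (a + b - 1 + 1) = a + b - 1 + 1) := by
          have := ((mem_unfoldCells_high hE h' hlt).1 hc'.2).2
          rwa [show a + b - 1 + 1 = a + b by omega]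
        rw [e1, e2, dU_of_conj (involutions_inv hinv) hasc hnf, ih1, ← ih2,
          invCount_conj hinv hasc hnf, mul_assoc]
        exact ⟨rfl, rfl⟩
    · rw [wordOn_append, wordOn_cons_not_mem, wordOn_nil, List.append_nil, inner_step_none
        (fun i j hij => unfoldCells_symm hE hij)]
      · exact ⟨ih1, ih2⟩
      · rintro ⟨h1, h2⟩
        exact hc ⟨h1, (mem_unfoldCells_low h1).1 h2⟩
      · intro h1
        exact hc ⟨(mem_lowerTriangle.1 (hE h1)).2.1, h1⟩

/-- Involution pipe dreams are the sets of lower cells whose reading word is a reduced involution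
word. -/
theorem mem_ID_iff (hN : n ≤ N) {y : Perm ℕ} (hy : y ∈ symmGroup n) :
    E ∈ ID n y ↔ E ⊆ lowerTriangle n ∧ E ⊆ upperTriangle n ∧ RaisesFrom 1 (word N E) ∧
      dUs 1 (word N E) = y := by
  constructor
  · rintro ⟨D, hD, hs, rfl⟩
    rw [mem_PD_iff hN hy] at hD
    obtain ⟨hD, hr, hw⟩ := hD
    obtain ⟨h1, h2⟩ := dUs_of_almostSymmetric hN hD hs hr (B := boxCells N 1 N) (A := []) (by simp)
    rw [inner_boxCells hN hD, hw] at h2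
    exact ⟨Finset.inter_subset_right, Finset.inter_subset_left.trans hD, h1, h2⟩
  · rintro ⟨h1, h2, h3, h4⟩
    have hD := unfoldCells_subset (N := N) h1 h2
    obtain ⟨e1, e2⟩ := wiring_inner_unfoldCells hN h1 h2 h3 (B := boxCells N 1 N) (A := [])
      (by simp)
    rw [inner_boxCells hN hD] at e1 e2
    refine ⟨unfoldCells N E, ?_, ⟨fun i j hij => unfoldCells_symm h1 hij, ?_⟩,
      (unfoldCells_inter h1).symm⟩
    · rw [mem_PD_iff hN hy, red_word_iff hN hD, e1]
      exact ⟨hD, e2, h4⟩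
    · intro i j hij hc hc'
      have hu := mem_upperTriangle.1 (hD hc)
      simp only at hu
      obtain ⟨B, hB⟩ := boxCells_eq (N := N) (i := j) (j := i) (by omega) (by omega) (by omega)
        (by omega)
      -- A missing reflection means that the involution read so far fixes both points, which is the
      -- first alternative of the avoidance criterion.
      rw [avoid_iff hN hD hB hij hc hc', (wiring_inner_unfoldCells hN h1 h2 h3 hB).1]
      left
      by_contra hcon
      exact hc' ((mem_unfoldCells_high h1 hB hij).2 ⟨(mem_unfoldCells_low hij.le).1 hc, hcon⟩)

end

/-! ### Lengths as numbers of cells -/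

lemma card_of_mem_PD {n : ℕ} {D : Finset (ℕ × ℕ)} {w : Perm ℕ} (hw : w ∈ symmGroup n)
    (hD : D ∈ PD n w) : invCount w = D.card := by
  rw [mem_PD_iff le_rfl hw] at hD
  rw [← hD.2.2]
  exact (red_word_iff le_rfl hD.1).1 hD.2.1

lemma invStat_of_mem_ID {n : ℕ} {E : Finset (ℕ × ℕ)} {y : Perm ℕ} (hy : y ∈ symmGroup n)
    (hE : E ∈ ID n y) : invStat y = 4 * E.card := by
  rw [mem_ID_iff le_rfl hy] at hE
  obtain ⟨-, h2, h3, h4⟩ := hE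
  have := ((invStat_dUs (one_mem_involutions n) (wordOn_letters h2 (boxCells n 1 n))).2).2 h3
  rw [invStat_one, zero_add] at this
  rw [← h4, ← length_word le_rfl h2]
  exact this

/-! ### Pipes in rectangles of crossings -/

section Pipes

variable {N : ℕ} {D : Finset (ℕ × ℕ)}

lemma enters_left_of_row {p q : ℕ} (hp : 1 ≤ p) (hq : 1 ≤ q)
    (h : ∀ r, 1 ≤ r → r < q → (p, r) ∈ D) : Enters D p .left p q := by
  obtain ⟨p, rfl⟩ := Nat.exists_eq_add_of_le' hp
  induction q, hq using Nat.le_induction with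
  | base => exact .start
  | succ q hq ih =>
    exact .cross_left (ih fun r h1 h2 => h r h1 (by omega)) (h q hq (by omega))

lemma enters_top_of_col {p r q : ℕ} (h : Enters D p .below r q)
    (hc : ∀ r', 1 ≤ r' → r' ≤ r → (r', q) ∈ D) : Enters D p .below 0 q := by
  induction r with
  | zero => exact h
  | succ r ih =>
    exact ih (.cross_below h (hc (r + 1) (by omega) le_rfl)) fun r' h1 h2 => hc r' h1 (by omega)

/-- The pipe runs straight along its row, turns at the first bending tile and then rises through a
full column. -/
lemma wiring_of_hook (hD : D ⊆ upperTriangle N) {p q : ℕ} (hp : 1 ≤ p) (hp' : p ≤ N) (hq : 1 ≤ q)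
    (hrow : ∀ r, 1 ≤ r → r < q → (p, r) ∈ D) (hpq : (p, q) ∉ D)
    (hcol : ∀ r, 1 ≤ r → r < p → (r, q) ∈ D) : wiring N D p = q := by
  have h1 := enters_left_of_row hp hq hrow
  rw [← enters_top_iff hD hp hp' hq]
  obtain ⟨p, rfl⟩ := Nat.exists_eq_add_of_le' hp
  exact enters_top_of_col (.bend_left h1 hpq) fun r h1 h2 => hcol r h1 (by omega)

/-- Inside a rectangle of crossings a pipe coming from the left cannot turn upward, so it leaves the
first i columns in its own row. -/
lemma wiring_gt_of_rect (hD : D ⊆ upperTriangle N) {p j i : ℕ} (hp : 1 ≤ p) (hp' : p ≤ N)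
    (hpj : p ≤ j) (h : ∀ a b, 1 ≤ a → a ≤ j → 1 ≤ b → b ≤ i → (a, b) ∈ D) :
    i < wiring N D p := by
  have key : ∀ σ r c, Enters D p σ r c → 1 ≤ c ∧
      ((σ = .left → c ≤ i → r = p) ∧ (σ = .below → i < c)) := by
    intro σ r c he
    induction he with
    | start => simp
    | @cross_left a b _ _ ih =>
      refine ⟨by omega, fun _ hb => ih.2.1 rfl (by omega), by simp⟩
    | @bend_left a b _ hc ih =>
      refine ⟨ih.1, by simp, fun _ => ?_⟩
      by_contra hb
      have := ih.2.1 rfl (by omega)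
      exact hc (h _ _ (by omega) (by omega) ih.1 (by omega))
    | cross_below _ _ ih => exact ⟨ih.1, by simp, fun _ => ih.2.2 rfl⟩
    | bend_below _ _ ih =>
      have := ih.2.2 rfl
      exact ⟨by omega, fun _ _ => by omega, by simp⟩
  have hpos := symmGroup_pos (wiring_mem_symmGroup (N := N) hD) hp
  exact (key _ _ _ ((enters_top_iff hD hp hp' hpos).2 rfl)).2.2 rfl

/-- A minimal missing cell (p,q) of the rectangle would be the corner of a hook, giving pipe p the
endpoint q ≤ b. -/
lemma rect_of_wiring_gt (hD : D ⊆ upperTriangle N) {a b : ℕ} (ha : a ≤ N)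
    (h : ∀ p, 1 ≤ p → p ≤ a → b < wiring N D p) {p q : ℕ} (hp : 1 ≤ p) (hpa : p ≤ a) (hq : 1 ≤ q)
    (hqb : q ≤ b) : (p, q) ∈ D := by
  induction p using Nat.strong_induction_on generalizing q with
  | _ p ihp =>
    induction q using Nat.strong_induction_on with
    | _ q ihq =>
      by_contra hc
      have := wiring_of_hook hD hp (by omega) hq (fun r h1 h2 => ihq r h2 h1 (by omega)) hc
        (fun r h1 h2 => ihp r h2 h1 (by omega) hq hqb)
      have := h p hp hpa
      omega

/-- Down-closed sets of cells are reduced pipe dreams. -/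
lemma isReducedPipeDream_of_downClosed (hD : D ⊆ upperTriangle N)
    (h : ∀ a b a' b', (a, b) ∈ D → 1 ≤ a' → a' ≤ a → 1 ≤ b' → b' ≤ b → (a', b') ∈ D) :
    IsReducedPipeDream N D := by
  refine ⟨hD, ?_⟩
  -- In a down-closed shape the horizontal pipe at a crossing started in that row and the vertical
  -- one ends in that column, so the crossing is determined by the two pipes. The comparison of
  -- endpoints excludes a second crossing with the roles exchanged.
  have key : ∀ p q, 1 ≤ p → p ≤ N → 1 ≤ q → q ≤ N → ∀ c : ℕ × ℕ, c ∈ D →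
      Enters D p .left c.1 c.2 → Enters D q .below c.1 c.2 →
      c.1 = p ∧ c.2 = wiring N D q ∧ wiring N D q < wiring N D p := by
    rintro p q hp hp' hq hq' ⟨a, b⟩ hc h1 h2
    have hu := mem_upperTriangle.1 (hD hc)
    simp only at h1 h2 hu ⊢
    have h3 : Enters D a .left a b := enters_left_of_row hu.1 hu.2.1
      fun r h1 h2 => h a b a r hc hu.1 le_rfl h1 (by omega)
    rw [enters_left_iff hD hp hp' hu.1 hu.2.1] at h1
    rw [enters_left_iff hD hu.1 (by omega) hu.1 hu.2.1] at h3
    have e1 : a = p := (permOn D _).injective (h3.trans h1.symm)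
    have h4 := enters_top_of_col h2 fun r h1 h2 => h a b r b hc h1 h2 hu.2.1 le_rfl
    rw [enters_top_iff hD hq hq' hu.2.1] at h4
    refine ⟨e1, h4.symm, ?_⟩
    rw [h4]
    exact wiring_gt_of_rect hD hp hp' (j := a) (by omega)
      fun a' b' h1 h2 h3 h4 => h a b a' b' hc h1 h2 h3 h4
  intro p hp q hq _ c c' hc hc'
  rw [Finset.mem_Icc] at hp hq
  have k1 := key p q hp.1 hp.2 hq.1 hq.2
  have k2 := key q p hq.1 hq.2 hp.1 hp.2
  rcases hc with ⟨hc, ⟨h1, h2⟩ | ⟨h1, h2⟩⟩ <;> rcases hc' with ⟨hc', ⟨h3, h4⟩ | ⟨h3, h4⟩⟩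
  · have := k1 c hc h1 h2; have := k1 c' hc' h3 h4; ext <;> omega
  · have := k1 c hc h1 h2; have := k2 c' hc' h3 h4; omega
  · have := k2 c hc h1 h2; have := k1 c' hc' h3 h4; omega
  · have := k2 c hc h1 h2; have := k2 c' hc' h3 h4; ext <;> omega

lemma dUs_of_downClosed (hD : D ⊆ upperTriangle N)
    (h : ∀ a b a' b', (a, b) ∈ D → 1 ≤ a' → a' ≤ a → 1 ≤ b' → b' ≤ b → (a', b') ∈ D)
    (hs : IsSymmetric D) :
    dUs 1 (word N (D ∩ lowerTriangle N)) = wiring N D := by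
  have hw := wiring_mem_symmGroup (N := N) hD
  refine ((mem_ID_iff le_rfl hw).1 ⟨D, (mem_PD_iff le_rfl hw).2 ⟨hD, red_word_of_reduced le_rfl
    (isReducedPipeDream_of_downClosed hD h), rfl⟩, ⟨fun i j _ => hs i j, ?_⟩, rfl⟩).2.2.2
  intro i j _ h1 h2
  exact absurd (hs _ _ h1) h2

end Pipes

/-! ### Comparison of twofold Demazure products -/

lemma dUs_sublist {c d : List ℕ} (h : c.Sublist d) {x y : Perm ℕ} (hxy : BruhatLE x y) :
    BruhatLE (dUs x c) (dUs y d) := by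
  induction h generalizing x y with
  | slnil => exact hxy
  | cons m _ ih => exact ih (hxy.trans (le_dU m y))
  | cons_cons m _ ih => exact ih (dU_mono m hxy)

lemma wordOn_sublist {E F : Finset (ℕ × ℕ)} (h : E ⊆ F) (l : List (ℕ × ℕ)) :
    (wordOn E l).Sublist (wordOn F l) := by
  unfold wordOn
  apply List.Sublist.map
  apply List.monotone_filter_right
  intro c hc
  simpa using h (by simpa using hc)

lemma dUs_word_mono {E F : Finset (ℕ × ℕ)} (h : E ⊆ F) (N : ℕ) :
    BruhatLE (dUs 1 (word N E)) (dUs 1 (word N F)) :=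
  dUs_sublist (wordOn_sublist h _) (BruhatLE.refl 1)

/-- Going up in the Bruhat order can only decrease the number of small values among the first
positions. Position 0, whose value is 0, is counted too, hence the bounds 1 and 2 in the proof. -/
lemma lt_of_bruhatLE {x y : Perm ℕ} (h : BruhatLE x y) (hy0 : y 0 = 0) {j i : ℕ}
    (hx : ∀ p, 1 ≤ p → p ≤ j → i < x p) {p : ℕ} (hp : 1 ≤ p) (hpj : p ≤ j) : i < y p := by
  by_contra hc
  have h1 := h (j + 1) (i + 1)
  have h2 : rk x (j + 1) (i + 1) ≤ 1 := by
    unfold rk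
    refine (Finset.card_le_card (t := {0}) ?_).trans (by simp)
    intro q hq
    rw [Finset.mem_filter, Finset.mem_range] at hq
    rw [Finset.mem_singleton]
    by_contra h0
    have := hx q (by omega) (by omega)
    omega
  have h3 : 2 ≤ rk y (j + 1) (i + 1) := by
    unfold rk
    rw [← Finset.card_pair (show (0 : ℕ) ≠ p by omega)]
    apply Finset.card_le_card
    intro q hq
    rw [Finset.mem_insert, Finset.mem_singleton] at hq
    rw [Finset.mem_filter, Finset.mem_range]
    rcases hq with rfl | rfl <;> omega
  omega

lemma le_of_bruhatLE {x y : Perm ℕ} (h : BruhatLE x y) {a b : ℕ}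
    (hy : ∀ p, p ≤ a → y p ≤ b) {p : ℕ} (hp : p ≤ a) : x p ≤ b := by
  have h1 := h (a + 1) (b + 1)
  have h2 : rk y (a + 1) (b + 1) = a + 1 := by
    unfold rk
    rw [Finset.filter_true_of_mem, Finset.card_range]
    intro q hq
    rw [Finset.mem_range] at hq
    have := hy q (by omega); omega
  rw [h2] at h1
  have h3 : (Finset.range (a + 1)).filter (fun i => x i < b + 1) = Finset.range (a + 1) := by
    apply Finset.eq_of_subset_of_card_le (Finset.filter_subset _ _)
    rw [Finset.card_range]; exact h1
  have h4 : p ∈ (Finset.range (a + 1)).filter (fun i => x i < b + 1) := by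
    rw [h3, Finset.mem_range]; omega
  have := (Finset.mem_filter.1 h4).2
  omega

lemma dUs_apply_zero {c : List ℕ} (hc : ∀ m ∈ c, 1 ≤ m) : dUs 1 c 0 = 0 := by
  obtain ⟨n, hn⟩ : ∃ n, ∀ m ∈ c, m < n := by
    refine ⟨c.sum + 1, fun m hm => ?_⟩
    have := List.single_le_sum (l := c) (by simp) m hm
    omega
  exact symmGroup_zero (dUs_mem_involutions (one_mem_involutions n)
    fun m hm => ⟨hc m hm, hn m hm⟩).1

/-- The symmetric hook shape spanned by a rectangle. -/
def hookShape (j i : ℕ) : Finset (ℕ × ℕ) :=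
  (Finset.Icc 1 j ×ˢ Finset.Icc 1 i) ∪ (Finset.Icc 1 i ×ˢ Finset.Icc 1 j)

lemma mem_hookShape {j i : ℕ} {c : ℕ × ℕ} : c ∈ hookShape j i ↔
    (1 ≤ c.1 ∧ 1 ≤ c.2) ∧ ((c.1 ≤ j ∧ c.2 ≤ i) ∨ (c.1 ≤ i ∧ c.2 ≤ j)) := by
  simp [hookShape]; omega

lemma dUs_hookShape {N j i : ℕ} (hN : i + j ≤ N) :
    hookShape j i ⊆ upperTriangle N ∧
      dUs 1 (word N (hookShape j i ∩ lowerTriangle N)) = wiring N (hookShape j i) := by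
  have hD : hookShape j i ⊆ upperTriangle N := by
    intro c hc
    rw [mem_hookShape] at hc
    rw [mem_upperTriangle]; omega
  refine ⟨hD, dUs_of_downClosed hD ?_ ?_⟩
  · intro a b a' b' h h1 h2 h3 h4
    rw [mem_hookShape] at h ⊢
    simp only at h ⊢; omega
  · intro a b h
    rw [mem_hookShape] at h ⊢
    simp only at h ⊢; omega

/-- The hook shape is symmetric and down-closed, so its product is its wiring and has the required
large values. A larger set of cells has a Bruhat-larger product. -/
lemma lt_dUs_of_rect {N j i : ℕ} (hij : i ≤ j) (hN : i + j ≤ N) {F : Finset (ℕ × ℕ)}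
    (hF1 : ∀ c ∈ F, 1 ≤ c.1 ∧ 1 ≤ c.2)
    (hF : ∀ p q, 1 ≤ q → q ≤ p → p ≤ j → q ≤ i → (p, q) ∈ F) {p : ℕ} (hp : 1 ≤ p) (hpj : p ≤ j) :
    i < dUs 1 (word N F) p := by
  obtain ⟨hD, h1⟩ := dUs_hookShape hN
  have hle := dUs_word_mono (N := N) (E := hookShape j i ∩ lowerTriangle N) (F := F) (by
    rintro ⟨a, b⟩ hc
    rw [Finset.mem_inter, mem_hookShape, mem_lowerTriangle] at hc
    simp only at hc
    exact hF a b (by omega) (by omega) (by omega) (by omega))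
  rw [h1] at hle
  refine lt_of_bruhatLE hle ?_ (fun p hp hpj => wiring_gt_of_rect hD hp (by omega) hpj ?_) hp hpj
  · apply dUs_apply_zero
    intro m hm
    obtain ⟨c, -, hc, rfl⟩ := mem_wordOn.1 hm
    have := hF1 c hc; omega
  · intro a b h1 h2 h3 h4
    rw [mem_hookShape]; simp only; omega

/-- Pipe p crosses the square along row p, leaves it at column j+1, and then zigzags to the
northeast through empty tiles up to column j+p. -/
lemma wiring_square {N j p : ℕ} (hN : 2 * j ≤ N) (hp : 1 ≤ p) (hpj : p ≤ j) :
    wiring N (hookShape j j) p = j + p := by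
  obtain ⟨hD, -⟩ := dUs_hookShape (N := N) (j := j) (i := j) (by omega)
  have key : ∀ k, k < p → Enters (hookShape j j) p .left (p - k) (j + 1 + k) := by
    intro k
    induction k with
    | zero =>
      intro _
      apply enters_left_of_row hp (by omega)
      intro r h1 h2
      rw [mem_hookShape]; simp only; omega
    | succ k ih =>
      intro hk
      have h1 := ih (by omega)
      rw [show p - k = (p - (k + 1) - 1) + 1 + 1 by omega] at h1
      have h2 := h1.bend_left (by rw [mem_hookShape]; simp only; omega)
      have h3 := h2.bend_below (by rw [mem_hookShape]; simp only; omega)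
      rwa [show p - (k + 1) - 1 + 1 = p - (k + 1) by omega] at h3
  have h1 := key (p - 1) (by omega)
  rw [show p - (p - 1) = 0 + 1 by omega] at h1
  have h2 := h1.bend_left (by rw [mem_hookShape]; simp only; omega)
  rw [enters_top_iff hD hp (by omega) (by omega)] at h2
  omega

/-- Lower cells in rows ≤ j lie in the j × j square, so the product is bounded above by the wiring
of the square. -/
lemma le_dUs_of_rows {N j : ℕ} (hN : 2 * j ≤ N) {F : Finset (ℕ × ℕ)} {x : Perm ℕ}
    (hF : ∀ c ∈ F, 1 ≤ c.2 ∧ c.2 ≤ c.1 ∧ c.1 ≤ j) (hx : BruhatLE x (dUs 1 (word N F))) {p : ℕ}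
    (hpj : p ≤ j) : x p ≤ j + p := by
  obtain ⟨hD, h1⟩ := dUs_hookShape (N := N) (j := j) (i := j) (by omega)
  have hle := dUs_word_mono (N := N) (E := F) (F := hookShape j j ∩ lowerTriangle N) (by
    intro c hc
    have := hF c hc
    rw [Finset.mem_inter, mem_hookShape, mem_lowerTriangle]
    omega)
  rw [h1] at hle
  refine le_of_bruhatLE (hx.trans hle) (a := p) ?_ le_rfl
  intro q hq
  rcases Nat.eq_zero_or_pos q with rfl | hq0
  · rw [symmGroup_zero (wiring_mem_symmGroup hD)]; omega
  · rw [wiring_square hN hq0 (by omega)]; omega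

/-! ### Outer corners -/

/-- The cell `(j, i)` is an outer corner, weakly below the diagonal, of the involution `y`. -/
structure IsCorner (y : Perm ℕ) (j i : ℕ) : Prop where
  pos : 1 ≤ i
  le : i ≤ j
  apply : y j = i
  row : ∀ p, 1 ≤ p → p < j → i < y p
  col : ∀ b, 1 ≤ b → b < i → j < y b

/-- Adding the corner completes a rectangle whose other cells are all in the Rothe diagram, which
gives `row` and `col`. Since the corner itself is not in the diagram, these inequalities pin down
y(j) = i. -/
lemma isCorner_of_isOuterCornerOf {n : ℕ} (hn : 0 < n) {y : Perm ℕ} (hy : y ∈ involutions n)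
    {i j : ℕ} (hij : i ≤ j) (h : IsOuterCornerOf n y (j, i)) :
    IsCorner y j i ∧ j ≤ n ∧ i + j ≤ n + 1 := by
  obtain ⟨hc, hnd, lam, hanti, -, hF⟩ := h
  obtain ⟨hj, hi⟩ : 1 ≤ j ∧ 1 ≤ i := hc
  have hinv := involutions_inv hy
  have hyy := inv_apply_of_inv hinv
  have mem_rothe : ∀ c : ℕ × ℕ, c ∈ rothe n y ↔
      c.1 ∈ Finset.Icc 1 n ∧ c.2 ∈ Finset.Icc 1 n ∧ c.2 < y c.1 ∧ c.1 < y c.2 := by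
    intro c; simp [rothe, hinv]
  have dom_sub : ∀ S : Set (ℕ × ℕ), dom S ⊆ S := by
    rintro S c ⟨L, ⟨-, hL⟩, hcL⟩; exact hL hcL
  have hlam : i ≤ lam j := by
    have : ((j, i) : ℕ × ℕ) ∈ insert (j, i) (dom (domPerm n y)) := Set.mem_insert _ _
    rw [hF] at this
    exact this.2.2
  have hrect : ∀ p b, 1 ≤ p → p ≤ j → 1 ≤ b → b ≤ i → (p, b) ≠ (j, i) → (p, b) ∈ rothe n y := by
    intro p b h1 h2 h3 h4 h5
    have : ((p, b) : ℕ × ℕ) ∈ insert (j, i) (dom (domPerm n y)) := by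
      rw [hF]
      have := hanti h2
      exact ⟨h1, h3, by simp only; omega⟩
    exact dom_sub _ (dom_sub _ ((Set.mem_insert_iff.1 this).resolve_left h5))
  -- Otherwise the full rectangle would be a lower set inside the Rothe diagram, and the corner
  -- would lie in the dominant component.
  have hnr : (j, i) ∉ rothe n y := by
    intro hr
    apply hnd
    refine ⟨{c | (1 ≤ c.1 ∧ 1 ≤ c.2) ∧ c.1 ≤ j ∧ c.2 ≤ i}, ⟨⟨fun c hc => hc.1, ?_⟩, ?_⟩,
      ⟨⟨hj, hi⟩, le_rfl, le_rfl⟩⟩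
    · intro c hc c' hc' hle
      exact ⟨hc', hle.1.trans hc.2.1, hle.2.trans hc.2.2⟩
    · rintro ⟨p, b⟩ hpb
      by_cases he : (p, b) = (j, i)
      · rw [he]; exact hr
      · exact hrect p b hpb.1.1 hpb.2.1 hpb.1.2 hpb.2.2 he
  have hrow : ∀ p, 1 ≤ p → p < j → i < y p := fun p h1 h2 =>
    ((mem_rothe _).1 (hrect p i h1 h2.le hi le_rfl (by simp; omega))).2.2.1
  have hcol : ∀ b, 1 ≤ b → b < i → j < y b := fun b h1 h2 =>
    ((mem_rothe _).1 (hrect j b hj le_rfl h1 h2.le (by simp; omega))).2.2.2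
  have hyj : i ≤ y j := by
    by_contra hlt
    have h1 := symmGroup_pos hy.1 hj
    have h2 := hcol (y j) h1 (by omega)
    rw [hyy] at h2; omega
  have hyi : j ≤ y i := by
    by_contra hlt
    have h1 := symmGroup_pos hy.1 hi
    have h2 := hrow (y i) h1 (by omega)
    rw [hyy] at h2; omega
  have hjn : j ≤ n := by
    by_contra hlt
    have h1 := symmGroup_le hy.1 (k := 1) hn
    have h2 := symmGroup_gt hy.1 (k := j) (by omega)
    have h3 : y i ≤ n ∨ n < i := by
      rcases le_or_gt i n with h | h
      · exact Or.inl (symmGroup_le hy.1 h)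
      · exact Or.inr h
    have h4 := hrow 1 le_rfl (by omega)
    omega
  have happly : y j = i := by
    by_contra hne
    have hne' : y i ≠ j := fun h => hne (by rw [← h, hyy])
    exact hnr ((mem_rothe _).2 ⟨Finset.mem_Icc.2 ⟨hj, hjn⟩, Finset.mem_Icc.2 ⟨hi, by omega⟩,
      by simp only; omega, by simp only; omega⟩)
  refine ⟨⟨hi, hij, happly, hrow, hcol⟩, hjn, ?_⟩
  -- By the row condition y injects {1, …, j-1} into {i+1, …, n}, whence i + j ≤ n + 1.
  have hcard := Finset.card_le_card_of_injOn (s := Finset.Icc 1 (j - 1))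
    (t := Finset.Icc (i + 1) n) y (by
      intro p hp
      rw [Finset.coe_Icc, Set.mem_Icc] at hp
      rw [Finset.coe_Icc, Set.mem_Icc]
      exact ⟨hrow p hp.1 (by omega), symmGroup_le hy.1 (by omega)⟩) y.injective.injOn
  rw [Nat.card_Icc, Nat.card_Icc] at hcard
  omega

/-! ### Peeling letters off an involution -/

/-- The twofold downward operators of the letters of a word, the last letter acting first. -/
def dEs (x : Perm ℕ) (c : List ℕ) : Perm ℕ := c.foldr dE x

lemma dEs_append (x : Perm ℕ) (c d : List ℕ) : dEs x (c ++ d) = dEs (dEs x d) c :=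
  List.foldr_append

lemma dEs_snoc (x : Perm ℕ) (c : List ℕ) (m : ℕ) : dEs x (c ++ [m]) = dEs (dE m x) c :=
  dEs_append x c [m]

lemma inv_dUs {x : Perm ℕ} (hx : x⁻¹ = x) (c : List ℕ) : (dUs x c)⁻¹ = dUs x c := by
  induction c generalizing x with
  | nil => exact hx
  | cons m c ih => exact ih (inv_dU hx)

lemma inv_dEs {x : Perm ℕ} (hx : x⁻¹ = x) (c : List ℕ) : (dEs x c)⁻¹ = dEs x c := by
  induction c with
  | nil => exact hx
  | cons m c ih => exact inv_dE ih

/-- Iterated adjunction: the letters of c can be moved from the right side of a Bruhat inequality to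
the left, last letter first. `le_dUs_dEs` moves them back. -/
lemma dEs_le {x z : Perm ℕ} (hz : z⁻¹ = z) {c : List ℕ} (h : BruhatLE x (dUs z c)) :
    BruhatLE (dEs x c) z := by
  induction c using List.reverseRecOn generalizing x with
  | nil => exact h
  | append_singleton c m ih =>
    rw [dUs_snoc] at h
    rw [dEs_snoc]
    exact ih ((dE_mono m h).trans (dE_dU_le (inv_dUs hz c)))

lemma le_dUs_dEs {x : Perm ℕ} (hx : x⁻¹ = x) (c : List ℕ) : BruhatLE x (dUs (dEs x c) c) := by
  induction c using List.reverseRecOn generalizing x with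
  | nil => exact BruhatLE.refl x
  | append_singleton c m ih =>
    rw [dUs_snoc, dEs_snoc]
    exact (le_dU_dE hx).trans (dU_mono m (ih (inv_dE hx)))

lemma IsCorner.dE {x : Perm ℕ} (hx : x⁻¹ = x) {j i m : ℕ} (h : IsCorner x j i) (hm : j < m) :
    IsCorner (dE m x) j i := by
  have hle := h.le
  rcases lt_or_gt_of_ne (asc_ne x m) with ha | hd
  · rwa [dE_of_asc hx ha]
  · rw [dE_of_desc hx hd]
    have hs : ∀ p, p ≤ j → simpleT m p = p := fun p hp => simpleT_of_ne (by omega) (by omega)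
    split_ifs with hxm
    · refine ⟨h.pos, hle, ?_, fun p h1 h2 => ?_, fun b h1 h2 => ?_⟩
      · rw [Perm.mul_apply, hs _ le_rfl]; exact h.apply
      · rw [Perm.mul_apply, hs _ h2.le]; exact h.row p h1 h2
      · rw [Perm.mul_apply, hs b (by omega)]; exact h.col b h1 h2
    · have hgt : ∀ r q, r ≤ j → r < q → r < simpleT m q := by
        intro r q h1 h2
        rw [simpleT_apply]; split_ifs <;> omega
      refine ⟨h.pos, hle, ?_, fun p h1 h2 => ?_, fun b h1 h2 => ?_⟩
      · rw [Perm.mul_apply, Perm.mul_apply, hs _ le_rfl, h.apply, hs _ hle]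
      · rw [Perm.mul_apply, Perm.mul_apply, hs _ h2.le]; exact hgt _ _ hle (h.row p h1 h2)
      · rw [Perm.mul_apply, Perm.mul_apply, hs b (by omega)]
        exact hgt _ _ le_rfl (h.col b h1 h2)

lemma IsCorner.dEs {x : Perm ℕ} (hx : x⁻¹ = x) {j i : ℕ} (h : IsCorner x j i) {c : List ℕ}
    (hc : ∀ m ∈ c, j < m) : IsCorner (dEs x c) j i := by
  induction c with
  | nil => exact h
  | cons m c ih =>
    exact (ih fun k hk => hc k (by simp [hk])).dE (inv_dEs hx c) (hc m (by simp))

/-- The value at b lies in {j+1, …, j+b}, and inductively all of these but the last are taken by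
smaller positions. -/
lemma IsCorner.apply_eq {x : Perm ℕ} {j i : ℕ} (h : IsCorner x j i)
    (hle : ∀ p, p ≤ j → x p ≤ j + p) {b : ℕ} (hb : 1 ≤ b) (hbi : b < i) : x b = j + b := by
  induction b using Nat.strong_induction_on with
  | _ b ih =>
    have h1 := h.col b hb hbi
    have hij := h.le
    have h2 := hle b (by omega)
    by_contra hne
    have h3 := ih (x b - j) (by omega) (by omega) (by omega)
    have := x.injective (h3.trans (by omega : j + (x b - j) = x b))
    omega

/-- Peeling off the letters j, j+1, … in turn slides each 2-cycle (b, j+b) to (b, j+b-1). Meanwhile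
the partner of i, or the fixed point if i = j, moves from j to j+t. -/
lemma dEs_row {x : Perm ℕ} (hx : x⁻¹ = x) {j i : ℕ} (hij : i ≤ j) (hxj : x j = i)
    (hb : ∀ b, 1 ≤ b → b < i → x b = j + b) {F : Finset (ℕ × ℕ)}
    (hF : ∀ b, 1 ≤ b → b < i → (j, b) ∈ F) (t : ℕ) (ht : t < i) :
    (∀ b, 1 ≤ b → b ≤ t → dEs x (wordOn F (rowCells j t)) b = j + b - 1) ∧
    (∀ b, t < b → b < i → dEs x (wordOn F (rowCells j t)) b = j + b) ∧
    ((dEs x (wordOn F (rowCells j t)) (j + t) = i ∧ i < j) ∨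
      (dEs x (wordOn F (rowCells j t)) (j + t) = j + t ∧ i = j)) := by
  induction t with
  | zero =>
    refine ⟨by omega, fun b h1 h2 => hb b h1 h2, ?_⟩
    change (x j = i ∧ _) ∨ (x j = j ∧ _)
    omega
  | succ t ih =>
    obtain ⟨hA, hB, hC⟩ := ih (by omega)
    rw [rowCells, wordOn_cons_mem (hF _ (by omega) ht)]
    change (∀ b, 1 ≤ b → b ≤ t + 1 → dE (j + (t + 1) - 1) (dEs x (wordOn F (rowCells j t))) b = _) ∧
      (∀ b, t + 1 < b → b < i → dE (j + (t + 1) - 1) (dEs x (wordOn F (rowCells j t))) b = _) ∧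
      ((dE (j + (t + 1) - 1) (dEs x (wordOn F (rowCells j t))) _ = _ ∧ _) ∨
        (dE (j + (t + 1) - 1) (dEs x (wordOn F (rowCells j t))) _ = _ ∧ _))
    have hX := inv_dEs hx (wordOn F (rowCells j t))
    set X := dEs x (wordOn F (rowCells j t))
    rw [show j + (t + 1) - 1 = j + t by omega]
    have h1 : X (j + t + 1) = t + 1 := by
      have := hB (t + 1) (by omega) ht
      rw [show j + t + 1 = X (t + 1) by omega]; exact inv_apply_of_inv hX _
    have hne : X (j + t) ≠ j + t + 1 := by omega
    rw [dE_of_desc hX (by omega), if_neg hne]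
    have hlow : ∀ b, b < j + t → simpleT (j + t) b = b :=
      fun b hb => simpleT_of_ne (by omega) (by omega)
    have hhigh : ∀ b, j + t + 1 < b → simpleT (j + t) b = b :=
      fun b hb => simpleT_of_ne (by omega) (by omega)
    refine ⟨fun b hb1 hb2 => ?_, fun b hb1 hb2 => ?_, ?_⟩
    · rw [Perm.mul_apply, Perm.mul_apply, hlow b (by omega)]
      rcases Nat.lt_or_eq_of_le hb2 with hb2 | rfl
      · rw [hA b hb1 (by omega), hlow _ (by omega)]
      · rw [hB _ (by omega) ht, show j + (t + 1) = j + t + 1 by omega, simpleT_right]; omega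
    · rw [Perm.mul_apply, Perm.mul_apply, hlow b (by omega), hB b (by omega) hb2, hhigh _ (by omega)]
    · rw [Perm.mul_apply, Perm.mul_apply, show j + (t + 1) = j + t + 1 by omega, simpleT_right]
      rcases hC with ⟨hC, hlt⟩ | ⟨hC, heq⟩
      · left; rw [hC, hlow _ (by omega)]; exact ⟨rfl, hlt⟩
      · right; rw [hC, simpleT_left]; exact ⟨rfl, heq⟩

/-- After the letters left of the corner are peeled, the values 1, …, i-1 (and i, …, 2i-2 as well if
i = j) are taken by other positions. Position j+i therefore cannot have a value below that at j+i-1,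
so the corner's letter sits at an ascent. -/
lemma dEs_row_asc {x : Perm ℕ} (hx : x⁻¹ = x) {j i : ℕ} (hi : 1 ≤ i) (hij : i ≤ j)
    (hxj : x j = i) (hb : ∀ b, 1 ≤ b → b < i → x b = j + b) {F : Finset (ℕ × ℕ)}
    (hF : ∀ b, 1 ≤ b → b < i → (j, b) ∈ F) (hX0 : dEs x (wordOn F (rowCells j (i - 1))) 0 = 0) :
    dEs x (wordOn F (rowCells j (i - 1))) (j + i - 1) <
      dEs x (wordOn F (rowCells j (i - 1))) (j + i) := by
  obtain ⟨hA, -, hC⟩ := dEs_row hx hij hxj hb hF (i - 1) (by omega)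
  have hX := inv_dEs hx (wordOn F (rowCells j (i - 1)))
  set X := dEs x (wordOn F (rowCells j (i - 1)))
  rw [show j + (i - 1) = j + i - 1 by omega] at hC
  have hXX := inv_apply_of_inv hX
  have hne : X (j + i - 1) ≠ X (j + i) := fun h => by have := X.injective h; omega
  have h0 : X (j + i) ≠ 0 := fun h => by
    have := X.injective (h.trans hX0.symm); omega
  by_contra hlt
  have h1 : ¬ X (j + i) < i := by
    intro h
    have h2 := hA (X (j + i)) (by omega) (by omega)
    rw [hXX] at h2; omega
  rcases hC with ⟨hC, -⟩ | ⟨hC, rfl⟩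
  · omega
  · have h2 := hA (X (i + i) + 1 - i) (by omega) (by omega)
    rw [show i + (X (i + i) + 1 - i) - 1 = X (i + i) by omega] at h2
    have h3 := X.injective h2
    omega

/-- The reading word is u, then the corner's letter, then v₁ (rest of row j), then v₂ (lower rows).
By adjunction v₂ and v₁ are peeled off x. At the corner's letter the peeled involution has an
ascent, so it already lies below the product of u alone, and restoring v₁ and v₂ gives the claim. -/
lemma IsCorner.le_dUs_erase {N : ℕ} {F : Finset (ℕ × ℕ)} {x : Perm ℕ} (hx : x⁻¹ = x) (hx0 : x 0 = 0)
    {j i : ℕ} (h : IsCorner x j i) (hN : 2 * j ≤ N) (hF : ∀ c ∈ F, 1 ≤ c.2 ∧ c.2 ≤ c.1)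
    (hrow : ∀ b, 1 ≤ b → b ≤ i → (j, b) ∈ F) (hle : BruhatLE x (dUs 1 (word N F))) :
    BruhatLE x (dUs 1 (word N (F.erase (j, i)))) := by
  have hi := h.pos
  have hij := h.le
  obtain ⟨B, hB⟩ := boxCells_eq (N := N) (i := j) (j := i) (by omega) (by omega) hi (by omega)
  set G := F.erase (j, i) with hG
  have hFG : F = insert (j, i) G := (Finset.insert_erase (hrow i hi le_rfl)).symm
  have hGrow : ∀ b, 1 ≤ b → b < i → (j, b) ∈ G := fun b h1 h2 =>
    Finset.mem_erase.2 ⟨by simp; omega, hrow b h1 h2.le⟩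
  have hGF : ∀ c ∈ G, 1 ≤ c.2 ∧ c.2 ≤ c.1 := fun c hc => hF c (Finset.mem_of_mem_erase hc)
  rw [word_eq_of_split G hB (by simp [hG])]
  rw [hFG, word_insert G hB] at hle
  rw [cellsAfter, wordOn_append] at hle ⊢
  simp only at hle
  set u := wordOn G B
  set v₁ := wordOn G (rowCells j (i - 1)) with hv₁
  set v₂ := wordOn G (boxCells N (j + 1) (N - j)) with hv₂
  have hv₂l : ∀ m ∈ v₂, j < m := by
    intro m hm
    obtain ⟨c, hc, -, rfl⟩ := mem_wordOn.1 hm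
    rw [mem_boxCells] at hc; omega
  have hpos : ∀ m, m ∈ v₁ ∨ m ∈ v₂ → 1 ≤ m := by
    rintro m (hm | hm) <;> obtain ⟨c, -, hc, rfl⟩ := mem_wordOn.1 hm <;>
    · have := hGF c hc; omega
  have h2 := h.dEs hx hv₂l
  have hx2 := inv_dEs hx v₂
  have one_inv : (1 : Perm ℕ)⁻¹ = 1 := inv_one
  have hle2 : BruhatLE (InvPipe.dEs x v₂) (dUs 1 (u ++ (j + i - 1) :: v₁)) := by
    apply dEs_le (inv_dUs one_inv _)
    rw [← dUs_append]; simpa using hle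
  -- Once v₂ is removed only cells in rows ≤ j remain, so the square bounds the values. This is
  -- where 2j ≤ N is needed.
  have hstair : ∀ p, p ≤ j → InvPipe.dEs x v₂ p ≤ j + p := by
    intro p hp
    refine le_dUs_of_rows (F := insert (j, i) (G.filter (fun c => c.1 ≤ j))) hN ?_ ?_ hp
    · intro c hc
      rw [Finset.mem_insert, Finset.mem_filter] at hc
      rcases hc with rfl | hc
      · exact ⟨hi, hij, le_rfl⟩
      · exact ⟨(hGF c hc.1).1, (hGF c hc.1).2, hc.2⟩
    · rw [word_insert _ hB, cellsAfter, wordOn_append,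
        wordOn_eq_nil (l := boxCells N (j + 1) (N - j)), List.append_nil,
        wordOn_congr (D' := G) (l := B), wordOn_congr (D' := G) (l := rowCells j (i - 1))]
      · exact hle2
      · intro c hc
        rw [mem_rowCells] at hc
        rw [Finset.mem_filter]
        exact ⟨fun h => h.1, fun h => ⟨h, by omega⟩⟩
      · intro c hc
        have := (readBefore_of_split hB).1 c hc
        rw [Finset.mem_filter]
        exact ⟨fun h => h.1, fun h => ⟨h, by unfold ReadBefore at this; simp only at this; omega⟩⟩
      · intro c hc hc'
        rw [mem_boxCells] at hc
        have := (Finset.mem_filter.1 hc').2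
        omega
  have dEs_zero : ∀ (z : Perm ℕ) (c : List ℕ), z⁻¹ = z → z 0 = 0 → (∀ m ∈ c, 1 ≤ m) →
      InvPipe.dEs z c 0 = 0 := by
    intro z c hz hz0 hc
    induction c with
    | nil => exact hz0
    | cons m c ih =>
      have ih := ih fun k hk => hc k (by simp [hk])
      have hm := hc m (by simp)
      change InvPipe.dE m (InvPipe.dEs z c) 0 = 0
      have hs : simpleT m 0 = 0 := simpleT_of_ne (by omega) (by omega)
      have hi := inv_dEs hz c
      rcases lt_or_gt_of_ne (asc_ne (InvPipe.dEs z c) m) with ha | hd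
      · rwa [dE_of_asc hi ha]
      · rw [dE_of_desc hi hd]
        split_ifs <;> simp [Perm.mul_apply, hs, ih]
  have h20 := dEs_zero x v₂ hx hx0 fun m hm => hpos m (Or.inr hm)
  have hasc := dEs_row_asc hx2 hi hij h2.apply
    (fun b h1 h3 => h2.apply_eq hstair h1 h3) hGrow
    (dEs_zero _ v₁ hx2 h20 fun m hm => hpos m (Or.inl hm))
  rw [← hv₁] at hasc
  have hle3 : BruhatLE (InvPipe.dEs (InvPipe.dEs x v₂) v₁) (dU (j + i - 1) (dUs 1 u)) := by
    rw [← dUs_snoc]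
    apply dEs_le (inv_dUs one_inv _)
    rw [← dUs_append]; simpa using hle2
  have hle4 := (dE_mono (j + i - 1) hle3).trans (dE_dU_le (inv_dUs one_inv u))
  rw [dE_of_asc (inv_dEs hx2 v₁) (by rwa [show j + i - 1 + 1 = j + i by omega]), ← dEs_append] at hle4
  rw [dUs_append]
  exact (le_dUs_dEs hx (v₁ ++ v₂)).trans (dUs_mono hle4 _)

/-! ### Covers of atoms and of involutions -/

lemma mul_simpleT_le_dR (m : ℕ) (x : Perm ℕ) : BruhatLE (x * simpleT m) (dR m x) := by
  rcases lt_or_gt_of_ne (asc_ne x m) with h | h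
  · rw [dR_of_asc h]; exact BruhatLE.refl _
  · rw [dR_of_desc h]
    have := le_dR m (x * simpleT m)
    rwa [dR_of_asc (by simpa using h), mul_assoc, simpleT_mul_self, mul_one] at this

lemma simpleT_mul_le_dL (m : ℕ) (x : Perm ℕ) : BruhatLE (simpleT m * x) (dL m x) := by
  have := (mul_simpleT_le_dR m x⁻¹).inv
  rwa [mul_inv_rev, simpleT_inv, inv_inv] at this

/-- Inverting the hypothesis gives b ≥ a s_m as well. The two inequalities control every rank of s_m
∘ a ∘ s_m except the one at (m+1, m+1). There s_m a has no value ≤ m at positions m and m+1, so row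
m+2 supplies the bound. -/
lemma dU_le_of_simpleT_mul_le {a b : Perm ℕ} {m : ℕ} (ha : a⁻¹ = a) (hb : b⁻¹ = b)
    (h1 : m ≤ a m) (h2 : m + 2 ≤ a (m + 1)) (hasc : a m < a (m + 1))
    (hle : BruhatLE (simpleT m * a) b) : BruhatLE (dU m a) b := by
  have hL : dL m a = simpleT m * a := dL_of_asc (by rwa [ha])
  rw [← hL] at hle
  have hleR : BruhatLE (dR m a) b := by
    have := hle.inv
    rwa [← dR_inv, ha, hb] at this
  have hne : a m ≠ m + 1 := fun h => by
    have := inv_apply_of_inv ha m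
    rw [h] at this; omega
  intro p q
  by_cases hq : q = m + 1
  · by_cases hp : p = m + 1
    · subst hp hq
      have h3 := rk_add_two (dL m a) m (m + 1)
      have e1 : m + 1 ≤ dL m a m := by
        rw [hL, Perm.mul_apply, simpleT_apply]; split_ifs <;> omega
      have e2 : m + 1 ≤ dL m a (m + 1) := by
        rw [hL, Perm.mul_apply, simpleT_apply]; split_ifs <;> omega
      rw [if_neg (by omega), if_neg (by omega)] at h3
      have h4 := hle (m + 2) (m + 1)
      have h5 := rk_mono_left b (show m + 1 ≤ m + 2 by omega) (m + 1)
      unfold dU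
      rw [← dR_dL_comm, rk_dR_eq]
      omega
    · unfold dU
      rw [← dR_dL_comm, rk_dR_ne hp]
      exact hle p q
  · unfold dU
    rw [rk_dL_ne hq]
    exact hleR p q

/-- Not being an excedance passes backwards through the letters of a raising word when the position
is moved along with them. -/
lemma apply_le_of_dUs_apply_le {a : Perm ℕ} (ha : a⁻¹ = a) {v : List ℕ} (hr : RaisesFrom a v)
    {j : ℕ} (h : dUs a v j ≤ j) : a (wprod v j) ≤ wprod v j := by
  induction v generalizing a with
  | nil => exact h
  | cons m v ih =>
    have h1 := ih (inv_dU ha) hr.2 h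
    rw [wprod_cons, Perm.mul_apply]
    by_cases hc : a m = m ∧ a (m + 1) = m + 1
    · rw [dU_of_comm hc.1 hc.2, Perm.mul_apply] at h1
      have h2 := simpleT_apply m (wprod v j)
      split_ifs at h2 <;> rw [h2] at h1 ⊢ <;> omega
    · rw [dU_of_conj ha hr.1 hc, Perm.mul_apply, Perm.mul_apply] at h1
      by_contra hlt
      have h2 := simpleT_lt (m := m) (not_le.1 hlt) (by
        rintro ⟨e1, e2⟩
        rw [e1] at e2
        have h3 := inv_apply_of_inv ha m
        have h4 := hr.1
        rw [e2] at h3; omega)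
      rw [simpleT_simpleT] at h2
      omega

lemma swap_mul_simpleT (m p q : ℕ) (a : Perm ℕ) :
    a * simpleT m * swap (simpleT m p) (simpleT m q) = a * swap p q * simpleT m := by
  rw [mul_assoc, mul_assoc, Equiv.mul_swap_eq_swap_mul, simpleT_simpleT, simpleT_simpleT]

/-- The relation a·t ≤ b is carried through the letters of v, the transposition being conjugated by
each letter. The gap of exactly one involution step between a and b is preserved, and it rules out
the letter that would reverse the order of the two values. -/
lemma dUs_mul_swap_le {n : ℕ} {a b : Perm ℕ} (ha : a ∈ involutions n) (hb : b ∈ involutions n)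
    {v : List ℕ} (hv : ∀ m ∈ v, 1 ≤ m ∧ m < n) (hra : RaisesFrom a v) (hrb : RaisesFrom b v)
    (hstat : invStat b = invStat a + 4) {j s : ℕ} (hj : dUs a v j ≤ j)
    (h1 : wprod v j < wprod v s) (h2 : a (wprod v j) < a (wprod v s))
    (h3 : b (wprod v s) < b (wprod v j))
    (hle : BruhatLE (a * swap (wprod v j) (wprod v s)) b) :
    dUs a v j < dUs a v s ∧ BruhatLE (dUs a v * swap j s) (dUs b v) := by
  induction v generalizing a b with
  | nil => exact ⟨h2, hle⟩
  | cons m v ih =>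
    have hm := hv m (by simp)
    have hai := involutions_inv ha
    have hbi := involutions_inv hb
    have hJ := apply_le_of_dUs_apply_le hai hra hj
    rw [wprod_cons, Perm.mul_apply] at hJ h1 h2 h3 hle
    rw [Perm.mul_apply] at h1 h2 h3 hle
    have hasca : a m < a (m + 1) := hra.1
    have hascb : b m < b (m + 1) := hrb.1
    set J := simpleT m (wprod v j) with hJdef
    set S := simpleT m (wprod v s) with hSdef
    have hJ' : wprod v j = simpleT m J := by rw [hJdef, simpleT_simpleT]
    have hS' : wprod v s = simpleT m S := by rw [hSdef, simpleT_simpleT]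
    have hmul : a * simpleT m * swap (simpleT m J) (simpleT m S) = a * swap J S * simpleT m :=
      swap_mul_simpleT m J S a
    refine ih (a := dU m a) (b := dU m b) (dU_mem_involutions ha hm.1 hm.2) (dU_mem_involutions hb hm.1 hm.2)
      (fun k hk => hv k (by simp [hk])) hra.2 hrb.2 ?_ hj ?_ ?_ ?_ ?_
    · rw [invStat_dU ha hasca, invStat_dU hb hascb, hstat]
    · rw [hJ', hS']
      apply simpleT_lt h1
      rintro ⟨e1, e2⟩
      rw [e1, e2] at h3; omega
    · rw [hJ', hS']
      by_cases hc : a m = m ∧ a (m + 1) = m + 1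
      · rw [dU_of_comm hc.1 hc.2]; simpa using h2
      · rw [dU_of_conj hai hasca hc]
        simp only [Perm.mul_apply, simpleT_simpleT]
        apply simpleT_lt h2
        rintro ⟨e1, e2⟩
        have f1 : a m = J := by rw [← e1]; exact inv_apply_of_inv hai J
        have f2 : a (m + 1) = S := by rw [← e2]; exact inv_apply_of_inv hai S
        -- In the bad case the transposition acts on a as left multiplication by s_m, so s_m ∘ a ∘
        -- s_m ≤ b. Equal statistics make these two equal, but b has an ascent at m.
        have hle' : BruhatLE (simpleT m * a) b := by
          rw [Equiv.mul_swap_eq_swap_mul, e1, e2] at hle; exact hle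
        have hS2 : S ≠ m + 1 := by
          intro h
          exact hc ⟨by omega, by omega⟩
        have hU := dU_le_of_simpleT_mul_le hai hbi (by omega) (by omega) hasca hle'
        have heq := (invStat_strictMono (dU_mem_involutions ha hm.1 hm.2) hb hU).2
          (by rw [invStat_dU ha hasca, hstat])
        have := dU_desc (m := m) hai
        rw [heq] at this; omega
    · rw [hJ', hS']
      by_cases hc : b m = m ∧ b (m + 1) = m + 1
      · rw [dU_of_comm hc.1 hc.2]; simpa using h3
      · rw [dU_of_conj hbi hascb hc]
        simp only [Perm.mul_apply, simpleT_simpleT]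
        apply simpleT_lt h3
        rintro ⟨e1, e2⟩
        have f1 : b m = S := by rw [← e1]; exact inv_apply_of_inv hbi S
        have f2 : b (m + 1) = J := by rw [← e2]; exact inv_apply_of_inv hbi J
        omega
    · rw [hJ', hS']
      have hR : BruhatLE (a * swap J S * simpleT m) (dR m b) :=
        (mul_simpleT_le_dR m _).trans (dR_mono m hle)
      by_cases hc : a m = m ∧ a (m + 1) = m + 1
      · rw [dU_of_comm hc.1 hc.2, hmul]
        exact hR.trans (le_dL m _)
      · rw [dU_of_conj hai hasca hc, mul_assoc (simpleT m), mul_assoc (simpleT m), hmul]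
        exact (simpleT_mul_le_dL m _).trans (dL_mono m hR)

/-- Just after u the statement is x s_k ≤ s_k ∘ x ∘ s_k. The letters of v then transport it, turning
s_k into t_{js}. -/
lemma mul_swap_le_of_atoms {n : ℕ} {u v : List ℕ} {k : ℕ} (hl : ∀ m ∈ u ++ k :: v, 1 ≤ m ∧ m < n)
    (h1 : RaisesFrom 1 (u ++ v)) (h2 : RaisesFrom 1 (u ++ k :: v)) {j s : ℕ} (hjs : wprod v j = k)
    (hs : wprod v s = k + 1) (hj : dUs 1 (u ++ v) j ≤ j) :
    dUs 1 (u ++ v) j < dUs 1 (u ++ v) s ∧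
      BruhatLE (dUs 1 (u ++ v) * swap j s) (dUs 1 (u ++ k :: v)) := by
  rw [raisesFrom_append] at h1 h2
  have hu := dUs_mem_involutions (one_mem_involutions n) (c := u) fun m hm => hl m (by simp [hm])
  have hk := hl k (by simp)
  have hasc : dUs 1 u k < dUs 1 u (k + 1) := h2.2.1
  rw [dUs_append, dUs_append] at *
  refine dUs_mul_swap_le hu (dU_mem_involutions hu hk.1 hk.2) (fun m hm => hl m (by simp [hm]))
    h1.2 h2.2.2 (invStat_dU hu hasc) hj ?_ ?_ ?_ ?_
  · omega
  · rw [hjs, hs]; exact hasc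
  · rw [hjs, hs]; exact dU_desc (involutions_inv hu)
  · rw [hjs, hs]
    exact (mul_simpleT_le_dR k _).trans (le_dL k _)

/-! ### Letters and lengths of involution words -/

/-- Each letter m gives s_m below the product, while an element of S_n preserves {0, …, m} as soon
as m ≥ n. -/
lemma letters_lt_of_mem_symmGroup {n : ℕ} {c : List ℕ}
    (hy : dUs 1 c ∈ symmGroup n) : ∀ m ∈ c, m < n := by
  intro m hm
  by_contra hlt
  have h1 : BruhatLE (simpleT m) (dUs 1 c) := by
    have := dUs_sublist (List.singleton_sublist.2 hm) (BruhatLE.refl 1)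
    rw [dUs_cons, dUs_nil, dU_of_comm rfl rfl, one_mul] at this
    exact this
  have h2 := le_of_bruhatLE (a := m) (b := m) h1 (fun p hp => ?_) (le_refl m)
  · rw [simpleT_left] at h2; omega
  · rcases le_or_gt p n with h | h
    · exact (symmGroup_le hy h).trans (by omega)
    · rw [symmGroup_gt hy h]; exact hp

/-- Values of `invStat` move in steps of 4, so a strict increase is an increase by at least 4. -/
lemma invStat_dUs_mod (n : ℕ) {x : Perm ℕ} (hx : x ∈ involutions n) {c : List ℕ}
    (hc : ∀ m ∈ c, 1 ≤ m ∧ m < n) : ∃ k, invStat (dUs x c) = invStat x + 4 * k := by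
  induction c generalizing x with
  | nil => exact ⟨0, rfl⟩
  | cons m c ih =>
    have hm := hc m (by simp)
    obtain ⟨k, hk⟩ := ih (dU_mem_involutions hx hm.1 hm.2) fun k hk => hc k (by simp [hk])
    rw [dUs_cons, hk]
    rcases lt_or_gt_of_ne (asc_ne x m) with h | h
    · exact ⟨k + 1, by rw [invStat_dU hx h]; ring⟩
    · exact ⟨k, by rw [dU_of_desc (involutions_inv hx) h]⟩

/-! ### Adding and removing an outer corner -/

lemma word_letters {n : ℕ} {D : Finset (ℕ × ℕ)} (hD : D ⊆ upperTriangle n) (N : ℕ) :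
    ∀ m ∈ word N D, 1 ≤ m ∧ m < n := wordOn_letters hD _

section Corner

variable {n M : ℕ} {y z : Perm ℕ} {E D : Finset (ℕ × ℕ)} {j i : ℕ}

/-- The rectangle without the corner is the union of the rectangles [j-1] × [i] and [j] × [i-1],
both forced by the values of y. A full rectangle would force y(j) > i. -/
lemma IsCorner.rect_subset (hy : y ∈ symmGroup n) (hc : IsCorner y j i) (hjn : j ≤ n)
    (hD : D ∈ PD n y) :
    (∀ p q, 1 ≤ p → p ≤ j → 1 ≤ q → q ≤ i → (p, q) ≠ (j, i) → (p, q) ∈ D) ∧ (j, i) ∉ D := by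
  rw [mem_PD_iff le_rfl hy] at hD
  obtain ⟨hD, -, hw⟩ := hD
  have hi := hc.pos
  have hij := hc.le
  have hrect : ∀ p q, 1 ≤ p → p ≤ j → 1 ≤ q → q ≤ i → (p, q) ≠ (j, i) → (p, q) ∈ D := by
    intro p q h1 h2 h3 h4 h5
    rcases Nat.lt_or_eq_of_le h2 with h2 | rfl
    · refine rect_of_wiring_gt hD (a := j - 1) (b := i) (by omega) (fun p h1 h2 => ?_) h1 (by omega)
        h3 h4
      rw [hw]; exact hc.row p h1 (by omega)
    · have hq : q ≠ i := fun h => h5 (by rw [h])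
      refine rect_of_wiring_gt hD (a := p) (b := i - 1) hjn (fun p' h1' h2' => ?_) h1 le_rfl
        h3 (by omega)
      rw [hw]
      rcases Nat.lt_or_eq_of_le h2' with h2' | rfl
      · have := hc.row p' h1' h2'; omega
      · have := hc.apply; omega
  refine ⟨hrect, fun hmem => ?_⟩
  have := wiring_gt_of_rect hD (p := j) (j := j) (i := i) (by omega) hjn le_rfl
    fun a b h1 h2 h3 h4 => by
      by_cases h : (a, b) = (j, i)
      · rw [h]; exact hmem
      · exact hrect a b h1 h2 h3 h4 h
  rw [hw, hc.apply] at this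
  omega

lemma IsCorner.mem_of_mem_ID (hy : y ∈ symmGroup n) (hc : IsCorner y j i) (hjn : j ≤ n)
    (hE : E ∈ ID n y) :
    (∀ p q, 1 ≤ q → q ≤ p → p ≤ j → q ≤ i → (p, q) ≠ (j, i) → (p, q) ∈ E) ∧ (j, i) ∉ E := by
  obtain ⟨D, hD, -, rfl⟩ := hE
  obtain ⟨h1, h2⟩ := hc.rect_subset hy hjn hD
  refine ⟨fun p q a b c d e => Finset.mem_inter.2 ⟨h1 p q (by omega) c a d e, ?_⟩,
    fun h => h2 (Finset.mem_inter.1 h).1⟩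
  rw [mem_lowerTriangle]; simp only; omega

lemma mem_of_lt_apply (hz : z ∈ symmGroup n) (hjn : j ≤ n) (hgt : ∀ p, 1 ≤ p → p ≤ j → i < z p)
    (hE : E ∈ ID n z) {p q : ℕ} (hq : 1 ≤ q) (hqp : q ≤ p) (hpj : p ≤ j) (hqi : q ≤ i) :
    (p, q) ∈ E := by
  obtain ⟨D, hD, -, rfl⟩ := hE
  rw [mem_PD_iff le_rfl hz] at hD
  refine Finset.mem_inter.2 ⟨rect_of_wiring_gt hD.1 hjn ?_ (by omega) hpj hq hqi, ?_⟩
  · rw [hD.2.2]; exact hgt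
  · rw [mem_lowerTriangle]; simp only; omega

/-- The new product is ≥ y and differs from it at j, while the word is only one letter longer. -/
lemma IsCorner.insert_mem_ID (hnM : n ≤ M) (hy : y ∈ involutions n) (hc : IsCorner y j i)
    (hjn : j ≤ n) (hij : i + j ≤ M) (hE : E ∈ ID n y) :
    ∃ z ∈ involutions M, insert (j, i) E ∈ ID M z := by
  have hi := hc.pos
  have hle := hc.le
  obtain ⟨hrect, hcE⟩ := hc.mem_of_mem_ID hy.1 hjn hE
  rw [mem_ID_iff hnM hy.1] at hE
  obtain ⟨h1, h2, h3, h4⟩ := hE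
  set F := insert (j, i) E with hF
  have hFl : F ⊆ lowerTriangle M := by
    intro c hcF
    rw [hF, Finset.mem_insert] at hcF
    rw [mem_lowerTriangle]
    rcases hcF with rfl | hcF
    · simp only; omega
    · have := mem_lowerTriangle.1 (h1 hcF); omega
  have hFu : F ⊆ upperTriangle M := by
    intro c hcF
    rw [hF, Finset.mem_insert] at hcF
    rw [mem_upperTriangle]
    rcases hcF with rfl | hcF
    · simp only; omega
    · have := mem_upperTriangle.1 (h2 hcF); omega
  have hlet := word_letters hFu M
  have hz := dUs_mem_involutions (one_mem_involutions M) hlet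
  have hyM := involutions_mono hnM hy
  refine ⟨_, hz, (mem_ID_iff le_rfl hz.1).2 ⟨hFl, hFu, ?_, rfl⟩⟩
  have hgt : i < dUs 1 (word M F) j := by
    refine lt_dUs_of_rect hle hij (fun c hcF => ?_) (fun p q a b c d => ?_) (by omega) le_rfl
    · have := mem_lowerTriangle.1 (hFl hcF); omega
    · by_cases h : (p, q) = (j, i)
      · rw [h]; exact Finset.mem_insert_self _ _
      · exact Finset.mem_insert_of_mem (hrect p q a b c d h)
  have hyz : BruhatLE y (dUs 1 (word M F)) := by
    rw [← h4]; exact dUs_word_mono (Finset.subset_insert _ _) M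
  have hne : invStat y ≠ invStat (dUs 1 (word M F)) := fun h => by
    have := (invStat_strictMono hyM hz hyz).2 h
    rw [← this, hc.apply] at hgt; omega
  have hmono := (invStat_strictMono hyM hz hyz).1
  obtain ⟨k₁, hk₁⟩ := invStat_dUs_mod M (one_mem_involutions M) hlet
  obtain ⟨hb1, hb2⟩ := invStat_dUs (one_mem_involutions M) hlet
  have hEl := (invStat_dUs (one_mem_involutions M) (c := word M E)
    (word_letters (h2.trans (upperTriangle_mono hnM)) M)).2.2 h3
  have hcard : (word M F).length = (word M E).length + 1 := by
    rw [length_word le_rfl hFu, length_word hnM h2, hF, Finset.card_insert_of_notMem hcE]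
  rw [h4] at hEl
  rw [invStat_one] at *
  -- Strictness and divisibility give an increase of at least 4, and the extra letter allows at most
  -- 4, so every letter raises.
  exact hb2.1 (by omega)

/-- After erasure the product is ≥ y, but one letter fewer leaves no room for it to be larger. Hence
it equals y and all letters raise. -/
lemma IsCorner.erase_mem_ID (hnM : n ≤ M) (hy : y ∈ involutions n) (hc : IsCorner y j i)
    (hjn : j ≤ n) (hz : z ∈ involutions M) (hE : E ∈ ID M z)
    (hgt : ∀ p, 1 ≤ p → p ≤ j → i < z p) (hyz : BruhatLE y z) (hstat : invStat z = invStat y + 4) :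
    (j, i) ∈ E ∧ E.erase (j, i) ∈ ID n y := by
  have hi := hc.pos
  have hle := hc.le
  have hrect : ∀ p q, 1 ≤ q → q ≤ p → p ≤ j → q ≤ i → (p, q) ∈ E :=
    fun p q h1 h2 h3 h4 => mem_of_lt_apply hz.1 (by omega) hgt hE h1 h2 h3 h4
  have hcE : (j, i) ∈ E := hrect j i hi hle le_rfl le_rfl
  refine ⟨hcE, ?_⟩
  -- The box of side 2M contains the j × j square's wiring needed in `IsCorner.le_dUs_erase`.
  rw [mem_ID_iff (N := 2 * M) (by omega) hz.1] at hE
  obtain ⟨h1, h2, h3, h4⟩ := hE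
  set F := E.erase (j, i) with hF
  have hFE : F ⊆ E := Finset.erase_subset _ _
  have hyF : BruhatLE y (dUs 1 (word (2 * M) F)) := by
    refine hc.le_dUs_erase (involutions_inv hy) (symmGroup_zero hy.1) (by omega) (fun c hcE => ?_)
      (fun b hb1 hb2 => hrect j b hb1 (by omega) le_rfl hb2) (by rwa [h4])
    have := mem_lowerTriangle.1 (h1 hcE); omega
  have hlet := word_letters (hFE.trans h2) (2 * M)
  have hw := dUs_mem_involutions (one_mem_involutions M) hlet
  have hEl := (invStat_dUs (one_mem_involutions M) (word_letters h2 (2 * M))).2.2 h3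
  obtain ⟨hb1, hb2⟩ := invStat_dUs (one_mem_involutions M) hlet
  have hcard : (word (2 * M) E).length = (word (2 * M) F).length + 1 := by
    rw [length_word (by omega) h2, length_word (by omega) (hFE.trans h2), hF,
      Finset.card_erase_add_one hcE]
  obtain ⟨hm1, hm2⟩ := invStat_strictMono (involutions_mono hnM hy) hw hyF
  have heq : y = dUs 1 (word (2 * M) F) := hm2 (by
    rw [h4] at hEl; omega)
  have hr : RaisesFrom 1 (word (2 * M) F) := hb2.1 (by
    rw [h4] at hEl; omega)
  -- Since the product y is in S_n all letters are below n, so the remaining cells lie in the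
  -- smaller triangle.
  have hlt := letters_lt_of_mem_symmGroup (n := n) (c := word (2 * M) F) (by rw [← heq]; exact hy.1)
  have hbound : ∀ c ∈ F, c.1 + c.2 ≤ n := by
    intro c hcF
    have hu := mem_upperTriangle.1 (h2 (hFE hcF))
    have := hlt (c.1 + c.2 - 1) (mem_wordOn.2 ⟨c, by rw [mem_boxCells]; omega, hcF, rfl⟩)
    omega
  refine (mem_ID_iff (N := 2 * M) (by omega) hy.1).2 ⟨fun c hcF => ?_, fun c hcF => ?_, hr, heq.symm⟩
  · have := mem_lowerTriangle.1 (h1 (hFE hcF))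
    have := hbound c hcF
    rw [mem_lowerTriangle]; omega
  · have := mem_upperTriangle.1 (h2 (hFE hcF))
    have := hbound c hcF
    rw [mem_upperTriangle]; omega

end Corner

/-! ### The transition sets -/

lemma wprod_mul_swap {u v : List ℕ} {k j s : ℕ} (hj : wprod v j = k) (hs : wprod v s = k + 1) :
    wprod (u ++ v) * swap j s = wprod (u ++ k :: v) := by
  rw [wprod_append, wprod_append, wprod_cons, mul_assoc, Equiv.mul_swap_eq_swap_mul, hj, hs]
  rfl

/-- Strong exchange, applied to a reduced word of the covering atom, deletes one letter and leaves a
reduced word of the covered atom. Both are involution words. The default value z = y of τ is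
excluded by the involution length. -/
lemma exists_words_of_mem_Psi {n : ℕ} {y z : Perm ℕ} {j : ℕ} (hj : 1 ≤ j) (hz : z ∈ Psi n y j) :
    ∃ s u k v, j < s ∧ s ≤ n + 1 ∧ (∀ m ∈ u ++ k :: v, 1 ≤ m ∧ m < n + 1) ∧
      RaisesFrom 1 (u ++ v) ∧ RaisesFrom 1 (u ++ k :: v) ∧ dUs 1 (u ++ v) = y ∧
      dUs 1 (u ++ k :: v) = z ∧ wprod v j = k ∧ wprod v s = k + 1 := by
  obtain ⟨hzi, s, hjs, hsn, htau, hlen⟩ := hz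
  rcases htau with ⟨-, w', ⟨w, hw, rfl, hcov⟩, hw'⟩ | ⟨-, rfl⟩
  · have hlw := len_eq_invCount hw.1
    rw [len_eq_invCount hw'.1, hlw] at hcov
    have hlt : w j < w s := by
      by_contra hge
      have hne : w j ≠ w s := fun h => by have := w.injective h; omega
      have := invCount_lt_mul_swap hw'.1 hjs hj hsn (by simp; omega)
      rw [mul_assoc, swap_mul_self, mul_one] at this
      omega
    obtain ⟨c, hc, hcw, hcl⟩ := exists_reduced_word hw'.1
    obtain ⟨u, k, v, rfl, h1, h2, h3⟩ := exchange (c := c) hjs (by rw [hcw]; simpa using hlt)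
    have hred : Red (u ++ k :: v) := by unfold Red; rw [hcw]; exact hcl
    rw [hcw, mul_assoc, swap_mul_self, mul_one] at h1
    have hred' : Red (u ++ v) := by
      unfold Red
      rw [h1]
      simp only [List.length_append, List.length_cons] at hcl ⊢
      omega
    have hc' : ∀ m ∈ u ++ v, 1 ≤ m ∧ m < n + 1 := by
      intro m hm
      rw [List.mem_append] at hm
      exact hc m (by simp; tauto)
    obtain ⟨r1, e1⟩ := raises_of_mem_atoms hw hc' h1 hred'
    obtain ⟨r2, e2⟩ := raises_of_mem_atoms hw' hc hcw hred
    exact ⟨s, u, k, v, hjs, hsn, hc, r1, r2, e1, e2, h2, h3⟩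
  · omega

lemma mem_Psi_of_words {n : ℕ} {j s k : ℕ} {u v : List ℕ}
    (hjs : j < s) (hsn : s ≤ n + 1) (hl : ∀ m ∈ u ++ k :: v, 1 ≤ m ∧ m < n + 1)
    (h1 : RaisesFrom 1 (u ++ v)) (h2 : RaisesFrom 1 (u ++ k :: v)) (h3 : wprod v j = k)
    (h4 : wprod v s = k + 1) : dUs 1 (u ++ k :: v) ∈ Psi n (dUs 1 (u ++ v)) j := by
  have hl' : ∀ m ∈ u ++ v, 1 ≤ m ∧ m < n + 1 := by
    intro m hm
    rw [List.mem_append] at hm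
    exact hl m (by simp; tauto)
  have hz := dUs_mem_involutions (one_mem_involutions (n + 1)) hl
  refine ⟨hz, s, hjs, hsn, Or.inl ⟨hz, wprod (u ++ k :: v), ⟨wprod (u ++ v),
    wprod_mem_atoms hl' h1, (wprod_mul_swap h3 h4).symm, ?_⟩, wprod_mem_atoms hl h2⟩, ?_⟩
  · rw [len_eq_invCount (wprod_mem_symmGroup hl), len_eq_invCount (wprod_mem_symmGroup hl'),
      ← (h1.red hl').1, ← (h2.red hl).1]
    simp; ring
  · rw [invLen_eq hl h2, invLen_eq hl' h1]
    simp; ring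

/-- The permutation y t_{js} has all its first j values above i, since y(s) > y(j) = i. Going up to
z keeps this. -/
lemma IsCorner.of_mem_Psi {n : ℕ} {y z : Perm ℕ} {j i : ℕ}
    (hc : IsCorner y j i) (hz : z ∈ Psi n y j) :
    (∀ p, 1 ≤ p → p ≤ j → i < z p) ∧ BruhatLE y z ∧ invStat z = invStat y + 4 := by
  have hi := hc.pos
  have hij := hc.le
  obtain ⟨s, u, k, v, hjs, hsn, hl, h1, h2, rfl, rfl, h3, h4⟩ :=
    exists_words_of_mem_Psi (by omega) hz
  have hl' : ∀ m ∈ u ++ v, 1 ≤ m ∧ m < n + 1 := by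
    intro m hm
    rw [List.mem_append] at hm
    exact hl m (by simp; tauto)
  obtain ⟨hlt, hle⟩ := mul_swap_le_of_atoms hl h1 h2 h3 h4 (by rw [hc.apply]; exact hij)
  refine ⟨fun p hp hpj => ?_, (le_mul_swap hjs.le hlt.le).trans hle, ?_⟩
  · refine lt_of_bruhatLE hle (symmGroup_zero hz.1.1) (j := j) (fun p hp hpj => ?_) hp hpj
    rcases Nat.lt_or_eq_of_le hpj with hpj | rfl
    · rw [Perm.mul_apply, swap_apply_of_ne_of_ne (by omega) (by omega)]
      exact hc.row p hp hpj
    · rw [Perm.mul_apply, swap_apply_left]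
      rw [hc.apply] at hlt; exact hlt
  · rw [(invStat_dUs (one_mem_involutions (n + 1)) hl').2.2 h1,
      (invStat_dUs (one_mem_involutions (n + 1)) hl).2.2 h2]
    simp; ring

lemma permOn_row {D : Finset (ℕ × ℕ)} {j t : ℕ} (hj : 1 ≤ j)
    (h : ∀ b, 1 ≤ b → b ≤ t → (j, b) ∈ D) : permOn D (rowCells j t) j = j + t := by
  induction t with
  | zero => rfl
  | succ t ih =>
    rw [rowCells, permOn_cons_mem (h _ (by omega) le_rfl), Perm.mul_apply,
      ih fun b h1 h2 => h b h1 (by omega)]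
    simp only
    rw [show j + (t + 1) - 1 = j + t by omega, simpleT_left]; omega

lemma permOn_cellsAfter_row {N : ℕ} {D : Finset (ℕ × ℕ)} {j i : ℕ} (hj : 1 ≤ j) (hi : 1 ≤ i)
    (h : ∀ b, 1 ≤ b → b < i → (j, b) ∈ D) : permOn D (cellsAfter N j i) j = j + i - 1 := by
  have h1 : permOn D (boxCells N (j + 1) (N - j)) j = j := by
    apply permOn_apply_of_ne
    intro c hc _
    rw [mem_boxCells] at hc; omega
  rw [cellsAfter, permOn_append, Perm.mul_apply, h1,
    permOn_row hj fun b h1 h2 => h b h1 (by omega)]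
  omega

/-- Row j is full to the left of the corner, so the pipe reaching the corner from the left is j. The
pipe s entering from below satisfies s > j by reducedness, and inserting the letter multiplies the
atom by t_{js}. -/
lemma IsCorner.insert_mem_Psi {n : ℕ} {y z : Perm ℕ} {E : Finset (ℕ × ℕ)} {j i : ℕ}
    (hy : y ∈ involutions n) (hc : IsCorner y j i) (hjn : j ≤ n) (hij : i + j ≤ n + 1)
    (hE : E ∈ ID n y) (hz : z ∈ involutions (n + 1)) (hF : insert (j, i) E ∈ ID (n + 1) z) :
    z ∈ Psi n y j := by
  have hi := hc.pos
  have hle := hc.le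
  obtain ⟨hrect, hcE⟩ := hc.mem_of_mem_ID hy.1 hjn hE
  rw [mem_ID_iff (N := n + 1) (by omega) hy.1] at hE
  rw [mem_ID_iff (N := n + 1) (by omega) hz.1] at hF
  obtain ⟨-, -, h3, h4⟩ := hE
  obtain ⟨-, f2, f3, f4⟩ := hF
  obtain ⟨B, hB⟩ := boxCells_eq (N := n + 1) (i := j) (j := i) (by omega) (by omega) hi (by omega)
  have hlet := word_letters f2 (n + 1)
  rw [word_insert E hB] at f3 f4 hlet
  rw [word_eq_of_split E hB hcE] at h3 h4
  simp only at f3 f4 hlet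
  have hvj : wprod (wordOn E (cellsAfter (n + 1) j i)) j = j + i - 1 :=
    permOn_cellsAfter_row (by omega) hi fun b h1 h2 =>
      hrect j b h1 (by omega) le_rfl h2.le (by simp; omega)
  set v := wordOn E (cellsAfter (n + 1) j i)
  have hred := (f3.red hlet).1.of_append_right
  have hlt := (red_cons.1 hred).2
  rw [show (wprod v)⁻¹ (j + i - 1) = j by rw [Perm.inv_eq_iff_eq]; exact hvj.symm] at hlt
  have hvm : wprod v ∈ symmGroup (n + 1) := wprod_mem_symmGroup fun m hm => hlet m (by simp [hm])
  have hsn := symmGroup_le (inv_mem_symmGroup hvm) (k := j + i - 1 + 1) (by omega)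
  rw [← f4, ← h4]
  exact mem_Psi_of_words hlt hsn hlet h3 f3 hvj (by simp)

/-- If s ≤ n, the atom w t_{js} is still in S_n and determines z. The case s = n + 1 is excluded by
counting values. -/
lemma IsCorner.psi_subset {n : ℕ} {y : Perm ℕ} {j i : ℕ} (hy : y ∈ involutions n)
    (hc : IsCorner y j i) (hjn : j ≤ n) (hij : i + j ≤ n) : Psi n y j ⊆ involutions n := by
  intro z hz
  have hi := hc.pos
  have hle := hc.le
  obtain ⟨s, u, k, v, hjs, hsn, hl, h1, h2, hy', rfl, h3, h4⟩ :=
    exists_words_of_mem_Psi (by omega) hz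
  have hl' : ∀ m ∈ u ++ v, 1 ≤ m ∧ m < n := by
    intro m hm
    refine ⟨?_, letters_lt_of_mem_symmGroup (n := n) (by rw [hy']; exact hy.1) m hm⟩
    rw [List.mem_append] at hm
    exact (hl m (by simp; tauto)).1
  have hw := wprod_mem_symmGroup hl'
  rcases Nat.lt_or_eq_of_le hsn with hsn | rfl
  · have hw' := mul_mem_symmGroup hw (swap_mem_symmGroup (n := n) (p := j) (q := s) (by omega)
      (by omega) (by omega) (by omega))
    rw [wprod_mul_swap h3 h4] at hw'
    obtain ⟨c, hcl, hcw, hcr⟩ := exists_reduced_word hw'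
    have hat := wprod_mem_atoms hl h2
    rw [← (raises_of_mem_atoms hat (fun m hm => ⟨(hcl m hm).1, by have := (hcl m hm).2; omega⟩) hcw
      (by unfold Red; rw [hcw, hcr])).2]
    exact dUs_mem_involutions (one_mem_involutions n) hcl
  · exfalso
    have hinv : ∀ t, j < t → t ≤ n → y t < i := by
      intro t ht htn
      -- The atom fixes n+1, so a larger value at t would lie strictly between those at j and n+1
      -- and contradict the cover. Hence (j,t) is an inversion of the atom, and so of y.
      have hwt : ¬ wprod (u ++ v) j < wprod (u ++ v) t := by
        intro hlt
        refine no_between (symmGroup_mono (Nat.le_succ n) hw) (by omega) le_rfl ?_ ht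
          (Nat.lt_succ_of_le htn) hlt ?_
        · have r1 := (h1.red hl').1
          have r2 := (h2.red hl).1
          unfold Red at r1 r2
          rw [wprod_mul_swap h3 h4, ← r1, ← r2]
          simp; ring
        · rw [symmGroup_gt hw (Nat.lt_succ_self n)]
          exact Nat.lt_succ_of_le (symmGroup_le hw htn)
      have hne : wprod (u ++ v) j ≠ wprod (u ++ v) t := fun h => by
        have := (wprod (u ++ v)).injective h; omega
      have := (h1.red hl').2 (mem_invSet.2 ⟨ht, by omega⟩)
      rw [hy', mem_invSet, hc.apply] at this
      exact this.2
    have hcard := Finset.card_le_card_of_injOn (s := Finset.Icc (j + 1) n)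
      (t := Finset.Icc 1 (i - 1)) y (by
        intro t ht
        rw [Finset.coe_Icc, Set.mem_Icc] at ht
        rw [Finset.coe_Icc, Set.mem_Icc]
        have := hinv t (by omega) ht.2
        exact ⟨symmGroup_pos hy.1 (by omega), by omega⟩) y.injective.injOn
    rw [Nat.card_Icc, Nat.card_Icc] at hcard
    omega

/-! ### The bijection for involutions -/

lemma ID_unique {n : ℕ} {y z : Perm ℕ} (hy : y ∈ symmGroup n) (hz : z ∈ symmGroup n)
    {E : Finset (ℕ × ℕ)} (h : E ∈ ID n y) (h' : E ∈ ID n z) : y = z := by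
  rw [mem_ID_iff le_rfl hy] at h
  rw [mem_ID_iff le_rfl hz] at h'
  rw [← h.2.2.2, h'.2.2.2]

/-- The transition bijection for involution pipe dreams. -/
theorem IsCorner.transition {n : ℕ} {y : Perm ℕ} {j i : ℕ} (hy : y ∈ involutions n)
    (hc : IsCorner y j i) (hjn : j ≤ n) (hij : i + j ≤ n + 1) :
    (∀ D ∈ ID n y, (j, i) ∉ D) ∧ (Psi n y j).PairwiseDisjoint (ID (n + 1)) ∧
      Set.BijOn (fun D : Finset (ℕ × ℕ) => insert (j, i) D) (ID n y)
        (⋃ z ∈ Psi n y j, ID (n + 1) z) := by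
  have hnot : ∀ D ∈ ID n y, (j, i) ∉ D := fun D hD => (hc.mem_of_mem_ID hy.1 hjn hD).2
  refine ⟨hnot, ?_, ?_, ?_, ?_⟩
  · intro z hz z' hz' hne
    rw [Function.onFun, Set.disjoint_left]
    exact fun E hE hE' => hne (ID_unique hz.1.1 hz'.1.1 hE hE')
  · intro E hE
    obtain ⟨z, hz, hF⟩ := hc.insert_mem_ID (Nat.le_succ n) hy hjn hij hE
    exact Set.mem_biUnion (hc.insert_mem_Psi hy hjn hij hE hz hF) hF
  · intro E hE E' hE' heq
    have := congrArg (fun F : Finset (ℕ × ℕ) => F.erase (j, i)) heq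
    simpa [Finset.erase_insert (hnot E hE), Finset.erase_insert (hnot E' hE')] using this
  · intro F hF
    obtain ⟨z, hz, hF⟩ := Set.mem_iUnion₂.1 hF
    obtain ⟨h1, h2, h3⟩ := hc.of_mem_Psi hz
    obtain ⟨h4, h5⟩ := hc.erase_mem_ID (Nat.le_succ n) hy hjn hz.1 hF h1 h2 h3
    exact ⟨_, h5, Finset.insert_erase h4⟩

/-! ### Fixed-point-free involution pipe dreams -/

lemma fpfInvolutions_iff_moved {n : ℕ} {z : Perm ℕ} (hz : z ∈ involutions n) :
    moved z ≤ n ∧ (z ∈ fpfInvolutions n ↔ moved z = n) := by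
  have hsub : {p | z p ≠ p} ⊆ (Finset.Icc 1 n : Set ℕ) := by
    intro p hp
    by_contra h
    exact hp (hz.1 p (by simpa using h))
  have hcard : ((Finset.Icc 1 n : Finset ℕ) : Set ℕ).ncard = n := by
    rw [Set.ncard_coe_finset, Nat.card_Icc]; omega
  have hle := Set.ncard_le_ncard hsub (Finset.finite_toSet _)
  rw [hcard] at hle
  refine ⟨hle, fun h => ?_, fun h => ⟨hz, ?_⟩⟩
  · unfold moved
    rw [← hcard]
    congr 1
    exact hsub.antisymm fun p hp => h.2 p (by simpa using hp)
  · have := Set.eq_of_subset_of_ncard_le hsub (by rw [hcard]; exact h.ge) (Finset.finite_toSet _)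
    intro k hk
    have hk' : k ∈ {p | z p ≠ p} := by rw [this]; simpa using hk
    exact hk'

/-- The diagonal cells of the upper triangle. -/
def diagCells (n : ℕ) : Finset (ℕ × ℕ) := (Finset.Icc 1 (n / 2)).image (fun a => (a, a))

lemma mem_diagCells {n : ℕ} {c : ℕ × ℕ} : c ∈ diagCells n ↔ c.1 = c.2 ∧ 1 ≤ c.1 ∧ 2 * c.1 ≤ n := by
  rw [diagCells, Finset.mem_image]
  constructor
  · rintro ⟨a, ha, rfl⟩
    rw [Finset.mem_Icc] at ha
    exact ⟨rfl, ha.1, by dsimp only; omega⟩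
  · rintro ⟨h1, h2, h3⟩
    exact ⟨c.1, Finset.mem_Icc.2 ⟨h2, by omega⟩, Prod.ext rfl h1⟩

lemma card_diagCells (n : ℕ) : (diagCells n).card = n / 2 := by
  rw [diagCells, Finset.card_image_of_injective, Nat.card_Icc]
  · omega
  · intro a b h; exact (Prod.ext_iff.1 h).1

lemma mem_strictLowerTriangle {n : ℕ} {c : ℕ × ℕ} :
    c ∈ strictLowerTriangle n ↔ 1 ≤ c.2 ∧ c.2 < c.1 ∧ c.1 ≤ n := by
  simp [strictLowerTriangle]; omega

section

variable {n : ℕ} {z : Perm ℕ} {D E : Finset (ℕ × ℕ)}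

lemma mem_inter_strictLowerTriangle (hD : D ⊆ upperTriangle n) {c : ℕ × ℕ} :
    c ∈ D ∩ strictLowerTriangle n ↔ c.2 < c.1 ∧ c ∈ D := by
  rw [Finset.mem_inter, mem_strictLowerTriangle]
  refine ⟨fun h => ⟨h.2.2.1, h.1⟩, fun h => ⟨h.2, ?_⟩⟩
  have := mem_upperTriangle.1 (hD h.2)
  omega

/-- Reflection injects the cells above the diagonal into those strictly below it, and it is onto
exactly when D is symmetric. -/
lemma card_almostSymmetric (hD : D ⊆ upperTriangle n)
    (hs : ∀ i j, i < j → (i, j) ∈ D → (j, i) ∈ D) :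
    D.card ≤ (D ∩ lowerTriangle n).card + (D ∩ strictLowerTriangle n).card ∧
      (D.card = (D ∩ lowerTriangle n).card + (D ∩ strictLowerTriangle n).card ↔ IsSymmetric D) := by
  have h1 : D ∩ lowerTriangle n = D.filter (fun c => c.2 ≤ c.1) := by
    ext c; rw [mem_inter_lowerTriangle hD, Finset.mem_filter, and_comm]
  have h2 := Finset.card_filter_add_card_filter_not (s := D) (fun c : ℕ × ℕ => c.2 ≤ c.1)
  rw [← h1] at h2
  set U := D.filter (fun c => ¬ c.2 ≤ c.1) with hU
  have hsub : U.image Prod.swap ⊆ D ∩ strictLowerTriangle n := by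
    intro c hc
    obtain ⟨d, hd, rfl⟩ := Finset.mem_image.1 hc
    obtain ⟨hd1, hd2⟩ := Finset.mem_filter.1 hd
    exact (mem_inter_strictLowerTriangle hD).2 ⟨not_le.1 hd2, hs _ _ (not_le.1 hd2) hd1⟩
  have hcard : (U.image Prod.swap).card = U.card :=
    Finset.card_image_of_injective _ Prod.swap_injective
  have hle := Finset.card_le_card hsub
  refine ⟨by omega, fun h => ?_, fun h => ?_⟩
  · have heq := Finset.eq_of_subset_of_card_le hsub (by omega)
    intro a b hab
    rcases lt_trichotomy a b with hlt | rfl | hlt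
    · exact hs a b hlt hab
    · exact hab
    · have : (a, b) ∈ U.image Prod.swap := by
        rw [heq]; exact (mem_inter_strictLowerTriangle hD).2 ⟨hlt, hab⟩
      obtain ⟨d, hd, he⟩ := Finset.mem_image.1 this
      have hd' : d = (b, a) := by rw [← Prod.swap_swap d, he]; rfl
      rw [← hd']; exact (Finset.mem_filter.1 hd).1
  · have heq : U.image Prod.swap = D ∩ strictLowerTriangle n := by
      refine hsub.antisymm fun c hc => ?_
      obtain ⟨hc1, hc2⟩ := (mem_inter_strictLowerTriangle hD).1 hc
      exact Finset.mem_image.2 ⟨c.swap, Finset.mem_filter.2 ⟨h _ _ hc2, not_le.2 hc1⟩,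
        Prod.swap_swap c⟩
    rw [heq] at hcard
    omega

lemma IsSymmetric.almost (h : IsSymmetric D) : IsAlmostSymmetric n D :=
  ⟨fun i j _ => h i j, fun _ _ _ h1 h2 => absurd (h _ _ h1) h2⟩

lemma disjoint_diagCells (hE : E ⊆ strictLowerTriangle n) (m : ℕ) : Disjoint E (diagCells m) := by
  rw [Finset.disjoint_left]
  intro c hc hc'
  have h1 := mem_strictLowerTriangle.1 (hE hc)
  have h2 := mem_diagCells.1 hc'
  omega

lemma even_of_mem_ID (hz : z ∈ fpfInvolutions n) (hE : E ∈ ID n z) : Even n := by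
  have h1 := invStat_of_mem_ID hz.1.1 hE
  unfold invStat at h1
  rw [(fpfInvolutions_iff_moved hz.1).2.1 hz] at h1
  exact ⟨2 * E.card - invCount z, by omega⟩

/-- With n = 2k one has 2|D| + moved(z) = 4(|E| + k), while |D| ≤ 2|E| + k and moved(z) ≤ 2k. So
both bounds are equalities: D is symmetric and z has no fixed points. -/
lemma mem_FD_of_union_diagCells (hn : Even n) (hz : z ∈ involutions n)
    (hE : E ⊆ strictLowerTriangle n) (h : E ∪ diagCells n ∈ ID n z) :
    z ∈ fpfInvolutions n ∧ E ∈ FD n z := by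
  obtain ⟨k, rfl⟩ := hn
  have h1 := invStat_of_mem_ID hz.1 h
  obtain ⟨D, hD, hs, he⟩ := h
  have hDu := ((mem_PD_iff le_rfl hz.1).1 hD).1
  unfold invStat at h1
  rw [card_of_mem_PD hz.1 hD, Finset.card_union_of_disjoint (disjoint_diagCells hE _),
    card_diagCells] at h1
  obtain ⟨h2, h3⟩ := fpfInvolutions_iff_moved hz
  have hED : D ∩ strictLowerTriangle (k + k) = E := by
    ext c
    have hc : c ∈ E ∪ diagCells (k + k) ↔ c.2 ≤ c.1 ∧ c ∈ D := by rw [he]; exact mem_inter_lowerTriangle hDu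
    rw [mem_inter_strictLowerTriangle hDu]
    rw [Finset.mem_union, mem_diagCells] at hc
    constructor
    · rintro ⟨c1, c2⟩
      rcases hc.2 ⟨c1.le, c2⟩ with h | h
      · exact h
      · omega
    · intro hcE
      exact ⟨(mem_strictLowerTriangle.1 (hE hcE)).2.1, (hc.1 (Or.inl hcE)).2⟩
  obtain ⟨h4, h5⟩ := card_almostSymmetric hDu hs.1
  rw [hED, ← he, Finset.card_union_of_disjoint (disjoint_diagCells hE _), card_diagCells] at h4 h5
  exact ⟨h3.2 (by omega), D, hD, h5.1 (by omega), hED.symm⟩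

/-- The same count read backwards: 2|D| + n = 4|D ∩ lower| forces n/2 diagonal cells, which is all
of them. -/
lemma inter_lowerTriangle_of_symmetric (hz : z ∈ fpfInvolutions n) (hD : D ∈ PD n z)
    (hs : IsSymmetric D) :
    D ∩ lowerTriangle n = (D ∩ strictLowerTriangle n) ∪ diagCells n := by
  have hDu := ((mem_PD_iff le_rfl hz.1.1).1 hD).1
  have h1 := invStat_of_mem_ID hz.1.1 ⟨D, hD, hs.almost, rfl⟩
  unfold invStat at h1
  rw [(fpfInvolutions_iff_moved hz.1).2.1 hz, card_of_mem_PD hz.1.1 hD] at h1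
  have h2 := (card_almostSymmetric hDu (fun i j _ => hs i j)).2.2 hs
  have hsub : D ∩ lowerTriangle n ⊆ (D ∩ strictLowerTriangle n) ∪ diagCells n := by
    intro c hc
    rw [mem_inter_lowerTriangle hDu] at hc
    rw [Finset.mem_union, mem_inter_strictLowerTriangle hDu, mem_diagCells]
    have := mem_upperTriangle.1 (hDu hc.2)
    rcases Nat.lt_or_eq_of_le hc.1 with h | h
    · exact Or.inl ⟨h, hc.2⟩
    · right; omega
  refine Finset.eq_of_subset_of_card_le hsub ?_
  refine (Finset.card_union_le _ _).trans ?_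
  rw [card_diagCells]
  omega

lemma mem_FD_iff (hz : z ∈ fpfInvolutions n) :
    E ∈ FD n z ↔ E ⊆ strictLowerTriangle n ∧ E ∪ diagCells n ∈ ID n z := by
  constructor
  · rintro ⟨D, hD, hs, rfl⟩
    exact ⟨Finset.inter_subset_right, D, hD, hs.almost,
      (inter_lowerTriangle_of_symmetric hz hD hs).symm⟩
  · rintro ⟨h1, h2⟩
    exact (mem_FD_of_union_diagCells (even_of_mem_ID hz h2) hz.1 h1 h2).2

lemma mem_iff_of_symmetric (hD : D ⊆ upperTriangle n) (hs : IsSymmetric D) (a b : ℕ) :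
    (a, b) ∈ D ↔ (max a b, min a b) ∈ D ∩ lowerTriangle n := by
  rw [mem_inter_lowerTriangle hD]
  rcases le_total b a with h | h
  · rw [max_eq_left h, min_eq_right h]; simp [h]
  · rw [max_eq_right h, min_eq_left h]
    exact ⟨fun hab => ⟨h, hs _ _ hab⟩, fun hab => hs _ _ hab.2⟩

/-! ### Stabilization of fixed-point-free involutions -/

lemma mul_simpleT_mem_fpfInvolutions (hz : z ∈ fpfInvolutions n) :
    z * simpleT (n + 1) ∈ fpfInvolutions (n + 2) := by
  have h1 : z (n + 1) = n + 1 := symmGroup_gt hz.1.1 (by omega)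
  have h2 : z (n + 1 + 1) = n + 1 + 1 := symmGroup_gt hz.1.1 (by omega)
  have hmem := mul_mem_symmGroup (symmGroup_mono (n := n) (N := n + 2) (by omega) hz.1.1)
    (simpleT_mem_symmGroup (n := n + 2) (m := n + 1) (by omega) (by omega))
  refine ⟨mem_involutions_iff.2 ⟨hmem, ?_⟩, fun k hk => ?_⟩
  · rw [mul_inv_rev, simpleT_inv, involutions_inv hz.1, simpleT_comm_of_fix h1 h2]
  · rw [Finset.mem_Icc] at hk
    rw [Perm.mul_apply, simpleT_apply]
    split_ifs with h h'
    · rw [h2]; omega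
    · rw [h1]; omega
    · exact hz.2 k (Finset.mem_Icc.2 ⟨hk.1, by omega⟩)

lemma mul_simpleT_apply (z : Perm ℕ) {p : ℕ} (hp : p ≤ n) : (z * simpleT (n + 1)) p = z p := by
  rw [Perm.mul_apply, simpleT_of_ne (by omega) (by omega)]

/-- The diagonal cell with h = (n+2)/2 has letter n+1, which commutes with z, so adding it realises
z s_{n+1} without changing the strict lower half. -/
lemma insert_diag_mem_PD (hz : z ∈ fpfInvolutions n) {h : ℕ} (hh : 2 * h = n + 2)
    (hD : D ∈ PD n z) (hs : IsSymmetric D) :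
    insert (h, h) D ∈ PD (n + 2) (z * simpleT (n + 1)) ∧ IsSymmetric (insert (h, h) D) ∧
      insert (h, h) D ∩ strictLowerTriangle (n + 2) = D ∩ strictLowerTriangle n := by
  have hY := (mul_simpleT_mem_fpfInvolutions hz).1.1
  rw [mem_PD_iff (N := n + 2) (by omega) hz.1.1] at hD
  obtain ⟨hDu, hr, hw⟩ := hD
  have hcD : (h, h) ∉ D := fun hc => by
    have := mem_upperTriangle.1 (hDu hc); simp only at this; omega
  have hsub : insert (h, h) D ⊆ upperTriangle (n + 2) := by
    intro c hc
    rw [Finset.mem_insert] at hc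
    rw [mem_upperTriangle]
    rcases hc with rfl | hc
    · simp only; omega
    · have := mem_upperTriangle.1 (hDu hc); omega
  have h1 : z (n + 1) = n + 1 := symmGroup_gt hz.1.1 (by omega)
  have h2 : z (n + 1 + 1) = n + 1 + 1 := symmGroup_gt hz.1.1 (by omega)
  have hwire : wiring (n + 2) (insert (h, h) D) = z * simpleT (n + 1) := by
    rw [wiring_insert_first (c := (h, h)), hw]
    · simp only
      rw [show h + h - 1 = n + 1 by omega, simpleT_comm_of_fix h1 h2]
    · rw [mem_boxCells]; simp only; omega
    · exact hcD
    · intro d hd _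
      have := mem_upperTriangle.1 (hDu hd)
      simp only; omega
  refine ⟨(mem_PD_iff le_rfl hY).2 ⟨hsub, (red_word_iff le_rfl hsub).2 ?_, hwire⟩, ?_, ?_⟩
  · rw [hwire, (invCount_mul_simpleT (finite_invSet hz.1.1) (by omega)).2,
      Finset.card_insert_of_notMem hcD, ← hw, (red_word_iff (by omega) hDu).1 hr]
  · intro a b hab
    rw [Finset.mem_insert, Prod.ext_iff] at hab ⊢
    rcases hab with hab | hab
    · left; simp only at hab ⊢; omega
    · exact Or.inr (hs a b hab)
  · ext c
    rw [mem_inter_strictLowerTriangle hsub, mem_inter_strictLowerTriangle hDu, Finset.mem_insert]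
    constructor
    · rintro ⟨h1, rfl | h2⟩
      · simp only at h1; omega
      · exact ⟨h1, h2⟩
    · exact fun h => ⟨h.1, Or.inr h.2⟩

lemma wordOn_filter_lt (D : Finset (ℕ × ℕ)) (l : List (ℕ × ℕ)) (K : ℕ) :
    (wordOn D l).filter (· < K) = wordOn (D.filter (fun c => c.1 + c.2 - 1 < K)) l := by
  induction l with
  | nil => rfl
  | cons c l ih =>
    by_cases hc : c ∈ D
    · rw [wordOn_cons_mem hc, List.filter_cons, ih]
      by_cases hK : c.1 + c.2 - 1 < K
      · rw [wordOn_cons_mem (Finset.mem_filter.2 ⟨hc, hK⟩)]; simp [hK]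
      · rw [wordOn_cons_not_mem (fun h => hK (Finset.mem_filter.1 h).2)]; simp [hK]
    · rw [wordOn_cons_not_mem hc, wordOn_cons_not_mem (fun h => hc (Finset.mem_filter.1 h).1), ih]

/-- Letters below n commute with n+1, and repetitions of n+1 are absorbed. -/
lemma dUs_dU_of_isolated {n : ℕ} {x : Perm ℕ} (hx : x⁻¹ = x) {c : List ℕ}
    (hc : ∀ m ∈ c, m < n ∨ m = n + 1) :
    dUs (dU (n + 1) x) c = dU (n + 1) (dUs x (c.filter (· < n))) := by
  induction c generalizing x with
  | nil => rfl
  | cons m c ih =>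
    have hc' : ∀ m ∈ c, m < n ∨ m = n + 1 := fun k hk => hc k (by simp [hk])
    rcases hc m (by simp) with hm | rfl
    · rw [dUs_cons, dU_dU_comm (by omega), ih (inv_dU hx) hc', List.filter_cons]
      simp [hm]
    · rw [dUs_cons, dU_of_desc (inv_dU hx) (dU_desc hx), ih hx hc', List.filter_cons]
      simp

/-- The letter n cannot occur because z s_{n+1} preserves {1, …, n}. The word therefore splits into
letters below n and copies of n+1, and counting leaves a single n+1, coming from the diagonal cell
(h,h). -/
lemma mem_FD_of_stable (hz : z ∈ fpfInvolutions n)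
    (hE : E ∈ FD (n + 2) (z * simpleT (n + 1))) : E ∈ FD n z := by
  have hY := mul_simpleT_mem_fpfInvolutions hz
  have hzi := involutions_mono (n := n) (N := n + 2) (by omega) hz.1
  rw [mem_FD_iff hY] at hE
  obtain ⟨hEl, hE⟩ := hE
  obtain ⟨h, hh⟩ := even_of_mem_ID hY hE
  rw [mem_ID_iff le_rfl hY.1.1] at hE
  obtain ⟨e1, e2, e3, e4⟩ := hE
  set F := E ∪ diagCells (n + 2) with hF
  have hlet := word_letters e2 (n + 2)
  have hYle : ∀ p, p ≤ n → (z * simpleT (n + 1)) p ≤ n := fun p hp => by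
    rw [mul_simpleT_apply z hp]; exact symmGroup_le hz.1.1 hp
  have hnn : ∀ m ∈ word (n + 2) F, m < n ∨ m = n + 1 := by
    intro m hm
    have h1 := hlet m hm
    by_contra hcon
    obtain rfl : m = n := by omega
    have h2 : BruhatLE (simpleT m) (dUs 1 (word (m + 2) F)) := by
      have := dUs_sublist (List.singleton_sublist.2 hm) (BruhatLE.refl 1)
      rw [dUs_cons, dUs_nil, dU_of_comm rfl rfl, one_mul] at this
      exact this
    rw [e4] at h2
    have h3 := le_of_bruhatLE h2 hYle (le_refl m)
    rw [simpleT_left] at h3; omega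
  have hfil : (word (n + 2) F).filter (· < n) =
      word (n + 2) (F.filter (fun c => c.1 + c.2 - 1 < n)) := wordOn_filter_lt F _ n
  set G := F.filter (fun c => c.1 + c.2 - 1 < n) with hG
  have hGu : G ⊆ upperTriangle n := by
    intro c hc
    obtain ⟨hc1, hc2⟩ := Finset.mem_filter.1 hc
    have := mem_upperTriangle.1 (e2 hc1)
    rw [mem_upperTriangle]; omega
  have hx := dUs_mem_involutions (one_mem_involutions n) (word_letters hGu (n + 2))
  have hxb := invStat_dUs (one_mem_involutions n) (word_letters hGu (n + 2))
  have hle : BruhatLE (z * simpleT (n + 1)) (dU (n + 1) (dUs 1 (word (n + 2) G))) := by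
    rw [← hfil, ← dUs_dU_of_isolated inv_one hnn, ← e4]
    exact dUs_mono (le_dU _ _) _
  set x := dUs 1 (word (n + 2) G) with hxdef
  have hxn : x (n + 1) = n + 1 := symmGroup_gt hx.1 (by omega)
  have hxn' : x (n + 1 + 1) = n + 1 + 1 := symmGroup_gt hx.1 (by omega)
  have hxs := invStat_dU (m := n + 1) hx (by omega)
  have hm := invStat_strictMono hY.1 (dU_mem_involutions (involutions_mono (n := n) (N := n + 2)
    (by omega) hx) (by omega) (by omega)) hle
  have hYs := (invStat_dUs (one_mem_involutions (n + 2)) hlet).2.2 e3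
  rw [e4, length_word le_rfl e2] at hYs
  rw [length_word (by omega) hGu] at hxb
  rw [invStat_one] at hYs hxb
  have hhF : (h, h) ∈ F := Finset.mem_union_right _ (mem_diagCells.2 ⟨rfl, by dsimp only; omega, by dsimp only; omega⟩)
  have hhG : (h, h) ∉ G := fun hc => by
    have := mem_upperTriangle.1 (hGu hc); simp only at this; omega
  have hsub : insert (h, h) G ⊆ F :=
    Finset.insert_subset hhF (Finset.filter_subset _ _)
  have hcard := Finset.card_le_card hsub
  rw [Finset.card_insert_of_notMem hhG] at hcard
  have heq := hm.2 (by omega)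
  -- The chain invStat(z s_{n+1}) ≤ invStat(x) + 4 ≤ 4|G| + 4 ≤ 4|F| begins and ends with the same
  -- number.
  have hFG : insert (h, h) G = F := Finset.eq_of_subset_of_card_le hsub (by
    rw [Finset.card_insert_of_notMem hhG]; omega)
  rw [dU_of_comm hxn hxn'] at heq
  have hxz : z = x := mul_right_cancel heq
  have hEG : ∀ c ∈ E, c.1 + c.2 ≤ n := by
    intro c hc
    have h1 : c ∈ insert (h, h) G := by rw [hFG]; exact Finset.mem_union_left _ hc
    rcases Finset.mem_insert.1 h1 with rfl | h1
    · have := mem_strictLowerTriangle.1 (hEl hc); simp only at this; omega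
    · have := mem_upperTriangle.1 (hGu h1); omega
  have hGE : G = E ∪ diagCells n := by
    ext c
    rw [hG, Finset.mem_filter, hF, Finset.mem_union, Finset.mem_union, mem_diagCells, mem_diagCells]
    constructor
    · rintro ⟨h1 | h1, h2⟩
      · exact Or.inl h1
      · right; omega
    · rintro (h1 | h1)
      · have := hEG c h1
        have := mem_strictLowerTriangle.1 (hEl h1)
        exact ⟨Or.inl h1, by omega⟩
      · exact ⟨Or.inr (by omega), by omega⟩
  have hGl : G ⊆ lowerTriangle n := by
    intro c hc
    have h1 := mem_lowerTriangle.1 (e1 (Finset.mem_filter.1 hc).1)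
    have h2 := mem_upperTriangle.1 (hGu hc)
    rw [mem_lowerTriangle]; omega
  rw [mem_FD_iff hz, ← hGE, mem_ID_iff (N := n + 2) (by omega) hz.1.1]
  refine ⟨fun c hc => ?_, hGl, hGu, hxb.2.1 (by omega), hxz.symm⟩
  have h1 := mem_strictLowerTriangle.1 (hEl hc)
  have h2 := hEG c hc
  rw [mem_strictLowerTriangle]; omega

end

/-! ### The transition bijection for fixed-point-free involutions -/

/-- With row a full before column b, the pipe entering (a,b) from the left is a, so the new letter
amounts to t_{as}, with s the pipe from below. Reducedness gives a < s. -/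
lemma wiring_insert_of_row {N a b : ℕ} {D : Finset (ℕ × ℕ)} (ha : 1 ≤ a) (hb : 1 ≤ b)
    (hD : insert (a, b) D ⊆ upperTriangle N) (hc : (a, b) ∉ D)
    (hrow : ∀ q, 1 ≤ q → q < b → (a, q) ∈ D) :
    ∃ s, 1 ≤ s ∧ s ≤ N ∧ s ≠ a ∧ wiring N (insert (a, b) D) = wiring N D * swap a s ∧
      (Red (word N (insert (a, b) D)) → a < s) := by
  have hab := mem_upperTriangle.1 (hD (Finset.mem_insert_self _ _))
  simp only at hab
  obtain ⟨B, hB⟩ := boxCells_eq (N := N) (i := a) (j := b) ha (by omega) hb (by omega)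
  have hlet := word_letters hD N
  rw [word_insert D hB] at hlet
  simp only at hlet
  have hva : wprod (wordOn D (cellsAfter N a b)) a = a + b - 1 := permOn_cellsAfter_row ha hb hrow
  rw [wiring, wiring, word_insert D hB, word_eq_of_split D hB hc]
  simp only
  set v := wordOn D (cellsAfter N a b)
  have hvm : wprod v ∈ symmGroup N := wprod_mem_symmGroup fun m hm => hlet m (by simp [hm])
  have hvi := inv_mem_symmGroup hvm
  refine ⟨(wprod v)⁻¹ (a + b - 1 + 1), symmGroup_pos hvi (by omega), symmGroup_le hvi (by omega),
    fun h => ?_, (wprod_mul_swap hva (by simp)).symm, fun h => ?_⟩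
  · rw [Perm.inv_eq_iff_eq, hva] at h; omega
  · have hlt := (red_cons.1 h.of_append_right).2
    rwa [show (wprod v)⁻¹ (a + b - 1) = a by rw [Perm.inv_eq_iff_eq]; exact hva.symm] at hlt

lemma eq_of_swap_mul_mul_swap_involutive {Y : Perm ℕ} {j r s : ℕ} (hr : r ≠ j) (hs : s ≠ j)
    (hYj : Y j ≠ j) (hYr : Y r ≠ r) (hYs : Y s ≠ s)
    (h : swap j r * Y * swap j s = swap j s * Y * swap j r) : r = s := by
  by_contra hrs
  have h1 := Perm.congr_fun h j
  have h2 := Perm.congr_fun h s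
  have h3 := Perm.congr_fun h r
  have i1 := Y.injective.ne hr
  have i2 := Y.injective.ne hs
  have i3 := Y.injective.ne hrs
  simp only [Perm.mul_apply, swap_apply_left, swap_apply_right] at h1 h2 h3
  rw [swap_apply_of_ne_of_ne hs (Ne.symm hrs)] at h2
  rw [swap_apply_of_ne_of_ne hr hrs] at h3
  simp only [swap_apply_def] at h1 h2 h3
  split_ifs at h1 h2 h3 <;> omega

section

variable {n N : ℕ} {y z Y : Perm ℕ} {E D : Finset (ℕ × ℕ)} {j i : ℕ}

/-- Adding (i,j) multiplies Y by t_{i s'} on the right, which is a transposition of j and Y(s') on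
the left because Y(i) = j. Adding (j,i) multiplies by t_{js} on the right. Since the result is an
involution and Y has no fixed points in [N], the two transpositions coincide. -/
lemma IsCorner.eq_conj_of_insert (hc : IsCorner Y j i) (hY : Y ∈ fpfInvolutions N) (hij : i < j)
    (hijN : i + j ≤ N) (hD : D ∈ PD N Y) (hs : IsSymmetric D) (hz : z ∈ involutions N)
    (hD' : insert (j, i) (insert (i, j) D) ∈ PD N z) :
    invCount z = invCount Y + 2 ∧
      ∃ s, j < s ∧ s ≤ N ∧ z = swap j s * Y * swap j s := by
  have hi := hc.pos
  obtain ⟨hrect, hcD⟩ := hc.rect_subset hY.1.1 (by omega) hD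
  have hcD' : (i, j) ∉ D := fun h => hcD (hs _ _ h)
  have hcD'' : (j, i) ∉ insert (i, j) D := by
    rw [Finset.mem_insert, Prod.mk.injEq]
    rintro (h | h)
    · omega
    · exact hcD h
  constructor
  · rw [card_of_mem_PD hz.1 hD', card_of_mem_PD hY.1.1 hD, Finset.card_insert_of_notMem hcD'',
      Finset.card_insert_of_notMem hcD']
  obtain ⟨u1, u2, u3⟩ := (mem_PD_iff le_rfl hz.1).1 hD'
  have hwD := ((mem_PD_iff le_rfl hY.1.1).1 hD).2.2
  obtain ⟨s', p1, p2, p3, p4, -⟩ := wiring_insert_of_row hi (by omega)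
    ((Finset.subset_insert _ _).trans u1) hcD'
    fun q h1 h2 => hs _ _ (hrect q i h1 h2.le hi le_rfl (by simp; omega))
  obtain ⟨s, q1, q2, q3, q4, q5⟩ := wiring_insert_of_row (by omega) hi u1 hcD''
    fun q h1 h2 => Finset.mem_insert_of_mem
      (hrect j q (by omega) le_rfl h1 h2.le (by simp; omega))
  have hYi : Y i = j := by rw [← hc.apply]; exact inv_apply_of_inv (involutions_inv hY.1) j
  rw [u3, p4, hwD, Equiv.mul_swap_eq_swap_mul Y i s', hYi] at q4
  refine ⟨s, q5 u2, q2, ?_⟩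
  have hr1 := symmGroup_pos hY.1.1 p1
  have hr2 := symmGroup_le hY.1.1 p2
  have hrj : Y s' ≠ j := fun h => p3 (Y.injective (h.trans hYi.symm))
  have hfp : ∀ k, 1 ≤ k → k ≤ N → Y k ≠ k := fun k h1 h2 => hY.2 k (Finset.mem_Icc.2 ⟨h1, h2⟩)
  have hrs := eq_of_swap_mul_mul_swap_involutive hrj q3 (hfp j (by omega) (by omega))
    (hfp _ hr1 hr2) (hfp s q1 q2) (by
      rw [← q4, ← involutions_inv hz, q4, mul_inv_rev, mul_inv_rev, swap_inv, swap_inv,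
        involutions_inv hY.1, mul_assoc])
  rw [q4, hrs]

/-- An increase of 2 under conjugation forces Y(s) > Y(j) = i. Both multiplications then go up, so
each contributes exactly 1. -/
lemma IsCorner.lt_of_invCount_conj (hc : IsCorner Y j i) (hY : Y ∈ fpfInvolutions N) (hij : i < j)
    {s : ℕ} (hjs : j < s) (hsN : s ≤ N)
    (h : invCount (swap j s * Y * swap j s) = invCount Y + 2) :
    i < Y s ∧ invCount (Y * swap j s) = invCount Y + 1 ∧ BruhatLE Y (Y * swap j s) ∧
      BruhatLE (Y * swap j s) (swap j s * Y * swap j s) := by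
  have hi := hc.pos
  have hinv := involutions_inv hY.1
  have hYj := hc.apply
  have ht := swap_mem_symmGroup (n := N) (p := j) (q := s) (by omega) (by omega) (by omega) hsN
  have hYt := mul_mem_symmGroup hY.1.1 ht
  have htY := mul_mem_symmGroup ht hY.1.1
  have hiv : (swap j s * Y)⁻¹ = Y * swap j s := by rw [mul_inv_rev, swap_inv, hinv]
  have hcount : invCount (swap j s * Y) = invCount (Y * swap j s) := by rw [← invCount_inv, hiv]
  have hj : (swap j s * Y) j = i := by
    rw [Perm.mul_apply, hYj, swap_apply_of_ne_of_ne (by omega) (by omega)]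
  have hlt : i < Y s := by
    -- If Y(s) < Y(j), both multiplications would lower the length.
    by_contra hcon
    have hne : Y s ≠ Y j := Y.injective.ne (by omega)
    have h1 := invCount_lt_mul_swap hYt hjs (by omega) hsN (by
      rw [Perm.mul_apply, Perm.mul_apply, swap_apply_left, swap_apply_right]; omega)
    rw [mul_assoc, swap_mul_self, mul_one] at h1
    have h2 := invCount_lt_mul_swap (mul_mem_symmGroup htY ht) hjs (by omega) hsN (by
      rw [Perm.mul_apply _ (swap j s), Perm.mul_apply _ (swap j s), swap_apply_left,
        swap_apply_right, hj, Perm.mul_apply, swap_apply_of_ne_of_ne (by omega) (by omega)]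
      omega)
    rw [mul_assoc (swap j s * Y), swap_mul_self, mul_one] at h2
    omega
  have hs : i < (swap j s * Y) s := by
    rw [Perm.mul_apply, swap_apply_def]; split_ifs <;> omega
  have h1 := invCount_lt_mul_swap hY.1.1 hjs (by omega) hsN (by rw [hYj]; exact hlt)
  have h2 := invCount_lt_mul_swap htY hjs (by omega) hsN (by rw [hj]; exact hs)
  refine ⟨hlt, by omega, le_mul_swap hjs.le (by rw [hYj]; exact hlt.le), ?_⟩
  have h3 := (le_mul_swap (x := swap j s * Y) hjs.le (by rw [hj]; exact hs.le)).inv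
  rwa [hiv, mul_inv_rev, hiv, swap_inv, ← mul_assoc] at h3

lemma IsCorner.mul_simpleT (hc : IsCorner y j i) (hjn : j ≤ n) :
    IsCorner (y * simpleT (n + 1)) j i where
  pos := hc.pos
  le := hc.le
  apply := by rw [mul_simpleT_apply y hjn, hc.apply]
  row p h1 h2 := by rw [mul_simpleT_apply y (by omega)]; exact hc.row p h1 h2
  col b h1 h2 := by
    have := hc.le
    rw [mul_simpleT_apply y (by omega)]; exact hc.col b h1 h2

lemma exists_conj_of_mem_PsiFpf (hy : y ∈ fpfInvolutions n) (hz : z ∈ PsiFpf n y j) :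
    ∃ s, j < s ∧ s ≤ n + 2 ∧ z = swap j s * (y * simpleT (n + 1)) * swap j s ∧
      invCount (swap j s * (y * simpleT (n + 1)) * swap j s) =
        invCount (y * simpleT (n + 1)) + 2 := by
  obtain ⟨hz1, hz2, s, h1, h2, h3⟩ := hz
  refine ⟨s, h1, h2, h3, ?_⟩
  rwa [len_eq_invCount hz1.1.1, len_eq_invCount (mul_simpleT_mem_fpfInvolutions hy).1.1, h3] at hz2

lemma IsCorner.of_mem_PsiFpf (hc : IsCorner y j i) (hy : y ∈ fpfInvolutions n) (hij : i < j)
    (hjn : j ≤ n) (hz : z ∈ PsiFpf n y j) :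
    (∀ p, 1 ≤ p → p ≤ j → i < z p) ∧ BruhatLE (y * simpleT (n + 1)) z ∧
      invStat z = invStat (y * simpleT (n + 1)) + 4 := by
  have hY := mul_simpleT_mem_fpfInvolutions hy
  have hcY := hc.mul_simpleT hjn
  obtain ⟨s, hjs, hsn, rfl, hcount⟩ := exists_conj_of_mem_PsiFpf hy hz
  obtain ⟨h1, -, h2, h3⟩ := hcY.lt_of_invCount_conj hY hij hjs hsn hcount
  refine ⟨fun p hp hpj => ?_, h2.trans h3, ?_⟩
  · refine lt_of_bruhatLE h3 (symmGroup_zero hz.1.1.1) (j := j) (fun p hp hpj => ?_) hp hpj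
    rcases Nat.lt_or_eq_of_le hpj with hpj | rfl
    · rw [Perm.mul_apply, swap_apply_of_ne_of_ne (by omega) (by omega)]
      exact hcY.row p hp hpj
    · rw [Perm.mul_apply, swap_apply_left]; exact h1
  · unfold invStat
    rw [(fpfInvolutions_iff_moved hz.1.1).2.1 hz.1, (fpfInvolutions_iff_moved hY.1).2.1 hY, hcount]
    ring

lemma IsCorner.notMem_of_mem_FD (hc : IsCorner y j i) (hy : y ∈ involutions n) (hjn : j ≤ n)
    (hE : E ∈ FD n y) : (j, i) ∉ E := by
  obtain ⟨D, hD, -, rfl⟩ := hE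
  exact fun h => (hc.rect_subset hy.1 hjn hD).2 (Finset.mem_of_mem_inter_left h)

/-- After stabilising and adding all diagonal cells, the involution case yields z. The diagonal
count makes z fixed-point-free and its pipe dream symmetric. -/
lemma IsCorner.insert_mem_FD (hc : IsCorner y j i) (hy : y ∈ fpfInvolutions n) (hij : i < j)
    (hjn : j ≤ n) (hijn : i + j ≤ n + 1) (hE : E ∈ FD n y) :
    ∃ z ∈ PsiFpf n y j, insert (j, i) E ∈ FD (n + 2) z := by
  have hi := hc.pos
  have hY := mul_simpleT_mem_fpfInvolutions hy
  have hcY := hc.mul_simpleT hjn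
  obtain ⟨k, hk⟩ := even_of_mem_ID hy ((mem_FD_iff hy).1 hE).2
  have hev : Even (n + 2) := ⟨k + 1, by omega⟩
  obtain ⟨D, hD, hs, hED⟩ := hE
  obtain ⟨d1, d2, d3⟩ := insert_diag_mem_PD hy (h := k + 1) (by omega) hD hs
  set D₁ := insert (k + 1, k + 1) D
  rw [← d3] at hED
  obtain ⟨e1, e2⟩ := (mem_FD_iff hY).1 ⟨D₁, d1, d2, hED⟩
  obtain ⟨z, hz, hF⟩ := hcY.insert_mem_ID le_rfl hY.1 (by omega) (by omega) e2
  rw [← Finset.insert_union] at hF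
  have hsub : insert (j, i) E ⊆ strictLowerTriangle (n + 2) :=
    Finset.insert_subset (mem_strictLowerTriangle.2 ⟨hi, hij, by dsimp only; omega⟩) e1
  obtain ⟨hzf, hFD⟩ := mem_FD_of_union_diagCells hev hz hsub hF
  obtain ⟨D₂, g1, g2, g3⟩ := hFD
  have hD₁ := ((mem_PD_iff le_rfl hY.1.1).1 d1).1
  have hD₂ := ((mem_PD_iff le_rfl hz.1).1 g1).1
  -- Symmetric pipe dreams are determined by their lower halves, which differ only by the corner.
  have hEq : D₂ = insert (j, i) (insert (i, j) D₁) := by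
    ext ⟨a, b⟩
    rw [Finset.mem_insert, Finset.mem_insert, mem_iff_of_symmetric hD₂ g2,
      mem_iff_of_symmetric hD₁ d2, inter_lowerTriangle_of_symmetric hzf g1 g2,
      inter_lowerTriangle_of_symmetric hY d1 d2, ← g3, ← hED, Finset.insert_union,
      Finset.mem_insert, ← or_assoc]
    apply or_congr_left
    simp only [Prod.mk.injEq]
    omega
  rw [hEq] at g1
  obtain ⟨c1, s, hjs, hsn, c2⟩ := hcY.eq_conj_of_insert hY hij (by omega) d1 d2 hz g1
  refine ⟨z, ⟨hzf, ?_, s, hjs, hsn, c2⟩, D₂, hEq ▸ g1, g2, g3⟩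
  rw [len_eq_invCount hz.1, len_eq_invCount hY.1.1, c1]

lemma IsCorner.erase_mem_FD (hc : IsCorner y j i) (hy : y ∈ fpfInvolutions n) (hij : i < j)
    (hjn : j ≤ n) (hz : z ∈ PsiFpf n y j) (hE : E ∈ FD (n + 2) z) :
    (j, i) ∈ E ∧ E.erase (j, i) ∈ FD n y := by
  have hY := mul_simpleT_mem_fpfInvolutions hy
  obtain ⟨h1, h2, h3⟩ := hc.of_mem_PsiFpf hy hij hjn hz
  obtain ⟨e1, e2⟩ := (mem_FD_iff hz.1).1 hE
  obtain ⟨h4, h5⟩ := (hc.mul_simpleT hjn).erase_mem_ID le_rfl hY.1 (by omega) hz.1.1 e2 h1 h2 h3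
  have hd : (j, i) ∉ diagCells (n + 2) := fun h => by
    have := (mem_diagCells.1 h).1
    simp only at this; omega
  refine ⟨(Finset.mem_union.1 h4).resolve_right hd, mem_FD_of_stable hy ((mem_FD_iff hY).2
    ⟨(Finset.erase_subset _ _).trans e1, ?_⟩)⟩
  rwa [Finset.erase_union_distrib, Finset.erase_eq_of_notMem hd] at h5

/-- The transition bijection for fixed-point-free involution pipe dreams. -/
theorem IsCorner.fpf_transition (hc : IsCorner y j i) (hy : y ∈ fpfInvolutions n) (hij : i < j)
    (hjn : j ≤ n) (hijn : i + j ≤ n + 1) :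
    (∀ D ∈ FD n y, (j, i) ∉ D) ∧ (PsiFpf n y j).PairwiseDisjoint (FD (n + 2)) ∧
      Set.BijOn (fun D : Finset (ℕ × ℕ) => insert (j, i) D) (FD n y)
        (⋃ z ∈ PsiFpf n y j, FD (n + 2) z) := by
  have hnot : ∀ D ∈ FD n y, (j, i) ∉ D := fun D hD => hc.notMem_of_mem_FD hy.1 hjn hD
  refine ⟨hnot, ?_, ?_, ?_, ?_⟩
  · intro z hz z' hz' hne
    rw [Function.onFun, Set.disjoint_left]
    exact fun E hE hE' => hne (ID_unique hz.1.1.1 hz'.1.1.1 ((mem_FD_iff hz.1).1 hE).2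
      ((mem_FD_iff hz'.1).1 hE').2)
  · intro E hE
    obtain ⟨z, hz, hF⟩ := hc.insert_mem_FD hy hij hjn hijn hE
    exact Set.mem_biUnion hz hF
  · intro E hE E' hE' heq
    have := congrArg (fun F : Finset (ℕ × ℕ) => F.erase (j, i)) heq
    simpa [Finset.erase_insert (hnot E hE), Finset.erase_insert (hnot E' hE')] using this
  · intro F hF
    obtain ⟨z, hz, hF⟩ := Set.mem_iUnion₂.1 hF
    obtain ⟨h1, h2⟩ := hc.erase_mem_FD hy hij hjn hz hF
    exact ⟨_, h2, Finset.insert_erase h1⟩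

/-- If s ≤ n, then t_{js} commutes with s_{n+1} and conjugation acts on y itself. If s > n, then
Y(s) > n, so the cover leaves only values below i at positions j+1, …, n, which is impossible when i
+ j ≤ n. -/
lemma IsCorner.psiFpf_subset (hc : IsCorner y j i) (hy : y ∈ fpfInvolutions n) (hij : i < j)
    (hjn : j ≤ n) (hijn : i + j ≤ n) :
    PsiFpf n y j ⊆ {u | ∃ z ∈ fpfInvolutions n, u = z * simpleT (n + 1)} := by
  intro z hz
  have hi := hc.pos
  have hY := mul_simpleT_mem_fpfInvolutions hy
  have hcY := hc.mul_simpleT hjn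
  obtain ⟨s, hjs, hsn, rfl, hcount⟩ := exists_conj_of_mem_PsiFpf hy hz
  obtain ⟨h1, h2, -, -⟩ := hcY.lt_of_invCount_conj hY hij hjs hsn hcount
  have hYle : ∀ p, p ≤ n → (y * simpleT (n + 1)) p ≤ n := fun p hp => by
    rw [mul_simpleT_apply y hp]; exact symmGroup_le hy.1.1 hp
  rcases le_or_gt s n with hs | hs
  · have ht := swap_mem_symmGroup (n := n) (p := j) (q := s) (by omega) (by omega) (by omega) hs
    refine ⟨swap j s * y * swap j s, ⟨mem_involutions_iff.2 ⟨mul_mem_symmGroup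
      (mul_mem_symmGroup ht hy.1.1) ht, ?_⟩, fun k hk h => ?_⟩, ?_⟩
    · rw [mul_inv_rev, mul_inv_rev, swap_inv, involutions_inv hy.1, mul_assoc]
    · rw [Finset.mem_Icc] at hk
      refine hy.2 (swap j s k) (Finset.mem_Icc.2 ⟨symmGroup_pos ht hk.1, symmGroup_le ht hk.2⟩) ?_
      have h' := congrArg (swap j s) h
      rwa [Perm.mul_apply, Perm.mul_apply, swap_apply_self] at h'
    · rw [mul_assoc, mul_assoc, mul_assoc, mul_assoc,
        simpleT_comm_of_fix (symmGroup_gt ht (by omega)) (symmGroup_gt ht (by omega))]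
  · exfalso
    have hYs : n < (y * simpleT (n + 1)) s := by
      by_contra hcon
      have := hYle _ (not_lt.1 hcon)
      rw [inv_apply_of_inv (involutions_inv hY.1)] at this; omega
    have hlt : ∀ t, j < t → t ≤ n → (y * simpleT (n + 1)) t < i := by
      intro t htj htn
      by_contra hcon
      have hne := (y * simpleT (n + 1)).injective.ne (show t ≠ j by omega)
      rw [hcY.apply] at hne
      exact no_between hY.1.1 (by omega) hsn h2 htj (by omega) (by rw [hcY.apply]; omega)
        ((hYle t htn).trans_lt hYs)
    have hcard := Finset.card_le_card_of_injOn (s := Finset.Icc (j + 1) n)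
      (t := Finset.Icc 1 (i - 1)) (fun t => (y * simpleT (n + 1)) t) (by
        intro t ht
        rw [Finset.coe_Icc, Set.mem_Icc] at ht
        rw [Finset.coe_Icc, Set.mem_Icc]
        exact ⟨symmGroup_pos hY.1.1 (k := t) (by omega),
          Nat.le_sub_one_of_lt (hlt t (by omega) ht.2)⟩) (Equiv.injective _).injOn
    rw [Nat.card_Icc, Nat.card_Icc] at hcard
    omega

end

end InvPipe

/-! ### Assembly of both cases -/

theorem theorem4p22 (n : ℕ) (hn : 0 < n) :
    (∀ y ∈ InvPipe.involutions n, ∀ i j : ℕ, i ≤ j → InvPipe.IsOuterCornerOf n y (j, i) →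
      ((∀ D ∈ InvPipe.ID n y, (j, i) ∉ D) ∧
        (InvPipe.Psi n y j).PairwiseDisjoint (InvPipe.ID (n + 1)) ∧
        Set.BijOn (fun D : Finset (ℕ × ℕ) => insert (j, i) D)
          (InvPipe.ID n y) (⋃ z ∈ InvPipe.Psi n y j, InvPipe.ID (n + 1) z)) ∧
      (i + j ≤ n → InvPipe.Psi n y j ⊆ InvPipe.involutions n)) ∧
    (∀ y ∈ InvPipe.fpfInvolutions n, ∀ i j : ℕ, i < j → InvPipe.IsOuterCornerOf n y (j, i) →
      ((∀ D ∈ InvPipe.FD n y, (j, i) ∉ D) ∧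
        (InvPipe.PsiFpf n y j).PairwiseDisjoint (InvPipe.FD (n + 2)) ∧
        Set.BijOn (fun D : Finset (ℕ × ℕ) => insert (j, i) D)
          (InvPipe.FD n y) (⋃ z ∈ InvPipe.PsiFpf n y j, InvPipe.FD (n + 2) z)) ∧
      (i + j ≤ n → InvPipe.PsiFpf n y j ⊆
        {u | ∃ z ∈ InvPipe.fpfInvolutions n, u = z * InvPipe.simpleT (n + 1)})) := by
  refine ⟨fun y hy i j hij h => ?_, fun y hy i j hij h => ?_⟩
  · obtain ⟨hc, hjn, hijn⟩ := InvPipe.isCorner_of_isOuterCornerOf hn hy hij h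
    exact ⟨hc.transition hy hjn hijn, hc.psi_subset hy hjn⟩
  · obtain ⟨hc, hjn, hijn⟩ := InvPipe.isCorner_of_isOuterCornerOf hn hy.1 hij.le h
    exact ⟨hc.fpf_transition hy hij hjn hijn, hc.psiFpf_subset hy hij hjn⟩
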